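/- Let $\mathcal P$ be a probability measure on $\mathbb R$ that has a density $f$ with respect to Lebesgue measure, has mean zero, and for which there are constants $\sigma,\beta\in(0,\infty)$ with $\mathbb E_{\mathcal P}|X|^k\le \sigma^k k^{\beta k}$ for all integers $k\ge 1$. For $n\ge 1$ let $I_n=\{(i,j):1\le i\le j\le n\}$ and, for $x=(x_{ij})_{(i,j)\in I_n}\in\mathbb R^{I_n}$, let $M_n(x)$ be the real symmetric $n\times n$ matrix whose entries on and above the diagonal are the $x_{ij}$. Let $$\mathcal S_n=\{v\in\mathbb R^n:\ \|v\|_2=1,\ v_1\ge 0\}$$ with the Euclidean metric $d_n$, and $\psi_n(x;v)=v^{\top}M_n(x)v$ for $v\in\mathcal S_n$, so that $\psi_n(x;\cdot)$ has minimum $\lambda_1(M_n(x))$, the smallest eigenvalue, attained exactly at the unit eigenvectors in $\mathcal S_n$ for this eigenvalue. Let $\widehat v_n(x)$ denote a minimizer of $\psi_n(x;\cdot)$ over $\mathcal S_n$. (0) For every $n$, if the entries of $X^n=(X_{n,ij})_{(i,j)\in I_n}$ are i.i.d. with law $\mathcal P$ (so that $M_n(X^n)$ is a Wigner matrix), then almost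 surely $\psi_n(X^n;\cdot)$ has exactly one minimizer; moreover $x\mapsto\widehat v_n(x)$ is measurable with respect to the completion of the product $\sigma$-algebra under $\mathcal P^{\otimes I_n}$, and $\lambda_1(M_n(X^n))$ is an integrable random variable. *Stability.* For each $n$ let $\mathcal L_n$ be a finite non-empty set, $m_n=|\mathcal L_n|$, and let $J_{n,l}$ ($l\in\mathcal L_n$) be subsets of $I_n$ with union $I_n$ (the perturbation blocks). For each $n$ let $X^n\sim\mathcal P^{\otimes I_n}$, and for each $l\in\mathcal L_n$ let $X^{n,l}$ be an independent copy of $X^n$, with nothing else assumed about the joint law of $(X^n,(X^{n,l})_{l\in\mathcal L_n})$. Let $X^n_l$ be $X^n$ with the coordinates in $J_{n,l}$ replaced by those of $X^{n,l}$. For $A\subseteq\mathcal L_n$ put $\mathcal O_{n,A}=\{\widehat v_n(X^n_l): l\in A\}$, and let $P(T,d_n,\varepsilon)$ be the largest number of points of $T$ with pairwise $d_n$-distances greater than $\varepsilon$. The minimization problem is *stable under small perturbations* with blocks $\{J_{n,l}\}$ if for all $\varepsilon,\delta>0$ there is $M(\varepsilon,\delta)<\infty$ such that, for every such choice of the joint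 laws, $$\limsup_{n\to\infty}\ \mathbb P\Bigl[\ \min_{A\subseteq\mathcal L_n:\ |A|>(1-\varepsilon)m_n} P(\mathcal O_{n,A},d_n,\varepsilon)\ \ge\ M(\varepsilon,\delta)\Bigr]\ \le\ \delta .$$ (1) (Replacing one entry.) The problem is stable under small perturbations with the blocks $J_{n,(i,j)}=\{(i,j)\}$, $(i,j)\in\mathcal L_n=I_n$. (2) (Replacing a row and the corresponding column.) The problem is stable under small perturbations with the blocks $J_{n,i}=\{(i,j): j\ge i\}\cup\{(j,i): j\le i\}$, $i\in\mathcal L_n=\{1,\dots,n\}$. -/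

import Mathlib

open MeasureTheory ProbabilityTheory Filter Topology

universe u

noncomputable section

namespace RandomOpt

/-! ### Random minimization problems and stability under small perturbations

A random minimization problem has an input law `P` on `𝒳`, a finite index set `I` of inputs,
a metric space `S` of parameters, and an objective function `ψ : (I → 𝒳) → S → ℝ`, to be
minimized in the second argument when the inputs are i.i.d. with law `P`. -/

section Problem

variable {𝒳 I S : Type*}

/-- `s` minimizes the objective function at the input `x`. -/
def IsMinimizer (ψ : (I → 𝒳) → S → ℝ) (x : I → 𝒳) (s : S) : Prop :=
  ∀ t : S, ψ x s ≤ ψ x t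

/-- The optimal value `inf_s ψ (x; s)`. -/
def optValue (ψ : (I → 𝒳) → S → ℝ) (x : I → 𝒳) : ℝ :=
  ⨅ s : S, ψ x s

/-- The optimal solution: a parameter that minimizes `ψ (x; ·)`, whenever there is one. It is
the minimizer wherever the minimizer is unique. -/
def optimizer [Nonempty S] (ψ : (I → 𝒳) → S → ℝ) (x : I → 𝒳) : S :=
  Classical.epsilon (IsMinimizer ψ x)

/-- The problem is well posed: for i.i.d. inputs with law `P` there is almost surely exactly one
minimizer, the optimal solution is measurable for the completed product σ-algebra, and the
optimal value is an integrable random variable. -/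
structure WellPosed [MeasurableSpace 𝒳] [Fintype I] [Nonempty S] [MeasurableSpace S]
    (P : Measure 𝒳) (ψ : (I → 𝒳) → S → ℝ) : Prop where
  existsUnique_minimizer : ∀ᵐ x ∂(Measure.pi fun _ : I => P), ∃! s : S, IsMinimizer ψ x s
  aemeasurable_optimizer : AEMeasurable (optimizer ψ) (Measure.pi fun _ : I => P)
  integrable_optValue : Integrable (optValue ψ) (Measure.pi fun _ : I => P)

open Classical in
/-- The input `x` with the coordinates in the block `J` replaced by those of `x'`. -/
def perturb (J : Set I) (x x' : I → 𝒳) : I → 𝒳 :=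
  fun i => if i ∈ J then x' i else x i

/-- `X` is an i.i.d. collection of inputs with law `P`, and each `X' l` is an independent copy
of `X`. Nothing else is required of the joint law of `X` and the family `X'`. -/
structure IsPerturbationScheme {L Ω : Type*} [MeasurableSpace 𝒳] [Fintype I] [MeasurableSpace Ω]
    (P : Measure 𝒳) (μ : Measure Ω) (X : Ω → I → 𝒳) (X' : L → Ω → I → 𝒳) : Prop where
  hasLaw : HasLaw X (Measure.pi fun _ : I => P) μ
  hasLaw_copy : ∀ l, HasLaw (X' l) (Measure.pi fun _ : I => P) μ
  indep_copy : ∀ l, IndepFun X (X' l) μ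

/-- The set of the optimal solutions for the perturbed inputs with label in `A`. -/
def perturbedOptimizers {L : Type*} [Nonempty S] (ψ : (I → 𝒳) → S → ℝ) (J : L → Set I)
    (x : I → 𝒳) (x' : L → I → 𝒳) (A : Finset L) : Set S :=
  {s | ∃ l ∈ A, s = optimizer ψ (perturb (J l) x (x' l))}

/-- The minimum of the `ε`-packing numbers of the sets of optimal solutions for the perturbed
inputs with label in `A`, over the sets `A` of more than `(1 - ε) |L|` labels. -/
def minPacking {L : Type*} [Fintype L] [Nonempty S] [MetricSpace S] (ψ : (I → 𝒳) → S → ℝ)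
    (J : L → Set I) (ε : ℝ) (x : I → 𝒳) (x' : L → I → 𝒳) : ℕ∞ :=
  ⨅ (A : Finset L) (_ : (1 - ε) * (Fintype.card L : ℝ) < (A.card : ℝ)),
    Metric.packingNumber ε.toNNReal (perturbedOptimizers ψ J x x' A)

end Problem

/-- The sequence of minimization problems `ψ n`, with input law `P`, is stable under small
perturbations with perturbation blocks `J n l`. -/
def StableUnderSmallPerturbations {𝒳 : Type} [MeasurableSpace 𝒳] (P : Measure 𝒳)
    {I S L : ℕ → Type} [∀ n, Fintype (I n)] [∀ n, Nonempty (S n)] [∀ n, MetricSpace (S n)]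
    [∀ n, Fintype (L n)] (ψ : ∀ n, (I n → 𝒳) → S n → ℝ) (J : ∀ n, L n → Set (I n)) : Prop :=
  ∀ ε : ℝ, 0 < ε → ∀ δ : ℝ, 0 < δ → ∃ M : ℕ,
    ∀ (Ω : ℕ → Type u) [∀ n, MeasurableSpace (Ω n)] (μ : ∀ n, Measure (Ω n))
      (X : ∀ n, Ω n → I n → 𝒳) (X' : ∀ n, L n → Ω n → I n → 𝒳),
      (∀ n, IsProbabilityMeasure (μ n)) →
      (∀ n, IsPerturbationScheme P (μ n) (X n) (X' n)) →
      limsup (fun n => μ n {ω | (M : ℕ∞) ≤ minPacking (ψ n) (J n) ε (X n ω) fun l => X' n l ω})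
        atTop ≤ ENNReal.ofReal δ

end RandomOpt

namespace Wigner

/-! ### The smallest eigenvalue of a Wigner matrix as a minimization problem

All objects are indexed so that index `n` stands for `(n + 1) × (n + 1)` matrices. -/

/-- The positions `(i, j)`, `i ≤ j`, on and above the diagonal. -/
abbrev UpperIndex (n : ℕ) : Type :=
  {p : Fin (n + 1) × Fin (n + 1) // p.1 ≤ p.2}

/-- The symmetric matrix with the given entries on and above the diagonal. -/
def symmMatrix (n : ℕ) (x : UpperIndex n → ℝ) : Matrix (Fin (n + 1)) (Fin (n + 1)) ℝ :=
  Matrix.of fun i j => x ⟨(min i j, max i j), min_le_max⟩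

/-- The Euclidean unit vectors with non-negative first coordinate, with the Euclidean metric. -/
abbrev HalfSphere (n : ℕ) : Type :=
  {v : EuclideanSpace ℝ (Fin (n + 1)) // ‖v‖ = 1 ∧ 0 ≤ v 0}

instance (n : ℕ) : Nonempty (HalfSphere n) :=
  ⟨⟨EuclideanSpace.single 0 1, by simp⟩⟩

/-- The quadratic form `vᵀ M v` of the symmetric matrix `M` with upper triangular entries `x`. -/
def quadForm (n : ℕ) (x : UpperIndex n → ℝ) (v : HalfSphere n) : ℝ :=
  ∑ i, ∑ j, symmMatrix n x i j * v.1 i * v.1 j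

/-- The blocks that consist of a single entry on or above the diagonal. -/
def entryBlock (n : ℕ) (p : UpperIndex n) : Set (UpperIndex n) :=
  {p}

/-- The blocks that consist of an entire row, together with the corresponding column. -/
def rowBlock (n : ℕ) (i : Fin (n + 1)) : Set (UpperIndex n) :=
  {p | p.1.1 = i ∨ p.1.2 = i}

end Wigner

end

set_option linter.unusedSectionVars false

/-! Write `λ` for the smallest eigenvalue and `n` for the size of the matrix. The proof shows that
most perturbed minimizers nearly minimize the unperturbed form, and that near minimizers lie close
to a subspace of bounded dimension.

Near minimality comes from an exchange argument. Swapping a block between two independent copies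
preserves their joint law. Therefore the mean excess over `λ` of the value, at the original input,
of a perturbed minimizer is at most minus twice the mean contribution of the block to `λ`
(`Centered.integral_excess_le`). Summed over single entries the contributions give `λ`; summed over
rows they give `2λ` minus the diagonal part. As the mean of `-λ` is `O(√n)` and there are at least
`n` blocks, the average excess is `O(1/√n)`. Markov's inequality does the rest.

Bounded dimension means that the number of eigenvalues within `O(1/√n)` of `λ` is tight
(`Centered.nearDegenerate_tight`). Two estimates of the drop of `λ` under bordering by a fresh row
are played against each other. By exchangeability every row has the same mean drop, and the drops
over all rows are controlled by the squared coordinates of one unit eigenvector, which add up to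
one; hence the mean drop is `O(1/√n)` (`Centered.exists_gap_bound`). On the other hand, if `k`
eigenvalues are nearly degenerate, the new row has a component of length about `√k` in their span,
and a trial vector tilted along it lowers `λ` by order `k/√n` (`Centered.le_integral_gain`). So `k`
cannot be large with non-negligible probability. A compactness argument in dimension below `k` then
bounds packing numbers (`exists_packing_bound`).

The bound `O(√n)` for the mean of the negative part of `λ` (`Centered.exists_minEig_bound`) uses
second moments of quadratic forms only. Let `t` be the shift at which the resolvent `R` of `M + t`
has Frobenius norm one, so `-λ ≤ t`. The squared column norms of `R` are weights of total mass one,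
and averaging the Schur complement identities with these weights expresses `t` through quadratic
forms in the rows. Monotonicity allows each form to be evaluated at the level of its own minor,
which is independent of the row; there the form has mean at most a constant times `√n` and bounded
variance.

Uniqueness and measurability come from Rademacher's theorem: `λ` is Lipschitz in the entries, and
where it is differentiable its gradient determines the products `s₀ sⱼ` for every minimizer `s`.
Almost surely `s₀ ≠ 0`, so this determines `s`. -/

namespace Wigner
open Matrix

/-! ### Shifted resolvents and the level where the Frobenius norm is one. -/

section Resolvent
variable {ι : Type*} [Fintype ι] [DecidableEq ι]

/-- The matrix `B` shifted by the scalar `t`. -/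
def shift (B : Matrix ι ι ℝ) (t : ℝ) : Matrix ι ι ℝ := B + t • (1 : Matrix ι ι ℝ)

/-- The inverse of the shifted matrix. -/
noncomputable def resolv (B : Matrix ι ι ℝ) (t : ℝ) : Matrix ι ι ℝ := (shift B t)⁻¹

/-- The squared Frobenius norm. -/
def frobSq {κ : Type*} [Fintype κ] (A : Matrix κ κ ℝ) : ℝ := ∑ i, ∑ j, A i j ^ 2

lemma shift_mulVec (B : Matrix ι ι ℝ) (t : ℝ) (v : ι → ℝ) :
    shift B t *ᵥ v = B *ᵥ v + t • v := by
  simp [shift, Matrix.add_mulVec, Matrix.smul_mulVec]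

lemma shift_mulVec_shift (B : Matrix ι ι ℝ) (s t : ℝ) (v : ι → ℝ) :
    shift B t *ᵥ v = shift B s *ᵥ v + (t - s) • v := by
  rw [shift_mulVec, shift_mulVec, sub_smul]; abel

lemma shift_resolv_mulVec {B : Matrix ι ι ℝ} {t : ℝ} (h : (shift B t).PosDef) (v : ι → ℝ) :
    shift B t *ᵥ (resolv B t *ᵥ v) = v := by
  rw [Matrix.mulVec_mulVec, resolv, Matrix.mul_nonsing_inv _ (by simpa using h.det_pos.ne'),
    Matrix.one_mulVec]

lemma resolv_shift_mulVec {B : Matrix ι ι ℝ} {t : ℝ} (h : (shift B t).PosDef) (v : ι → ℝ) :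
    resolv B t *ᵥ (shift B t *ᵥ v) = v := by
  rw [Matrix.mulVec_mulVec, resolv, Matrix.nonsing_inv_mul _ (by simpa using h.det_pos.ne'),
    Matrix.one_mulVec]

lemma resolv_posDef {B : Matrix ι ι ℝ} {t : ℝ} (h : (shift B t).PosDef) : (resolv B t).PosDef :=
  h.inv

lemma PosDef.dotProduct_nonneg {A : Matrix ι ι ℝ} (h : A.PosDef) (v : ι → ℝ) :
    0 ≤ v ⬝ᵥ A *ᵥ v := by
  simpa using h.posSemidef.dotProduct_mulVec_nonneg v

lemma symm_dotProduct_mulVec {A : Matrix ι ι ℝ} (h : A.IsHermitian) (v w : ι → ℝ) :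
    v ⬝ᵥ A *ᵥ w = (A *ᵥ v) ⬝ᵥ w := by
  rw [Matrix.dotProduct_mulVec, ← Matrix.mulVec_transpose]
  congr 2

lemma shift_isHermitian {B : Matrix ι ι ℝ} (h : B.IsHermitian) (t : ℝ) :
    (shift B t).IsHermitian := by
  simp only [shift, Matrix.IsHermitian, Matrix.conjTranspose_add, h.eq, Matrix.conjTranspose_smul,
    Matrix.conjTranspose_one, star_trivial]

lemma dotProduct_self_nonneg (v : ι → ℝ) : 0 ≤ v ⬝ᵥ v := by
  simpa using dotProduct_star_self_nonneg v

lemma dotProduct_self_eq_zero' {v : ι → ℝ} : v ⬝ᵥ v = 0 ↔ v = 0 := dotProduct_self_eq_zero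

lemma shift_posDef_mono {B : Matrix ι ι ℝ} {s t : ℝ} (hst : s ≤ t) (h : (shift B s).PosDef) :
    (shift B t).PosDef := by
  have : shift B t = shift B s + (t - s) • (1 : Matrix ι ι ℝ) := by
    simp [shift, sub_smul]
  rw [this]
  exact h.add_posSemidef (Matrix.PosSemidef.one.smul (sub_nonneg.2 hst))

/-- Resolvent identity. -/
lemma resolv_mulVec_eq {B : Matrix ι ι ℝ} {s t : ℝ} (hst : s ≤ t) (h : (shift B s).PosDef)
    (u : ι → ℝ) : resolv B s *ᵥ u =
      resolv B t *ᵥ u + (t - s) • resolv B s *ᵥ (resolv B t *ᵥ u) := by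
  have ht := shift_posDef_mono hst h
  set v := resolv B t *ᵥ u with hv
  have hu : u = shift B s *ᵥ v + (t - s) • v := by
    rw [← shift_mulVec_shift, hv, shift_resolv_mulVec ht]
  conv_lhs => rw [hu]
  rw [Matrix.mulVec_add, resolv_shift_mulVec h, Matrix.mulVec_smul]

/-- By the resolvent identity the difference is `t - s` times the pairing of `u` with `resolv B s`
applied to `v = resolv B t *ᵥ u`. Moving the resolvent onto `u` turns this pairing into `v ⬝ᵥ v`
plus a nonnegative form in `v`. -/
lemma resolv_form_anti {B : Matrix ι ι ℝ} {s t : ℝ} (hst : s ≤ t) (h : (shift B s).PosDef)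
    (u : ι → ℝ) : u ⬝ᵥ resolv B t *ᵥ u ≤ u ⬝ᵥ resolv B s *ᵥ u := by
  have ht := shift_posDef_mono hst h
  have h1 := resolv_mulVec_eq hst h u
  set v := resolv B t *ᵥ u with hv
  have hu : u = shift B s *ᵥ v + (t - s) • v := by
    rw [← shift_mulVec_shift, hv, shift_resolv_mulVec ht]
  rw [h1, dotProduct_add, dotProduct_smul, smul_eq_mul]
  have h2 : 0 ≤ u ⬝ᵥ resolv B s *ᵥ v := by
    rw [symm_dotProduct_mulVec (resolv_posDef h).isHermitian, hu, Matrix.mulVec_add,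
      resolv_shift_mulVec h, Matrix.mulVec_smul, add_dotProduct, smul_dotProduct, smul_eq_mul]
    have h3 := PosDef.dotProduct_nonneg (resolv_posDef h) v
    rw [symm_dotProduct_mulVec (resolv_posDef h).isHermitian] at h3
    have := dotProduct_self_nonneg v
    have := mul_nonneg (sub_nonneg.2 hst) h3
    linarith
  have := mul_nonneg (sub_nonneg.2 hst) h2
  linarith

/-- Expand the square in the resolvent identity and drop the quadratic term in `t - s`. The cross
term is kept because it yields strict monotonicity in `frobSq_resolv_anti`. -/
lemma resolv_normSq_anti_aux {B : Matrix ι ι ℝ} {s t : ℝ} (hst : s ≤ t)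
    (h : (shift B s).PosDef) (u : ι → ℝ) :
    (resolv B t *ᵥ u) ⬝ᵥ (resolv B t *ᵥ u) +
      2 * (t - s) * ((resolv B t *ᵥ u) ⬝ᵥ resolv B s *ᵥ (resolv B t *ᵥ u))
      ≤ (resolv B s *ᵥ u) ⬝ᵥ (resolv B s *ᵥ u) := by
  rw [resolv_mulVec_eq hst h u]
  set v := resolv B t *ᵥ u
  simp only [add_dotProduct, dotProduct_add, smul_dotProduct, dotProduct_smul, smul_eq_mul]
  rw [dotProduct_comm (resolv B s *ᵥ v) v]
  have := mul_nonneg (mul_self_nonneg (t - s)) (dotProduct_self_nonneg (resolv B s *ᵥ v))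
  nlinarith

lemma resolv_normSq_anti {B : Matrix ι ι ℝ} {s t : ℝ} (hst : s ≤ t)
    (h : (shift B s).PosDef) (u : ι → ℝ) :
    (resolv B t *ᵥ u) ⬝ᵥ (resolv B t *ᵥ u) ≤ (resolv B s *ᵥ u) ⬝ᵥ (resolv B s *ᵥ u) := by
  have h1 := resolv_normSq_anti_aux hst h u
  have h2 := mul_nonneg (sub_nonneg.2 hst)
    (PosDef.dotProduct_nonneg (resolv_posDef h) (resolv B t *ᵥ u))
  linarith

lemma frobSq_eq_sum (A : Matrix ι ι ℝ) :
    frobSq A = ∑ j, (A *ᵥ Pi.single j 1) ⬝ᵥ (A *ᵥ Pi.single j 1) := by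
  rw [frobSq, Finset.sum_comm]
  simp [dotProduct, sq]

lemma frobSq_resolv_anti [Nonempty ι] {B : Matrix ι ι ℝ} {s t : ℝ} (hst : s < t)
    (h : (shift B s).PosDef) : frobSq (resolv B t) < frobSq (resolv B s) := by
  rw [frobSq_eq_sum, frobSq_eq_sum]
  refine Finset.sum_lt_sum_of_nonempty Finset.univ_nonempty fun j _ => ?_
  have ht := shift_posDef_mono hst.le h
  have h1 := resolv_normSq_anti_aux hst.le h (Pi.single j 1)
  have hne : resolv B t *ᵥ Pi.single j 1 ≠ 0 := by
    intro h0
    have := shift_resolv_mulVec ht (Pi.single j (1 : ℝ))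
    rw [h0, Matrix.mulVec_zero] at this
    simpa using congrFun this j
  have h2 : 0 < (resolv B t *ᵥ Pi.single j 1) ⬝ᵥ
      resolv B s *ᵥ (resolv B t *ᵥ Pi.single j 1) := by
    simpa using (resolv_posDef h).dotProduct_mulVec_pos hne
  have := mul_pos (sub_pos.2 hst) h2
  linarith

lemma continuousOn_frobSq_resolv {B : Matrix ι ι ℝ} {s : Set ℝ}
    (h : ∀ t ∈ s, (shift B t).PosDef) : ContinuousOn (fun t => frobSq (resolv B t)) s := by
  have hs : Continuous fun t => shift B t := by unfold shift; fun_prop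
  unfold frobSq
  refine continuousOn_finsetSum _ fun i _ => continuousOn_finsetSum _ fun j _ => ?_
  refine ContinuousOn.pow ?_ 2
  simp only [resolv, Matrix.inv_def, Ring.inverse_eq_inv', Matrix.smul_apply, smul_eq_mul]
  refine ContinuousOn.mul ?_ ?_
  · exact (hs.matrix_det.continuousOn).inv₀ fun t ht => (h t ht).det_pos.ne'
  · exact ((hs.matrix_adjugate).matrix_elem i j).continuousOn

/-- If `B ≥ a` and `a + t > 0` then the resolvent is at most `1 / (a + t)`. -/
lemma resolv_normSq_le {B : Matrix ι ι ℝ} {a t : ℝ} (hB : ∀ v, a * (v ⬝ᵥ v) ≤ v ⬝ᵥ B *ᵥ v)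
    (ht : (shift B t).PosDef) (hat : 0 < a + t) (u : ι → ℝ) :
    (a + t) ^ 2 * ((resolv B t *ᵥ u) ⬝ᵥ (resolv B t *ᵥ u)) ≤ u ⬝ᵥ u := by
  set v := resolv B t *ᵥ u with hv
  have hu : u = shift B t *ᵥ v := (shift_resolv_mulVec ht u).symm
  have h1 : (a + t) * (v ⬝ᵥ v) ≤ v ⬝ᵥ u := by
    rw [hu, shift_mulVec, dotProduct_add, dotProduct_smul, smul_eq_mul]
    linarith [hB v]
  have h2 : 0 ≤ (u - (a + t) • v) ⬝ᵥ (u - (a + t) • v) := dotProduct_self_nonneg _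
  simp only [sub_dotProduct, dotProduct_sub, smul_dotProduct, dotProduct_smul, smul_eq_mul] at h2
  rw [dotProduct_comm u v] at h2
  nlinarith [mul_le_mul_of_nonneg_left h1 hat.le]

lemma shift_posDef_of_lt {B : Matrix ι ι ℝ} {a t : ℝ} (hs : B.IsHermitian)
    (hB : ∀ v, a * (v ⬝ᵥ v) ≤ v ⬝ᵥ B *ᵥ v) (hat : 0 < a + t) : (shift B t).PosDef := by
  refine Matrix.PosDef.of_dotProduct_mulVec_pos (shift_isHermitian hs t) fun v hv => ?_
  have h1 : 0 < v ⬝ᵥ v := lt_of_le_of_ne (dotProduct_self_nonneg v)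
    (fun h => hv (dotProduct_self_eq_zero'.1 h.symm))
  simp only [star_trivial, shift_mulVec, dotProduct_add, dotProduct_smul, smul_eq_mul]
  nlinarith [hB v, mul_pos hat h1]

/-- The level `t` at which the resolvent has Frobenius norm one. -/
lemma exists_level [Nonempty ι] {B : Matrix ι ι ℝ} {a : ℝ} (hs : B.IsHermitian)
    (hB : ∀ v, a * (v ⬝ᵥ v) ≤ v ⬝ᵥ B *ᵥ v) {w : ι → ℝ} (hw : w ⬝ᵥ w = 1) (hBw : B *ᵥ w = a • w) :
    ∃ t, -a < t ∧ (shift B t).PosDef ∧ frobSq (resolv B t) = 1 := by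
  set N : ℝ := (Fintype.card ι : ℝ) with hN
  have hN1 : 1 ≤ N := by
    have := Fintype.card_pos (α := ι)
    rw [hN]; exact_mod_cast this
  have hsq : 1 ≤ √N := by rw [Real.one_le_sqrt]; exact hN1
  -- Intermediate values are taken on this window: one unit above the singular shift `-a` the
  -- Frobenius norm is at least one, and at distance `√N` it is at most one.
  have hpos : ∀ t ∈ Set.Icc (1 - a) (√N - a), (shift B t).PosDef := fun t ht =>
    shift_posDef_of_lt hs hB (by linarith [ht.1])
  have hcont := continuousOn_frobSq_resolv hpos
  have hle : (1 : ℝ) - a ≤ √N - a := by linarith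
  have hup : frobSq (resolv B (√N - a)) ≤ 1 := by
    have h1 := hpos _ (Set.right_mem_Icc.2 hle)
    have h2 : ∀ j, N * ((resolv B (√N - a) *ᵥ Pi.single j 1) ⬝ᵥ
        (resolv B (√N - a) *ᵥ Pi.single j 1)) ≤ 1 := fun j => by
      have := resolv_normSq_le hB h1 (by linarith) (Pi.single j 1)
      simpa [Real.sq_sqrt (by linarith : 0 ≤ N)] using this
    have h3 := Finset.sum_le_sum fun j (_ : j ∈ Finset.univ) => h2 j
    rw [← Finset.mul_sum, ← frobSq_eq_sum] at h3
    simp only [Finset.sum_const, Finset.card_univ, nsmul_eq_mul, mul_one, ← hN] at h3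
    nlinarith
  -- At this shift the resolvent fixes the unit eigenvector `w`; by Cauchy–Schwarz in each row its
  -- Frobenius norm is at least one.
  have hlow : 1 ≤ frobSq (resolv B (1 - a)) := by
    have h1 := hpos _ (Set.left_mem_Icc.2 hle)
    have h2 : resolv B (1 - a) *ᵥ w = w := by
      have : shift B (1 - a) *ᵥ w = w := by rw [shift_mulVec, hBw, ← add_smul]; simp
      conv_lhs => rw [← this]
      exact resolv_shift_mulVec h1 w
    have h3 : w ⬝ᵥ w = ∑ i, (∑ j, resolv B (1 - a) i j * w j) ^ 2 := by
      conv_lhs => rw [← h2]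
      simp [dotProduct, Matrix.mulVec, sq]
    have hw' : ∑ j, w j ^ 2 = 1 := by rw [← hw]; simp [dotProduct, sq]
    have h4 : ∀ i, (∑ j, resolv B (1 - a) i j * w j) ^ 2 ≤ ∑ j, resolv B (1 - a) i j ^ 2 := by
      intro i
      have := Finset.sum_mul_sq_le_sq_mul_sq Finset.univ (fun j => resolv B (1 - a) i j) w
      rwa [hw', mul_one] at this
    calc (1 : ℝ) = w ⬝ᵥ w := hw.symm
      _ = _ := h3
      _ ≤ _ := Finset.sum_le_sum fun i _ => h4 i
  obtain ⟨t, ht, hft⟩ := intermediate_value_Icc' hle hcont ⟨hup, hlow⟩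
  exact ⟨t, by linarith [ht.1], hpos t ht, hft⟩

open Classical in
/-- The shift for which the resolvent is positive definite with Frobenius norm one. -/
noncomputable def level (B : Matrix ι ι ℝ) : ℝ :=
  if h : ∃ t, (shift B t).PosDef ∧ frobSq (resolv B t) = 1 then h.choose else 0

lemma level_spec {B : Matrix ι ι ℝ} (h : ∃ t, (shift B t).PosDef ∧ frobSq (resolv B t) = 1) :
    (shift B (level B)).PosDef ∧ frobSq (resolv B (level B)) = 1 := by
  rw [level, dif_pos h]; exact h.choose_spec

/-- Strict monotonicity pins the level down, and the resulting criterion involves only a fixed shift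
`s`. This is what makes the level measurable although it is defined by choice. -/
lemma level_lt_iff [Nonempty ι] {B : Matrix ι ι ℝ}
    (h : ∃ t, (shift B t).PosDef ∧ frobSq (resolv B t) = 1) (s : ℝ) :
    level B < s ↔ (shift B s).PosDef ∧ frobSq (resolv B s) < 1 := by
  obtain ⟨h1, h2⟩ := level_spec h
  constructor
  · intro hs
    exact ⟨shift_posDef_mono hs.le h1, h2 ▸ frobSq_resolv_anti hs h1⟩
  · rintro ⟨h3, h4⟩
    by_contra hs
    rcases (not_lt.1 hs).lt_or_eq with hs | hs
    · have := frobSq_resolv_anti hs h3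
      linarith
    · rw [hs] at h4; linarith

end Resolvent
end Wigner

namespace Wigner
open Matrix

/-! ### Existence of a minimizing eigenvector. -/

section MinEig
variable {ι : Type*} [Fintype ι] [DecidableEq ι]

/-- `B - a` is positive semidefinite, and a vector on which a semidefinite form vanishes lies in the
kernel. -/
lemma mulVec_eq_of_form_eq {B : Matrix ι ι ℝ} {a : ℝ} (hs : B.IsHermitian)
    (hB : ∀ v, a * (v ⬝ᵥ v) ≤ v ⬝ᵥ B *ᵥ v) {w : ι → ℝ} (hw : w ⬝ᵥ B *ᵥ w = a * (w ⬝ᵥ w)) :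
    B *ᵥ w = a • w := by
  have hpsd : (shift B (-a)).PosSemidef := by
    refine Matrix.PosSemidef.of_dotProduct_mulVec_nonneg (shift_isHermitian hs _) fun v => ?_
    simp only [star_trivial, shift_mulVec, dotProduct_add, dotProduct_smul, smul_eq_mul]
    linarith [hB v]
  have h0 := (hpsd.dotProduct_mulVec_zero_iff w).1 (by
    simp only [star_trivial, shift_mulVec, dotProduct_add, dotProduct_smul, smul_eq_mul]
    linarith)
  rw [shift_mulVec] at h0
  have := eq_neg_of_add_eq_zero_left h0
  simpa using this

lemma exists_min_eigenvector [Nonempty ι] {B : Matrix ι ι ℝ} (hs : B.IsHermitian) :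
    ∃ (a : ℝ) (w : ι → ℝ), w ⬝ᵥ w = 1 ∧ (∀ v, a * (v ⬝ᵥ v) ≤ v ⬝ᵥ B *ᵥ v) ∧ B *ᵥ w = a • w := by
  have hcomp : IsCompact (Metric.sphere (0 : EuclideanSpace ℝ ι) 1) := isCompact_sphere 0 1
  have hcont : Continuous fun v : EuclideanSpace ℝ ι => v.ofLp ⬝ᵥ B *ᵥ v.ofLp := by
    simp only [dotProduct, Matrix.mulVec]
    fun_prop
  have hdot : ∀ v : EuclideanSpace ℝ ι, v.ofLp ⬝ᵥ v.ofLp = ‖v‖ ^ 2 := fun v => by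
    rw [EuclideanSpace.real_norm_sq_eq]; simp [dotProduct, sq]
  obtain ⟨i⟩ := ‹Nonempty ι›
  have hne : (Metric.sphere (0 : EuclideanSpace ℝ ι) 1).Nonempty :=
    ⟨EuclideanSpace.single i 1, by simp⟩
  obtain ⟨w, hw, hmin⟩ := hcomp.exists_isMinOn hne hcont.continuousOn
  have hw1 : w.ofLp ⬝ᵥ w.ofLp = 1 := by rw [hdot]; simp at hw; rw [hw]; norm_num
  have hB : ∀ v, (w.ofLp ⬝ᵥ B *ᵥ w.ofLp) * (v ⬝ᵥ v) ≤ v ⬝ᵥ B *ᵥ v := by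
    intro v
    by_cases hv : v = 0
    · simp [hv]
    set V : EuclideanSpace ℝ ι := WithLp.toLp 2 v with hV
    have hV0 : 0 < ‖V‖ := by
      rw [norm_pos_iff]; intro h; exact hv (by simpa [hV] using h)
    have h1 := hmin (a := ‖V‖⁻¹ • V) (by simp [norm_smul, hV0.ne'])
    have h2 : v ⬝ᵥ v = ‖V‖ ^ 2 := hdot V
    simp only [Set.mem_ofPred_eq, WithLp.ofLp_smul, smul_dotProduct, Matrix.mulVec_smul,
      dotProduct_smul, smul_eq_mul] at h1
    rw [h2]
    have h3 : V.ofLp = v := rfl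
    rw [h3] at h1
    calc (w.ofLp ⬝ᵥ B *ᵥ w.ofLp) * ‖V‖ ^ 2 ≤ (‖V‖⁻¹ * (‖V‖⁻¹ * v ⬝ᵥ B *ᵥ v)) * ‖V‖ ^ 2 := by gcongr
      _ = v ⬝ᵥ B *ᵥ v := by field_simp
  refine ⟨w.ofLp ⬝ᵥ B *ᵥ w.ofLp, w.ofLp, hw1, hB, ?_⟩
  exact mulVec_eq_of_form_eq hs hB (by rw [hw1, mul_one])

lemma level_exists [Nonempty ι] {B : Matrix ι ι ℝ} (hs : B.IsHermitian) :
    ∃ t, (shift B t).PosDef ∧ frobSq (resolv B t) = 1 := by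
  obtain ⟨a, w, hw, hB, hBw⟩ := exists_min_eigenvector hs
  obtain ⟨t, -, h⟩ := exists_level hs hB hw hBw
  exact ⟨t, h⟩

end MinEig

/-! ### Deleting a row and column: Schur complement identities. -/

section Minor
variable {m : ℕ}

/-- The matrix with the `i`-th row and column deleted. -/
def minor (M : Matrix (Fin (m + 1)) (Fin (m + 1)) ℝ) (i : Fin (m + 1)) : Matrix (Fin m) (Fin m) ℝ :=
  M.submatrix i.succAbove i.succAbove

/-- The `i`-th row without its diagonal entry. -/
def offRow (M : Matrix (Fin (m + 1)) (Fin (m + 1)) ℝ) (i : Fin (m + 1)) : Fin m → ℝ :=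
  fun j => M i (i.succAbove j)

variable {M : Matrix (Fin (m + 1)) (Fin (m + 1)) ℝ}

lemma minor_isHermitian (h : M.IsHermitian) (i : Fin (m + 1)) : (minor M i).IsHermitian :=
  h.submatrix _

lemma minor_posDef (h : M.PosDef) (i : Fin (m + 1)) : (minor M i).PosDef :=
  h.submatrix Fin.succAbove_right_injective

lemma minor_shift (i : Fin (m + 1)) (t : ℝ) : minor (shift M t) i = shift (minor M i) t := by
  ext a b
  simp [minor, shift, Matrix.one_apply, Fin.succAbove_right_injective.eq_iff]

lemma offRow_shift (i : Fin (m + 1)) (t : ℝ) : offRow (shift M t) i = offRow M i := by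
  ext a
  simp [offRow, shift, (Fin.succAbove_ne i a).symm]

lemma mulVec_self (i : Fin (m + 1)) (x : Fin (m + 1) → ℝ) :
    (M *ᵥ x) i = M i i * x i + offRow M i ⬝ᵥ i.removeNth x := by
  simp [Matrix.mulVec, dotProduct, Fin.sum_univ_succAbove _ i, offRow, Fin.removeNth]

lemma removeNth_mulVec (h : M.IsHermitian) (i : Fin (m + 1)) (x : Fin (m + 1) → ℝ) :
    i.removeNth (M *ᵥ x) = x i • offRow M i + minor M i *ᵥ i.removeNth x := by
  ext j
  have : M (i.succAbove j) i = M i (i.succAbove j) := by simpa using h.apply i (i.succAbove j)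
  simp [Matrix.mulVec, dotProduct, Fin.sum_univ_succAbove _ i, offRow, Fin.removeNth, minor, this,
    mul_comm]

lemma dotProduct_succAbove (i : Fin (m + 1)) (x y : Fin (m + 1) → ℝ) :
    x ⬝ᵥ y = x i * y i + i.removeNth x ⬝ᵥ i.removeNth y := by
  simp [dotProduct, Fin.sum_univ_succAbove _ i, Fin.removeNth]

variable {t : ℝ}

/-- The column of the resolvent, by the Schur complement. -/
lemma resolv_col (hA : (shift M t).PosDef) (i : Fin (m + 1)) :
    i.removeNth (resolv M t *ᵥ Pi.single i 1) =
      -(resolv M t i i) • (resolv (minor M i) t *ᵥ offRow M i) := by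
  have hm := minor_posDef hA i
  rw [minor_shift] at hm
  have h1 := congrArg i.removeNth (shift_resolv_mulVec hA (Pi.single i 1))
  rw [removeNth_mulVec hA.isHermitian, minor_shift, offRow_shift] at h1
  have h2 : i.removeNth (Pi.single i (1 : ℝ) : Fin (m + 1) → ℝ) = 0 := by
    ext j; simp [Fin.removeNth, Fin.succAbove_ne]
  rw [h2] at h1
  have h3 := eq_neg_of_add_eq_zero_right h1
  have h4 := congrArg (fun v => resolv (minor M i) t *ᵥ v) h3
  simp only [resolv_shift_mulVec hm, Matrix.mulVec_neg, Matrix.mulVec_smul] at h4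
  rw [h4]
  simp

lemma resolv_diag_mul (hA : (shift M t).PosDef) (i : Fin (m + 1)) :
    resolv M t i i * (t + M i i - offRow M i ⬝ᵥ resolv (minor M i) t *ᵥ offRow M i) = 1 := by
  have h1 := congrFun (shift_resolv_mulVec hA (Pi.single i 1)) i
  rw [mulVec_self, resolv_col hA, offRow_shift] at h1
  simp [shift] at h1
  linarith

/-- By `resolv_col` the `i`-th column of the resolvent is its diagonal entry times `1` and minus the
minor's resolvent applied to the row. -/
lemma sum_resolv_sq (hA : (shift M t).PosDef) (i : Fin (m + 1)) :
    ∑ j, resolv M t j i ^ 2 = resolv M t i i ^ 2 *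
      (1 + (resolv (minor M i) t *ᵥ offRow M i) ⬝ᵥ (resolv (minor M i) t *ᵥ offRow M i)) := by
  have h1 : ∑ j, resolv M t j i ^ 2 =
      (resolv M t *ᵥ Pi.single i 1) ⬝ᵥ (resolv M t *ᵥ Pi.single i 1) := by
    simp [dotProduct, sq]
  rw [h1, dotProduct_succAbove i, resolv_col hA]
  simp
  ring

/-- Block inversion: restricted to the remaining indices, the resolvent is a positive rank-one
update of the resolvent of the minor. -/
lemma resolv_minor (hA : (shift M t).PosDef) (i : Fin (m + 1)) (a b : Fin m) :
    resolv M t (i.succAbove a) (i.succAbove b) = resolv (minor M i) t a b +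
      resolv M t i i * (resolv (minor M i) t *ᵥ offRow M i) a *
        (resolv (minor M i) t *ᵥ offRow M i) b := by
  have hm := minor_posDef hA i
  rw [minor_shift] at hm
  have h1 := congrArg i.removeNth (shift_resolv_mulVec hA (Pi.single (i.succAbove b) 1))
  rw [removeNth_mulVec hA.isHermitian, minor_shift, offRow_shift] at h1
  have h2 : i.removeNth (Pi.single (i.succAbove b) (1 : ℝ) : Fin (m + 1) → ℝ) = Pi.single b 1 := by
    ext j; simp [Fin.removeNth, Pi.single_apply, Fin.succAbove_right_injective.eq_iff]
  have h4 : resolv M t i (i.succAbove b) =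
      -(resolv M t i i) * (resolv (minor M i) t *ᵥ offRow M i) b := by
    have h5 := congrFun (resolv_col hA i) b
    have h6 : resolv M t i (i.succAbove b) = resolv M t (i.succAbove b) i := by
      simpa using (resolv_posDef hA).isHermitian.apply (i.succAbove b) i
    rw [h6]
    simpa [Fin.removeNth] using h5
  rw [h2] at h1
  have h3 := eq_sub_of_add_eq' h1
  have h7 := congrArg (fun v => (resolv (minor M i) t *ᵥ v) a) h3
  simp only [resolv_shift_mulVec hm, Matrix.mulVec_sub, Matrix.mulVec_smul] at h7
  simp [Fin.removeNth, h4] at h7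
  linarith

/-- In the rank-one update the cross term is `2 r (g ⬝ᵥ G *ᵥ g)`, nonnegative because `G` is
positive definite; all other extra terms are squares. -/
lemma frobSq_resolv_minor_le (hA : (shift M t).PosDef) (i : Fin (m + 1)) :
    frobSq (resolv (minor M i) t) ≤ frobSq (resolv M t) := by
  have hm := minor_posDef hA i
  rw [minor_shift] at hm
  set G := resolv (minor M i) t with hG
  set g := G *ᵥ offRow M i with hg
  set r := resolv M t i i with hr
  have hr0 : 0 ≤ r := (resolv_posDef hA).posSemidef.diag_nonneg
  have h1 : frobSq (resolv M t) ≥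
      ∑ a, ∑ b, resolv M t (i.succAbove a) (i.succAbove b) ^ 2 := by
    rw [frobSq, Fin.sum_univ_succAbove _ i]
    have : 0 ≤ ∑ j, resolv M t i j ^ 2 := Finset.sum_nonneg fun _ _ => sq_nonneg _
    refine le_add_of_nonneg_of_le this (Finset.sum_le_sum fun a _ => ?_)
    rw [Fin.sum_univ_succAbove _ i]
    exact le_add_of_nonneg_left (sq_nonneg _)
  have h2 : ∑ a, ∑ b, resolv M t (i.succAbove a) (i.succAbove b) ^ 2 =
      frobSq G + 2 * r * (g ⬝ᵥ G *ᵥ g) + ∑ a, ∑ b, (r * g a * g b) ^ 2 := by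
    have h3 : g ⬝ᵥ G *ᵥ g = ∑ a, ∑ b, g a * (G a b * g b) := by
      simp only [dotProduct, Matrix.mulVec, Finset.mul_sum]
    rw [h3]
    simp only [resolv_minor hA, ← hG, ← hg, ← hr, frobSq,
      Finset.mul_sum, ← Finset.sum_add_distrib]
    refine Finset.sum_congr rfl fun a _ => Finset.sum_congr rfl fun b _ => ?_
    ring
  have h3 : 0 ≤ g ⬝ᵥ G *ᵥ g := PosDef.dotProduct_nonneg (resolv_posDef hm) g
  have h4 : 0 ≤ ∑ a, ∑ b, (r * g a * g b) ^ 2 :=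
    Finset.sum_nonneg fun _ _ => Finset.sum_nonneg fun _ _ => sq_nonneg _
  have := mul_nonneg hr0 h3
  linarith

end Minor

/-! ### A deterministic bound for the level. -/

section LevelBound
variable {m : ℕ} {M : Matrix (Fin (m + 2)) (Fin (m + 2)) ℝ}

/-- At the level of `M` the resolvent of the minor has Frobenius norm at most one, so by strict
monotonicity the minor has reached norm one no later. -/
lemma level_minor_le (h : M.IsHermitian) (i : Fin (m + 2)) : level (minor M i) ≤ level M := by
  obtain ⟨h1, h2⟩ := level_spec (level_exists h)
  by_contra hlt
  rw [not_le] at hlt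
  have hm := minor_posDef h1 i
  rw [minor_shift] at hm
  have h3 := frobSq_resolv_anti hlt hm
  have h4 := frobSq_resolv_minor_le h1 i
  rw [(level_spec (level_exists (minor_isHermitian h i))).2] at h3
  linarith

/-- The resolvent at the level. -/
noncomputable def levelRes {ι : Type*} [Fintype ι] [DecidableEq ι] (B : Matrix ι ι ℝ) :
    Matrix ι ι ℝ := resolv B (level B)

lemma trace_le_of_frobSq {ι : Type*} [Fintype ι] [DecidableEq ι] {A : Matrix ι ι ℝ}
    (h : frobSq A ≤ 1) : A.trace ≤ √(Fintype.card ι) := by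
  have h1 : ∑ i, A i i ^ 2 ≤ 1 := le_trans (Finset.sum_le_sum fun i _ =>
    Finset.single_le_sum (f := fun j => A i j ^ 2) (fun _ _ => sq_nonneg _) (Finset.mem_univ i)) h
  refine Real.le_sqrt_of_sq_le ?_
  have h2 := sq_sum_le_card_mul_sum_sq (s := Finset.univ) (f := fun i => A i i)
  simp only [Finset.card_univ] at h2
  calc A.trace ^ 2 ≤ _ := h2
    _ ≤ (Fintype.card ι : ℝ) * 1 := by gcongr
    _ = _ := mul_one _

/-- The point of the right-hand side is that each squared term involves a row only through its
diagonal entry and through forms whose matrix depends on the minor alone. For random entries these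
are independent, and conditional moments apply. -/
lemma level_le (h : M.IsHermitian) {c : ℝ} (hc : 0 ≤ c) :
    level M ≤ (c + 3) * √(m + 2 : ℝ) + (∑ i,
      ((offRow M i ⬝ᵥ levelRes (minor M i) *ᵥ offRow M i - c * (levelRes (minor M i)).trace) ^ 2
        + M i i ^ 2
        + ((levelRes (minor M i) *ᵥ offRow M i) ⬝ᵥ (levelRes (minor M i) *ᵥ offRow M i)) ^ 2))
      / (2 * √(m + 2 : ℝ)) := by
  obtain ⟨hA, hF⟩ := level_spec (level_exists h)
  set t := level M with ht
  set s := √(m + 2 : ℝ) with hs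
  have hs0 : 0 < s := Real.sqrt_pos.2 (by positivity)
  have hss : s ^ 2 = m + 2 := Real.sq_sqrt (by positivity)
  set R := resolv M t with hR
  set w : Fin (m + 2) → ℝ := fun i => ∑ j, R j i ^ 2 with hw
  have hw0 : ∀ i, 0 ≤ w i := fun i => Finset.sum_nonneg fun _ _ => sq_nonneg _
  have hw1 : ∑ i, w i = 1 := by rw [← hF, frobSq, Finset.sum_comm]
  have hwle : ∀ i, w i ≤ 1 := fun i => hw1 ▸
    Finset.single_le_sum (fun i _ => hw0 i) (Finset.mem_univ i)
  have hwsq : ∑ i, w i ^ 2 ≤ 1 := by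
    rw [← hw1]
    refine Finset.sum_le_sum fun i _ => ?_
    nlinarith [hw0 i, hwle i]
  have hRsq : ∑ i, R i i ^ 2 ≤ 1 := by
    rw [← hw1]
    exact Finset.sum_le_sum fun i _ =>
      Finset.single_le_sum (f := fun j => R j i ^ 2) (fun _ _ => sq_nonneg _) (Finset.mem_univ i)
  have hR0 : ∀ i, 0 ≤ R i i := fun i => (resolv_posDef hA).posSemidef.diag_nonneg
  set Q : Fin (m + 2) → ℝ := fun i => offRow M i ⬝ᵥ levelRes (minor M i) *ᵥ offRow M i with hQ
  set P : Fin (m + 2) → ℝ := fun i =>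
    (levelRes (minor M i) *ᵥ offRow M i) ⬝ᵥ (levelRes (minor M i) *ᵥ offRow M i) with hP
  set T : Fin (m + 2) → ℝ := fun i => (levelRes (minor M i)).trace with hT
  have hTle : ∀ i, T i ≤ s := fun i => by
    have := trace_le_of_frobSq (level_spec (level_exists (minor_isHermitian h i))).2.le
    refine this.trans (Real.sqrt_le_sqrt ?_)
    simp only [Fintype.card_fin]; push_cast; linarith
  -- Multiplying the Schur identity by `R i i * (1 + p)` gives an exact formula for `w i * t`. Since
  -- the minor's level is at most `t`, monotonicity replaces `q` and `p` by the larger `Q i` and `P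
  -- i`, which no longer refer to `t`.
  have key : ∀ i, w i * t ≤ w i * (Q i - M i i) + R i i * (1 + P i) := fun i => by
    have hm := (level_spec (level_exists (minor_isHermitian h i))).1
    have hle := level_minor_le h i
    have h1 := resolv_diag_mul hA i
    have h2 := sum_resolv_sq hA i
    have h3 := resolv_form_anti hle hm (offRow M i)
    have h4 := resolv_normSq_anti hle hm (offRow M i)
    set q := offRow M i ⬝ᵥ resolv (minor M i) t *ᵥ offRow M i
    set p := (resolv (minor M i) t *ᵥ offRow M i) ⬝ᵥ (resolv (minor M i) t *ᵥ offRow M i)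
    have h5 : w i * (t + M i i - q) = R i i * (1 + p) := by
      have : w i = R i i ^ 2 * (1 + p) := h2
      rw [this]
      linear_combination (R i i * (1 + p)) * h1
    have h6 : w i * q ≤ w i * Q i := mul_le_mul_of_nonneg_left h3 (hw0 i)
    have h7 : R i i * p ≤ R i i * P i := mul_le_mul_of_nonneg_left h4 (hR0 i)
    nlinarith
  -- Weights and diagonal resolvent entries have sums of squares at most one, whereas there are
  -- about `s ^ 2` error terms of bounded mean. This weighting makes both sides contribute order
  -- `s`.
  have amgm : ∀ a b : ℝ, a * b ≤ s * a ^ 2 / 2 + b ^ 2 / (2 * s) := fun a b => by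
    have : s * a ^ 2 / 2 + b ^ 2 / (2 * s) - a * b = (s * a - b) ^ 2 / (2 * s) := by
      field_simp; ring
    have h2 : 0 ≤ (s * a - b) ^ 2 / (2 * s) := by positivity
    linarith
  have key2 : ∀ i, w i * t ≤ w i * (c * s) + s * w i ^ 2 + s * R i i ^ 2 + 1 / (2 * s) +
      ((Q i - c * T i) ^ 2 + M i i ^ 2 + P i ^ 2) / (2 * s) := fun i => by
    have h1 := key i
    have h2 := amgm (w i) (Q i - c * T i)
    have h3 := amgm (w i) (-M i i)
    have h4 := amgm (R i i) 1
    have h5 := amgm (R i i) (P i)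
    have h6 : w i * (c * T i) ≤ w i * (c * s) :=
      mul_le_mul_of_nonneg_left (mul_le_mul_of_nonneg_left (hTle i) hc) (hw0 i)
    have h7 : ((Q i - c * T i) ^ 2 + M i i ^ 2 + P i ^ 2) / (2 * s) =
      (Q i - c * T i) ^ 2 / (2 * s) + (-M i i) ^ 2 / (2 * s) + P i ^ 2 / (2 * s) := by
      ring
    rw [h7]
    have h8 : (1 : ℝ) ^ 2 / (2 * s) = 1 / (2 * s) := by rw [one_pow]
    rw [h8] at h4
    nlinarith
  have hsum := Finset.sum_le_sum fun i (_ : i ∈ Finset.univ) => key2 i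
  simp only [Finset.sum_add_distrib, ← Finset.sum_mul, ← Finset.mul_sum, hw1,
    ← Finset.sum_div, Finset.sum_const, Finset.card_univ, Fintype.card_fin, nsmul_eq_mul,
    one_mul] at hsum
  simp only [← Finset.sum_add_distrib] at hsum
  have h9 : ((m + 2 : ℕ) : ℝ) * 1 / (2 * s) = s / 2 := by
    push_cast; rw [← hss]; field_simp
  rw [h9] at hsum
  nlinarith [mul_le_mul_of_nonneg_left hwsq hs0.le, mul_le_mul_of_nonneg_left hRsq hs0.le]

end LevelBound
end Wigner

namespace Wigner
open Matrix RandomOpt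

/-! ### The smallest eigenvalue as a function of the entries. -/

section MinEigenvalue
variable {n : ℕ}

/-- The smallest eigenvalue, as the optimal value of the quadratic form. -/
noncomputable def minEig (n : ℕ) (x : UpperIndex n → ℝ) : ℝ := optValue (quadForm n) x

lemma symmMatrix_isHermitian (x : UpperIndex n → ℝ) : (symmMatrix n x).IsHermitian := by
  refine Matrix.IsHermitian.ext fun i j => ?_
  simp [symmMatrix, min_comm, max_comm]

lemma symmMatrix_diag (x : UpperIndex n → ℝ) (i : Fin (n + 1)) :
    symmMatrix n x i i = x ⟨(i, i), le_rfl⟩ := by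
  simp [symmMatrix]

lemma quadForm_eq (x : UpperIndex n → ℝ) (v : HalfSphere n) :
    quadForm n x v = v.1.ofLp ⬝ᵥ symmMatrix n x *ᵥ v.1.ofLp := by
  simp only [quadForm, dotProduct, Matrix.mulVec, Finset.mul_sum]
  refine Finset.sum_congr rfl fun i _ => Finset.sum_congr rfl fun j _ => ?_
  ring

lemma ofLp_dotProduct_self {ι : Type*} [Fintype ι] (v : EuclideanSpace ℝ ι) :
    v.ofLp ⬝ᵥ v.ofLp = ‖v‖ ^ 2 := by
  rw [EuclideanSpace.real_norm_sq_eq]; simp [dotProduct, sq]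

lemma HalfSphere.dotProduct_self (v : HalfSphere n) : v.1.ofLp ⬝ᵥ v.1.ofLp = 1 := by
  rw [ofLp_dotProduct_self, v.2.1, one_pow]

lemma HalfSphere.sum_sq (v : HalfSphere n) : ∑ i, v.1 i ^ 2 = 1 := by
  have := v.dotProduct_self
  simpa only [dotProduct, ← sq] using this

/-- A unit vector, or its opposite, lies in the half sphere. -/
lemma exists_halfSphere {w : Fin (n + 1) → ℝ} (hw : w ⬝ᵥ w = 1) :
    ∃ s : HalfSphere n, s.1.ofLp = w ∨ s.1.ofLp = -w := by
  have hnorm : ∀ v : Fin (n + 1) → ℝ, v ⬝ᵥ v = 1 → ‖WithLp.toLp 2 v‖ = 1 := fun v hv => by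
    have := ofLp_dotProduct_self (WithLp.toLp 2 v)
    simp only [hv] at this
    nlinarith [norm_nonneg (WithLp.toLp 2 v)]
  rcases le_total 0 (w 0) with h | h
  · exact ⟨⟨WithLp.toLp 2 w, hnorm w hw, h⟩, Or.inl rfl⟩
  · exact ⟨⟨WithLp.toLp 2 (-w), hnorm _ (by simp [hw]), by simpa using h⟩, Or.inr rfl⟩

lemma exists_isMinimizer (x : UpperIndex n → ℝ) : ∃ s, IsMinimizer (quadForm n) x s := by
  obtain ⟨a, w, hw, hB, hBw⟩ := exists_min_eigenvector (symmMatrix_isHermitian x)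
  obtain ⟨s, hs⟩ := exists_halfSphere hw
  have h1 : quadForm n x s = a := by
    rw [quadForm_eq]
    rcases hs with hs | hs <;> simp [hs, hBw, hw, Matrix.mulVec_neg]
  refine ⟨s, fun t => ?_⟩
  rw [h1, quadForm_eq]
  have := hB t.1.ofLp
  rwa [t.dotProduct_self, mul_one] at this

lemma IsMinimizer.quadForm_eq {x : UpperIndex n → ℝ} {s : HalfSphere n}
    (hs : IsMinimizer (quadForm n) x s) : quadForm n x s = minEig n x :=
  le_antisymm (le_ciInf hs) (ciInf_le ⟨_, Set.forall_mem_range.2 hs⟩ s)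

lemma minEig_le (x : UpperIndex n → ℝ) (s : HalfSphere n) : minEig n x ≤ quadForm n x s := by
  obtain ⟨t, ht⟩ := exists_isMinimizer x
  rw [← IsMinimizer.quadForm_eq ht]
  exact ht s

lemma optimizer_isMinimizer (x : UpperIndex n → ℝ) :
    IsMinimizer (quadForm n) x (optimizer (quadForm n) x) :=
  Classical.epsilon_spec (exists_isMinimizer x)

lemma minEig_mul_le (x : UpperIndex n → ℝ) (v : Fin (n + 1) → ℝ) :
    minEig n x * (v ⬝ᵥ v) ≤ v ⬝ᵥ symmMatrix n x *ᵥ v := by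
  by_cases hv : v = 0
  · simp [hv]
  have h0 : 0 < v ⬝ᵥ v := lt_of_le_of_ne (Wigner.dotProduct_self_nonneg v)
    (fun h => hv (dotProduct_self_eq_zero.1 h.symm))
  set c := √(v ⬝ᵥ v) with hc
  have hc0 : 0 < c := Real.sqrt_pos.2 h0
  have hcc : v ⬝ᵥ v = c ^ 2 := (Real.sq_sqrt h0.le).symm
  obtain ⟨s, hs⟩ := exists_halfSphere (n := n) (w := c⁻¹ • v) (by
    simp only [smul_dotProduct, dotProduct_smul, smul_eq_mul, hcc]; field_simp)
  have h1 := minEig_le x s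
  have h2 : quadForm n x s = (v ⬝ᵥ symmMatrix n x *ᵥ v) / c ^ 2 := by
    rw [Wigner.quadForm_eq]
    rcases hs with hs | hs <;>
      simp only [hs, smul_dotProduct, dotProduct_smul, Matrix.mulVec_smul, smul_eq_mul,
        Matrix.mulVec_neg, neg_dotProduct, dotProduct_neg] <;> field_simp
  rw [h2, le_div_iff₀ (by positivity)] at h1
  rwa [hcc]

lemma IsMinimizer.mulVec_eq {x : UpperIndex n → ℝ} {s : HalfSphere n}
    (hs : IsMinimizer (quadForm n) x s) :
    symmMatrix n x *ᵥ s.1.ofLp = minEig n x • s.1.ofLp := by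
  refine mulVec_eq_of_form_eq (symmMatrix_isHermitian x) (minEig_mul_le x) ?_
  rw [← Wigner.quadForm_eq, IsMinimizer.quadForm_eq hs, s.dotProduct_self, mul_one]

lemma HalfSphere.abs_le_one (v : HalfSphere n) (i : Fin (n + 1)) : |v.1 i| ≤ 1 := by
  have := PiLp.norm_apply_le v.1 i
  rwa [v.2.1, Real.norm_eq_abs] at this

lemma abs_quadForm_sub_le (x y : UpperIndex n → ℝ) (v : HalfSphere n) :
    |quadForm n x v - quadForm n y v| ≤ (n + 1) ^ 2 * ‖x - y‖ := by
  have h1 : quadForm n x v - quadForm n y v = ∑ i, ∑ j,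
      (symmMatrix n x i j - symmMatrix n y i j) * v.1 i * v.1 j := by
    simp only [quadForm, ← Finset.sum_sub_distrib]
    refine Finset.sum_congr rfl fun i _ => Finset.sum_congr rfl fun j _ => ?_
    ring
  rw [h1]
  have h2 : ∀ i j, |(symmMatrix n x i j - symmMatrix n y i j) * v.1 i * v.1 j| ≤ ‖x - y‖ := by
    intro i j
    rw [abs_mul, abs_mul]
    have h3 : |symmMatrix n x i j - symmMatrix n y i j| ≤ ‖x - y‖ := by
      simpa [symmMatrix] using norm_le_pi_norm (x - y) ⟨(min i j, max i j), min_le_max⟩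
    calc _ ≤ ‖x - y‖ * 1 * 1 := by
          gcongr
          · exact v.abs_le_one i
          · exact v.abs_le_one j
      _ = _ := by ring
  calc _ ≤ ∑ i : Fin (n + 1), ∑ j : Fin (n + 1), ‖x - y‖ :=
        (Finset.abs_sum_le_sum_abs _ _).trans (Finset.sum_le_sum fun i _ =>
          (Finset.abs_sum_le_sum_abs _ _).trans (Finset.sum_le_sum fun j _ => h2 i j))
    _ = _ := by simp; ring

/-- An infimum of functions that are uniformly Lipschitz in the entries. Used for continuity,
integrability and, through Rademacher's theorem, uniqueness of the minimizer. -/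
lemma minEig_lipschitz (n : ℕ) : LipschitzWith ((n + 1) ^ 2 : NNReal) (minEig n) := by
  refine LipschitzWith.of_le_add_mul _ fun x y => ?_
  obtain ⟨s, hs⟩ := exists_isMinimizer y
  rw [← IsMinimizer.quadForm_eq hs, dist_eq_norm]
  have h1 := minEig_le x s
  have h2 := (abs_le.1 (abs_quadForm_sub_le x y s)).2
  push_cast
  linarith

lemma continuous_minEig (n : ℕ) : Continuous (minEig n) := (minEig_lipschitz n).continuous

lemma shift_symmMatrix_posDef_iff (x : UpperIndex n → ℝ) (t : ℝ) :
    (shift (symmMatrix n x) t).PosDef ↔ 0 < minEig n x + t := by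
  constructor
  · intro h
    obtain ⟨s, hs⟩ := exists_isMinimizer x
    have hne : s.1.ofLp ≠ 0 := fun h0 => by
      have := s.dotProduct_self
      simp [h0] at this
    have := h.dotProduct_mulVec_pos hne
    simpa [shift_mulVec, IsMinimizer.mulVec_eq hs, dotProduct_add, s.dotProduct_self] using this
  · exact shift_posDef_of_lt (symmMatrix_isHermitian x) (minEig_mul_le x)

lemma continuous_symmMatrix (n : ℕ) : Continuous (symmMatrix n) := by
  unfold symmMatrix
  fun_prop

lemma measurable_resolv_symmMatrix (i j : Fin (n + 1)) :
    Measurable fun p : (UpperIndex n → ℝ) × ℝ => resolv (symmMatrix n p.1) p.2 i j := by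
  have hs : Continuous fun p : (UpperIndex n → ℝ) × ℝ => shift (symmMatrix n p.1) p.2 := by
    have := continuous_symmMatrix n
    unfold shift; fun_prop
  simp only [resolv, Matrix.inv_def, Ring.inverse_eq_inv', Matrix.smul_apply, smul_eq_mul]
  have h1 : Measurable fun p : (UpperIndex n → ℝ) × ℝ => (shift (symmMatrix n p.1) p.2).det :=
    hs.matrix_det.measurable
  have h2 : Measurable fun p : (UpperIndex n → ℝ) × ℝ =>
      (shift (symmMatrix n p.1) p.2).adjugate i j :=
    (hs.matrix_adjugate.matrix_elem i j).measurable
  exact h1.inv.mul h2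

lemma measurable_level : Measurable fun x : UpperIndex n → ℝ => level (symmMatrix n x) := by
  refine measurable_of_Iio fun s => ?_
  have h1 : (fun x : UpperIndex n → ℝ => level (symmMatrix n x)) ⁻¹' Set.Iio s =
      {x | 0 < minEig n x + s} ∩ {x | frobSq (resolv (symmMatrix n x) s) < 1} := by
    ext x
    rw [Set.mem_preimage, Set.mem_Iio, level_lt_iff (level_exists (symmMatrix_isHermitian x)),
      shift_symmMatrix_posDef_iff]
    rfl
  rw [h1]
  refine MeasurableSet.inter ?_ ?_
  · exact measurableSet_lt measurable_const ((continuous_minEig n).measurable.add_const s)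
  · refine measurableSet_lt ?_ measurable_const
    unfold frobSq
    refine Finset.measurable_fun_sum _ fun i _ => Finset.measurable_fun_sum _ fun j _ => ?_
    exact ((measurable_resolv_symmMatrix i j).comp (measurable_id.prodMk measurable_const)).pow_const 2

lemma measurable_levelRes (i j : Fin (n + 1)) :
    Measurable fun x : UpperIndex n → ℝ => levelRes (symmMatrix n x) i j := by
  have h : Measurable fun x : UpperIndex n → ℝ => (x, level (symmMatrix n x)) :=
    measurable_id.prodMk measurable_level
  have h1 := (measurable_resolv_symmMatrix i j).comp h
  simp only [Function.comp_def] at h1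
  simpa only [levelRes] using h1

/-- At its level the shifted matrix is positive definite, so the shift exceeds minus the smallest
eigenvalue. -/
lemma neg_minEig_le_level (x : UpperIndex n → ℝ) : -minEig n x ≤ level (symmMatrix n x) := by
  have := (shift_symmMatrix_posDef_iff x _).1
    (level_spec (level_exists (symmMatrix_isHermitian x))).1
  linarith

lemma minEig_le_diag (x : UpperIndex n → ℝ) (i : Fin (n + 1)) :
    minEig n x ≤ x ⟨(i, i), le_rfl⟩ := by
  have := minEig_mul_le x (Pi.single i 1)
  simpa [symmMatrix_diag] using this

lemma minEig_le_form {x : UpperIndex n → ℝ} {v : Fin (n + 1) → ℝ} (hv : v ⬝ᵥ v = 1) :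
    minEig n x ≤ v ⬝ᵥ symmMatrix n x *ᵥ v := by
  simpa [hv] using minEig_mul_le x v

end MinEigenvalue
end Wigner

namespace Wigner
open Matrix RandomOpt

/-! ### Subfamilies of an i.i.d. family. -/

section PiMeasure
variable {ι κ Λ : Type*} [Fintype ι] [Fintype κ] [Fintype Λ] {α : Type*} [MeasurableSpace α]
  (P : Measure α) [IsProbabilityMeasure P]

/-- Restricting an i.i.d. family along an injection gives an i.i.d. family. -/
lemma measurePreserving_precomp {e : ι → κ} (he : Function.Injective e) :
    MeasurePreserving (fun (x : κ → α) i => x (e i))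
      (Measure.pi fun _ : κ => P) (Measure.pi fun _ : ι => P) := by
  refine ⟨by fun_prop, ?_⟩
  have h := iIndepFun_pi (μ := fun _ : κ => P) (X := fun _ => id) fun _ => aemeasurable_id
  have h2 := h.precomp he
  have h3 := (iIndepFun_iff_map_fun_eq_pi_map (μ := Measure.pi fun _ : κ => P)
    (f := fun i (x : κ → α) => x (e i)) fun i => (measurable_pi_apply _).aemeasurable).1 h2
  rw [h3]
  congr
  funext i
  exact (measurePreserving_eval (fun _ : κ => P) (e i)).map_eq

/-- Two restrictions of an i.i.d. family to disjoint index sets are independent. -/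
lemma measurePreserving_precomp_prod {e : ι ⊕ κ → Λ} (he : Function.Injective e) :
    MeasurePreserving (fun x : Λ → α => ((fun i => x (e (Sum.inl i)), fun j => x (e (Sum.inr j))) :
        (ι → α) × (κ → α)))
      (Measure.pi fun _ : Λ => P)
      ((Measure.pi fun _ : ι => P).prod (Measure.pi fun _ : κ => P)) :=
  (measurePreserving_sumPiEquivProdPi (fun _ : ι ⊕ κ => P)).comp (measurePreserving_precomp P he)

end PiMeasure

/-! ### Second moments of quadratic forms in i.i.d. vectors. -/

/-- A centred law with finite moments of all orders. -/
structure Centered (P : Measure ℝ) : Prop where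
  integrable_pow : ∀ k : ℕ, Integrable (fun t : ℝ => t ^ k) P
  mean : ∫ t, t ∂P = 0

/-- The second moment of a law. -/
noncomputable def secondMoment (P : Measure ℝ) : ℝ := ∫ t, t ^ 2 ∂P

/-- The constant in the second moment bound for quadratic forms. -/
noncomputable def formConst (P : Measure ℝ) : ℝ :=
  4 * secondMoment P ^ 2 + 2 * ∫ t, (t ^ 2 - secondMoment P) ^ 2 ∂P

section Moments
variable {P : Measure ℝ} [IsProbabilityMeasure P]

lemma secondMoment_nonneg (P : Measure ℝ) : 0 ≤ secondMoment P :=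
  integral_nonneg fun _ => sq_nonneg _

lemma formConst_nonneg (P : Measure ℝ) : 0 ≤ formConst P := by
  have : 0 ≤ ∫ t, (t ^ 2 - secondMoment P) ^ 2 ∂P := integral_nonneg fun _ => sq_nonneg _
  unfold formConst
  positivity

lemma Centered.memLp_id (h : Centered P) : MemLp (fun t : ℝ => t) 2 P :=
  (memLp_two_iff_integrable_sq (by fun_prop)).2 (h.integrable_pow 2)

lemma Centered.memLp_sq (h : Centered P) : MemLp (fun t : ℝ => t ^ 2 - secondMoment P) 2 P := by
  refine MemLp.sub ((memLp_two_iff_integrable_sq (by fun_prop)).2 ?_) (memLp_const _)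
  simpa [← pow_mul] using h.integrable_pow 4

variable {ι : Type*} [Fintype ι]

lemma Centered.memLp_eval (h : Centered P) (i : ι) :
    MemLp (fun u : ι → ℝ => u i) 2 (Measure.pi fun _ : ι => P) :=
  h.memLp_id.comp_measurePreserving (measurePreserving_eval (fun _ : ι => P) i)

lemma Centered.integral_eval (h : Centered P) (i : ι) :
    ∫ u : ι → ℝ, u i ∂(Measure.pi fun _ : ι => P) = 0 := by
  have h1 : Measure.map (fun u : ι → ℝ => u i) (Measure.pi fun _ : ι => P) = P :=
    (measurePreserving_eval (fun _ : ι => P) i).map_eq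
  have h2 := integral_map (μ := Measure.pi fun _ : ι => P) (φ := fun u : ι → ℝ => u i)
    (measurable_pi_apply i).aemeasurable (f := fun t : ℝ => t) (by fun_prop)
  rw [h1] at h2
  exact h2.symm.trans h.mean

lemma integral_eval_sq (i : ι) :
    ∫ u : ι → ℝ, u i ^ 2 ∂(Measure.pi fun _ : ι => P) = secondMoment P := by
  have h1 : Measure.map (fun u : ι → ℝ => u i) (Measure.pi fun _ : ι => P) = P :=
    (measurePreserving_eval (fun _ : ι => P) i).map_eq
  have h2 := integral_map (μ := Measure.pi fun _ : ι => P) (φ := fun u : ι → ℝ => u i)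
    (measurable_pi_apply i).aemeasurable (f := fun t : ℝ => t ^ 2) (by fun_prop)
  rw [h1] at h2
  exact h2.symm

lemma Centered.integrable_mul (h : Centered P) (i j : ι) :
    Integrable (fun u : ι → ℝ => u i * u j) (Measure.pi fun _ : ι => P) :=
  (h.memLp_eval i).integrable_mul (h.memLp_eval j)

lemma Centered.integral_mul [DecidableEq ι] (h : Centered P) (i j : ι) :
    ∫ u : ι → ℝ, u i * u j ∂(Measure.pi fun _ : ι => P) = if i = j then secondMoment P else 0 := by
  split_ifs with hij
  · subst hij
    simpa [← sq] using integral_eval_sq (P := P) i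
  · have h1 := iIndepFun_pi (μ := fun _ : ι => P) (X := fun _ => id) fun _ => aemeasurable_id
    have h2 : IndepFun (fun u : ι → ℝ => u i) (fun u : ι → ℝ => u j)
      (Measure.pi fun _ : ι => P) := h1.indepFun hij
    rw [h2.integral_fun_mul_eq_mul_integral (measurable_pi_apply i).aestronglyMeasurable
      (measurable_pi_apply j).aestronglyMeasurable, h.integral_eval, zero_mul]

lemma Centered.memLp_linear (h : Centered P) (b : ι → ℝ) :
    MemLp (fun u : ι → ℝ => b ⬝ᵥ u) 2 (Measure.pi fun _ : ι => P) := by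
  simp only [dotProduct]
  exact memLp_finsetSum _ fun i _ => (h.memLp_eval i).const_mul _

lemma Centered.integrable_form (h : Centered P) (B : Matrix ι ι ℝ) :
    Integrable (fun u : ι → ℝ => u ⬝ᵥ B *ᵥ u) (Measure.pi fun _ : ι => P) := by
  simp only [dotProduct, Matrix.mulVec, Finset.mul_sum]
  refine integrable_finsetSum _ fun i _ => integrable_finsetSum _ fun j _ => ?_
  exact ((h.integrable_mul i j).const_mul (B i j)).congr (by filter_upwards with u; ring)

lemma Centered.integral_form (h : Centered P) (B : Matrix ι ι ℝ) :
    ∫ u : ι → ℝ, u ⬝ᵥ B *ᵥ u ∂(Measure.pi fun _ : ι => P) = secondMoment P * B.trace := by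
  classical
  have h1 : ∀ u : ι → ℝ, u ⬝ᵥ B *ᵥ u = ∑ i, ∑ j, B i j * (u i * u j) := fun u => by
    simp only [dotProduct, Matrix.mulVec, Finset.mul_sum]
    refine Finset.sum_congr rfl fun i _ => Finset.sum_congr rfl fun j _ => by ring
  simp only [h1]
  have h2 : ∀ i j, Integrable (fun u : ι → ℝ => B i j * (u i * u j))
    (Measure.pi fun _ : ι => P) := fun i j => (h.integrable_mul i j).const_mul _
  rw [integral_finsetSum _ fun i _ => integrable_finsetSum _ fun j _ => h2 i j]
  simp_rw [integral_finsetSum _ fun j _ => h2 _ j, integral_const_mul, h.integral_mul]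
  simp [Matrix.trace, Finset.mul_sum, mul_comm]

lemma Centered.integral_linear_sq (h : Centered P) (b : ι → ℝ) :
    ∫ u : ι → ℝ, (b ⬝ᵥ u) ^ 2 ∂(Measure.pi fun _ : ι => P) = secondMoment P * (b ⬝ᵥ b) := by
  have h1 := h.integral_form (Matrix.vecMulVec b b)
  rw [Matrix.trace_vecMulVec] at h1
  rw [← h1]
  congr 1
  ext u
  rw [Matrix.vecMulVec_mulVec]
  simp [dotProduct_comm u b, sq]

/-- The centred quadratic form of an i.i.d. vector has second moment at most a constant times the
squared Frobenius norm. -/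
lemma Centered.form_sq (h : Centered P) : ∀ (n : ℕ) (B : Matrix (Fin n) (Fin n) ℝ),
    MemLp (fun u : Fin n → ℝ => u ⬝ᵥ B *ᵥ u - secondMoment P * B.trace) 2
      (Measure.pi fun _ : Fin n => P) ∧
    ∫ u : Fin n → ℝ, (u ⬝ᵥ B *ᵥ u - secondMoment P * B.trace) ^ 2
      ∂(Measure.pi fun _ : Fin n => P) ≤ formConst P * frobSq B := by
  intro n
  induction n with
  | zero => intro B; simp [frobSq, Matrix.trace, dotProduct]
  | succ n ih =>
    intro B
    set τ := secondMoment P with hτ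
    -- Induction on the dimension by splitting off coordinate `0`: the centred form becomes `A1 + A2
    -- + A3`, where `A1` is the form in the other coordinates, `A2` is bilinear and `A3` is the
    -- centred square.
    set ν := Measure.pi fun _ : Fin n => P with hν
    set B' : Matrix (Fin n) (Fin n) ℝ := B.submatrix Fin.succ Fin.succ with hB'
    set b : Fin n → ℝ := fun j => B 0 j.succ + B j.succ 0 with hb
    obtain ⟨ih1, ih2⟩ := ih B'
    set Q : (Fin n → ℝ) → ℝ := fun u => u ⬝ᵥ B' *ᵥ u - τ * B'.trace with hQ
    have hQ0 : ∫ u, Q u ∂ν = 0 := by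
      rw [hQ, integral_sub (h.integrable_form B') (integrable_const _), h.integral_form]
      simp [hτ]
    set l : (Fin n → ℝ) → ℝ := fun u => b ⬝ᵥ u with hl
    have hl2 : MemLp l 2 ν := h.memLp_linear b
    set A1 : ℝ × (Fin n → ℝ) → ℝ := fun p => Q p.2 with hA1
    set A2 : ℝ × (Fin n → ℝ) → ℝ := fun p => p.1 * l p.2 with hA2
    set A3 : ℝ × (Fin n → ℝ) → ℝ := fun p => B 0 0 * (p.1 ^ 2 - τ) with hA3
    have m1 : MemLp A1 2 (P.prod ν) := ih1.comp_snd P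
    have m3 : MemLp A3 2 (P.prod ν) := (h.memLp_sq.comp_fst ν).const_mul _
    have hlm : Measurable l := by
      simp only [hl, dotProduct]; fun_prop
    have i2 : Integrable (fun p => A2 p ^ 2) (P.prod ν) := by
      refine ((h.integrable_pow 2).mul_prod (hl2.integrable_sq)).congr ?_
      filter_upwards with p
      simp only [hA2]; ring
    have m2 : MemLp A2 2 (P.prod ν) := (memLp_two_iff_integrable_sq (by
      have : Measurable A2 := measurable_fst.mul (hlm.comp measurable_snd)
      exact this.aestronglyMeasurable)).2 i2
    have hmp := (measurePreserving_piFinSuccAbove (fun _ : Fin (n + 1) => P) 0)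
    have hF : ∀ u : Fin (n + 1) → ℝ, u ⬝ᵥ B *ᵥ u - τ * B.trace =
        ((fun p => A1 p + (A2 p + A3 p)) ∘
          (MeasurableEquiv.piFinSuccAbove (fun _ : Fin (n + 1) => ℝ) 0)) u := by
      intro u
      have h1 : u ⬝ᵥ B *ᵥ u = B 0 0 * u 0 ^ 2 + u 0 * (∑ j : Fin n, (B 0 j.succ + B j.succ 0) * u j.succ)
          + ∑ i : Fin n, ∑ j : Fin n, u i.succ * (B i.succ j.succ * u j.succ) := by
        simp only [dotProduct, Matrix.mulVec, Fin.sum_univ_succ, Finset.mul_sum, mul_add, add_mul,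
          Finset.sum_add_distrib]
        have h2 : ∑ x : Fin n, u x.succ * (B x.succ 0 * u 0) =
          ∑ x : Fin n, u 0 * (B x.succ 0 * u x.succ) :=
          Finset.sum_congr rfl fun x _ => by ring
        rw [h2]
        ring
      have h3 : B.trace = B 0 0 + B'.trace := by
        simp [Matrix.trace, Fin.sum_univ_succ, hB']
      rw [h1, h3]
      simp only [Function.comp, hA1, hA2, hA3, hQ, hl, hb, MeasurableEquiv.piFinSuccAbove_apply,
        Fin.insertNthEquiv_symm_apply, Fin.removeNth_zero, Fin.tail, dotProduct, hB',
        Matrix.mulVec, Matrix.submatrix_apply, Finset.mul_sum]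
      ring
    have hF' : (fun u : Fin (n + 1) → ℝ => u ⬝ᵥ B *ᵥ u - τ * B.trace) =
        (fun p => A1 p + (A2 p + A3 p)) ∘
          (MeasurableEquiv.piFinSuccAbove (fun _ : Fin (n + 1) => ℝ) 0) := funext hF
    have mA : MemLp (fun p => A1 p + (A2 p + A3 p)) 2 (P.prod ν) := m1.add (m2.add m3)
    refine ⟨by rw [hF']; exact mA.comp_measurePreserving hmp, ?_⟩
    have hint : ∫ u : Fin (n + 1) → ℝ, (u ⬝ᵥ B *ᵥ u - τ * B.trace) ^ 2
        ∂(Measure.pi fun _ : Fin (n + 1) => P) =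
        ∫ p, (A1 p + (A2 p + A3 p)) ^ 2 ∂(P.prod ν) := by
      rw [← hmp.integral_comp' (g := fun p => (A1 p + (A2 p + A3 p)) ^ 2)]
      exact integral_congr_ae (by filter_upwards with u; rw [hF u]; rfl)
    rw [hint]
    have c12 : ∫ p, A1 p * A2 p ∂(P.prod ν) = 0 := by
      have : ∀ p, A1 p * A2 p = p.1 * (Q p.2 * l p.2) := fun p => by simp only [hA1, hA2]; ring
      simp_rw [this]
      rw [integral_prod_mul (fun t : ℝ => t) (fun u => Q u * l u), h.mean, zero_mul]
    have c13 : ∫ p, A1 p * A3 p ∂(P.prod ν) = 0 := by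
      have : ∀ p, A1 p * A3 p = (B 0 0 * (p.1 ^ 2 - τ)) * Q p.2 :=
        fun p => by simp only [hA1, hA3]; ring
      simp_rw [this]
      rw [integral_prod_mul (fun t : ℝ => B 0 0 * (t ^ 2 - τ)) Q, hQ0, mul_zero]
    have e1 : ∫ p, A1 p ^ 2 ∂(P.prod ν) = ∫ u, Q u ^ 2 ∂ν := by
      have := integral_prod_mul (μ := P) (ν := ν) (fun _ : ℝ => (1 : ℝ)) (fun u => Q u ^ 2)
      simpa using this
    have e2 : ∫ p, A2 p ^ 2 ∂(P.prod ν) = τ * (τ * (b ⬝ᵥ b)) := by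
      rw [hτ, ← h.integral_linear_sq b, ← hτ]
      have := integral_prod_mul (μ := P) (ν := ν) (fun t : ℝ => t ^ 2) (fun u => l u ^ 2)
      rw [hτ, secondMoment, ← this]
      congr 1
      ext p
      simp only [hA2]; ring
    have e3 : ∫ p, A3 p ^ 2 ∂(P.prod ν) = B 0 0 ^ 2 * ∫ t, (t ^ 2 - τ) ^ 2 ∂P := by
      have := integral_prod_mul (μ := P) (ν := ν) (fun t : ℝ => B 0 0 ^ 2 * (t ^ 2 - τ) ^ 2)
        (fun _ => (1 : ℝ))
      rw [integral_const_mul] at this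
      simp only [mul_one, integral_const, probReal_univ, smul_eq_mul] at this
      rw [← this]
      congr 1
      ext p
      simp only [hA3]; ring
    have k12 : Integrable (fun p => 2 * (A1 p * A2 p)) (P.prod ν) :=
      (m1.integrable_mul m2).const_mul 2
    have k13 : Integrable (fun p => 2 * (A1 p * A3 p)) (P.prod ν) :=
      (m1.integrable_mul m3).const_mul 2
    have j1 := m1.integrable_sq
    have j2 : Integrable (fun p => 2 * A2 p ^ 2) (P.prod ν) := i2.const_mul 2
    have j3 : Integrable (fun p => 2 * A3 p ^ 2) (P.prod ν) := m3.integrable_sq.const_mul 2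
    have j23 : Integrable (fun p => 2 * A2 p ^ 2 + 2 * A3 p ^ 2) (P.prod ν) := j2.add j3
    have k1 : Integrable (fun p => A1 p ^ 2 + 2 * (A1 p * A2 p)) (P.prod ν) := j1.add k12
    have k2 : Integrable (fun p => 2 * (A1 p * A3 p) + (2 * A2 p ^ 2 + 2 * A3 p ^ 2))
      (P.prod ν) := k13.add j23
    -- The products `A1 A2` and `A1 A3` integrate to zero, but `A2 A3` need not, as it involves the
    -- third moment; it is absorbed by `2ab ≤ a² + b²`, which is the origin of the factors two in
    -- `formConst`.
    have hle : ∫ p, (A1 p + (A2 p + A3 p)) ^ 2 ∂(P.prod ν) ≤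
        ∫ p, ((A1 p ^ 2 + 2 * (A1 p * A2 p)) + (2 * (A1 p * A3 p) + (2 * A2 p ^ 2 + 2 * A3 p ^ 2)))
          ∂(P.prod ν) := by
      refine integral_mono mA.integrable_sq (k1.add k2) fun p => ?_
      simp only
      nlinarith [sq_nonneg (A2 p - A3 p)]
    have hb2 : b ⬝ᵥ b ≤ 2 * ((∑ j : Fin n, B 0 j.succ ^ 2) + ∑ j : Fin n, B j.succ 0 ^ 2) := by
      rw [← Finset.sum_add_distrib, Finset.mul_sum]
      refine Finset.sum_le_sum fun j _ => ?_
      simp only [hb]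
      nlinarith [sq_nonneg (B 0 j.succ - B j.succ 0)]
    have hfrob : frobSq B = B 0 0 ^ 2 + (∑ j : Fin n, B 0 j.succ ^ 2) +
        (∑ j : Fin n, B j.succ 0 ^ 2) + frobSq B' := by
      simp only [frobSq, Fin.sum_univ_succ, Finset.sum_add_distrib, hB', Matrix.submatrix_apply]
      ring
    rw [integral_add k1 k2, integral_add j1 k12, integral_add k13 j23,
      integral_add j2 j3] at hle
    simp only [integral_const_mul] at hle
    rw [c12, c13, e1, e2, e3] at hle
    set V := ∫ t, (t ^ 2 - τ) ^ 2 ∂P with hV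
    have hV0 : 0 ≤ V := integral_nonneg fun _ => sq_nonneg _
    have hK : formConst P = 4 * τ ^ 2 + 2 * V := rfl
    rw [hK] at ih2 ⊢
    rw [hfrob]
    have t1 := mul_le_mul_of_nonneg_left hb2 (sq_nonneg τ)
    have t2 : 0 ≤ (∑ j : Fin n, B 0 j.succ ^ 2) + ∑ j : Fin n, B j.succ 0 ^ 2 :=
      add_nonneg (Finset.sum_nonneg fun _ _ => sq_nonneg _)
        (Finset.sum_nonneg fun _ _ => sq_nonneg _)
    have t3 := mul_nonneg hV0 t2
    have t4 := mul_nonneg (sq_nonneg τ) (sq_nonneg (B 0 0))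
    nlinarith

/-- Moments of the squared norm of a linear image of an i.i.d. vector. -/
lemma Centered.normSq_moments (h : Centered P) {n : ℕ} {κ : Type*} [Fintype κ]
    (W : Matrix κ (Fin n) ℝ) :
    Integrable (fun u : Fin n → ℝ => ((W *ᵥ u) ⬝ᵥ (W *ᵥ u))) (Measure.pi fun _ : Fin n => P) ∧
    ∫ u : Fin n → ℝ, (W *ᵥ u) ⬝ᵥ (W *ᵥ u) ∂(Measure.pi fun _ : Fin n => P) =
      secondMoment P * ∑ a, ∑ i, W a i ^ 2 ∧
    Integrable (fun u : Fin n → ℝ => ((W *ᵥ u) ⬝ᵥ (W *ᵥ u)) ^ 2) (Measure.pi fun _ : Fin n => P) ∧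
    ∫ u : Fin n → ℝ, ((W *ᵥ u) ⬝ᵥ (W *ᵥ u)) ^ 2 ∂(Measure.pi fun _ : Fin n => P) ≤
      (2 * formConst P + 2 * secondMoment P ^ 2) * (∑ a, ∑ i, W a i ^ 2) ^ 2 := by
  set B := Wᵀ * W with hB
  have hform : ∀ u : Fin n → ℝ, (W *ᵥ u) ⬝ᵥ (W *ᵥ u) = u ⬝ᵥ B *ᵥ u := fun u => by
    rw [hB, ← Matrix.mulVec_mulVec, Matrix.dotProduct_mulVec u, Matrix.vecMul_transpose]
  have htr : B.trace = ∑ a, ∑ i, W a i ^ 2 := by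
    rw [Finset.sum_comm]
    simp [hB, Matrix.trace, Matrix.mul_apply, sq]
  have hfr : frobSq B ≤ (∑ a, ∑ i, W a i ^ 2) ^ 2 := by
    have h1 : ∀ i j, B i j ^ 2 ≤ (∑ a, W a i ^ 2) * ∑ a, W a j ^ 2 := fun i j => by
      simpa [hB, Matrix.mul_apply] using
        Finset.sum_mul_sq_le_sq_mul_sq Finset.univ (fun a => W a i) (fun a => W a j)
    calc frobSq B ≤ ∑ i, ∑ j, (∑ a, W a i ^ 2) * ∑ a, W a j ^ 2 :=
          Finset.sum_le_sum fun i _ => Finset.sum_le_sum fun j _ => h1 i j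
      _ = (∑ a, ∑ i, W a i ^ 2) ^ 2 := by
          rw [Finset.sum_comm (f := fun a i => W a i ^ 2), sq, Finset.sum_mul_sum]
  obtain ⟨h1, h2⟩ := h.form_sq n B
  simp only [hform]
  rw [← htr] at hfr ⊢
  set τ := secondMoment P
  have hm : MemLp (fun u : Fin n → ℝ => u ⬝ᵥ B *ᵥ u) 2 (Measure.pi fun _ : Fin n => P) := by
    have := h1.add (memLp_const (τ * B.trace))
    refine this.ae_eq ?_
    filter_upwards with u
    simp
  refine ⟨h.integrable_form B, h.integral_form B, hm.integrable_sq, ?_⟩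
  have h3 : ∫ u : Fin n → ℝ, (u ⬝ᵥ B *ᵥ u) ^ 2 ∂(Measure.pi fun _ : Fin n => P) ≤
      ∫ u : Fin n → ℝ, (2 * (u ⬝ᵥ B *ᵥ u - τ * B.trace) ^ 2 + 2 * (τ * B.trace) ^ 2)
        ∂(Measure.pi fun _ : Fin n => P) := by
    refine integral_mono hm.integrable_sq
      ((h1.integrable_sq.const_mul 2).add (integrable_const _)) fun u => ?_
    simp only
    nlinarith [sq_nonneg (u ⬝ᵥ B *ᵥ u - 2 * (τ * B.trace))]
  rw [integral_add (h1.integrable_sq.const_mul 2) (integrable_const _), integral_const_mul] at h3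
  simp only [integral_const, probReal_univ, smul_eq_mul, one_mul] at h3
  have h4 := mul_le_mul_of_nonneg_left hfr (formConst_nonneg P)
  nlinarith

end Moments
end Wigner

namespace Wigner
open Matrix RandomOpt

/-! ### Splitting the entries into a row and an independent minor. -/

section Border
variable {n : ℕ}

/-- The index set of the larger matrix, split along the `i`-th row. -/
def borderIndex (i : Fin (n + 2)) : UpperIndex n ⊕ Fin (n + 2) → UpperIndex (n + 1)
  | Sum.inl p => ⟨(i.succAbove p.1.1, i.succAbove p.1.2),
      (Fin.strictMono_succAbove i).monotone p.2⟩
  | Sum.inr j => ⟨(min i j, max i j), min_le_max⟩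

lemma borderIndex_injective (i : Fin (n + 2)) : Function.Injective (borderIndex i) := by
  rintro (⟨⟨a, b⟩, hab⟩ | j) (⟨⟨c, d⟩, hcd⟩ | k) h
  · simpa [borderIndex, Fin.succAbove_right_injective.eq_iff] using h
  · exfalso
    simp only [borderIndex, Subtype.mk.injEq, Prod.mk.injEq] at h
    rcases le_total i k with hk | hk
    · rw [min_eq_left hk] at h; exact Fin.succAbove_ne i a h.1
    · rw [max_eq_left hk] at h; exact Fin.succAbove_ne i b h.2
  · exfalso
    simp only [borderIndex, Subtype.mk.injEq, Prod.mk.injEq] at h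
    rcases le_total i j with hk | hk
    · rw [min_eq_left hk] at h; exact Fin.succAbove_ne i c h.1.symm
    · rw [max_eq_left hk] at h; exact Fin.succAbove_ne i d h.2.symm
  · simp only [borderIndex, Subtype.mk.injEq, Prod.mk.injEq] at h
    congr 1
    rcases le_total i j with hj | hj <;> rcases le_total i k with hk | hk <;>
      simp only [hj, hk, min_eq_left, max_eq_right, min_eq_right, max_eq_left] at h
    · exact h.2
    · rw [h.2, ← h.1]
    · rw [h.1, ← h.2]
    · exact h.1

/-- The entries of the matrix with the `i`-th row and column deleted. -/
def minorOf (i : Fin (n + 2)) (x : UpperIndex (n + 1) → ℝ) : UpperIndex n → ℝ :=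
  fun p => x (borderIndex i (Sum.inl p))

/-- The entries of the `i`-th row. -/
def rowOf (i : Fin (n + 2)) (x : UpperIndex (n + 1) → ℝ) : Fin (n + 2) → ℝ :=
  fun j => x (borderIndex i (Sum.inr j))

lemma symmMatrix_minorOf (i : Fin (n + 2)) (x : UpperIndex (n + 1) → ℝ) :
    symmMatrix n (minorOf i x) = minor (symmMatrix (n + 1) x) i := by
  ext a b
  simp only [symmMatrix, minorOf, borderIndex, minor, Matrix.of_apply, Matrix.submatrix_apply]
  congr 2
  rw [(Fin.strictMono_succAbove i).monotone.map_min, (Fin.strictMono_succAbove i).monotone.map_max]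

lemma offRow_symmMatrix (i : Fin (n + 2)) (x : UpperIndex (n + 1) → ℝ) :
    offRow (symmMatrix (n + 1) x) i = i.removeNth (rowOf i x) := rfl

lemma rowOf_self (i : Fin (n + 2)) (x : UpperIndex (n + 1) → ℝ) :
    symmMatrix (n + 1) x i i = rowOf i x i := rfl

variable (P : Measure ℝ) [IsProbabilityMeasure P]

/-- The law of the entries of the matrix. -/
noncomputable abbrev entryLaw (n : ℕ) : Measure (UpperIndex n → ℝ) := Measure.pi fun _ => P

lemma measurePreserving_border (i : Fin (n + 2)) :
    MeasurePreserving (fun x => (minorOf i x, rowOf i x)) (entryLaw P (n + 1))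
      ((entryLaw P n).prod (Measure.pi fun _ : Fin (n + 2) => P)) :=
  measurePreserving_precomp_prod P (borderIndex_injective i)

lemma measurePreserving_minorOf (i : Fin (n + 2)) :
    MeasurePreserving (minorOf i) (entryLaw P (n + 1)) (entryLaw P n) :=
  measurePreserving_precomp P ((borderIndex_injective i).comp Sum.inl_injective)

lemma measurePreserving_removeNth {m : ℕ} (i : Fin (m + 1)) :
    MeasurePreserving (fun u : Fin (m + 1) → ℝ => i.removeNth u)
      (Measure.pi fun _ : Fin (m + 1) => P) (Measure.pi fun _ : Fin m => P) :=
  measurePreserving_precomp P Fin.succAbove_right_injective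

end Border

/-! ### The mean of the negative part of the smallest eigenvalue is `O(√n)`. -/

section Integrals

lemma MeasurePreserving.integral_comp_of_integrable {α β : Type*} [MeasurableSpace α]
    [MeasurableSpace β] {μ : Measure α} {ν : Measure β} {f : α → β}
    (hf : MeasurePreserving f μ ν) {g : β → ℝ} (hg : Integrable g ν) :
    ∫ a, g (f a) ∂μ = ∫ b, g b ∂ν := by
  rw [← hf.map_eq, integral_map hf.aemeasurable (by rw [hf.map_eq]; exact hg.aestronglyMeasurable)]

/-- Tonelli with a uniform bound on the fibres: moments of the row, computed for a fixed minor,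
integrate to a bound for the whole matrix. -/
lemma integrable_prod_of_bound {α β : Type*} [MeasurableSpace α] [MeasurableSpace β]
    {μ : Measure α} {ν : Measure β} [IsProbabilityMeasure μ] [IsProbabilityMeasure ν]
    {F : α × β → ℝ} {C : ℝ} (hF : Measurable F) (h0 : ∀ p, 0 ≤ F p)
    (hs : ∀ y, Integrable (fun u => F (y, u)) ν) (hb : ∀ y, ∫ u, F (y, u) ∂ν ≤ C) :
    Integrable F (μ.prod ν) ∧ ∫ p, F p ∂(μ.prod ν) ≤ C := by
  have hm : StronglyMeasurable fun y => ∫ u, F (y, u) ∂ν :=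
    hF.stronglyMeasurable.integral_prod_right'
  have hbd : ∀ y, ‖∫ u, F (y, u) ∂ν‖ ≤ C := fun y => by
    rw [Real.norm_of_nonneg (integral_nonneg fun u => h0 _)]; exact hb y
  have hi : Integrable (fun y => ∫ u, F (y, u) ∂ν) μ :=
    (integrable_const C).mono' hm.aestronglyMeasurable (ae_of_all _ hbd)
  have hI : Integrable F (μ.prod ν) := by
    refine (integrable_prod_iff hF.aestronglyMeasurable).2 ⟨ae_of_all _ hs, ?_⟩
    simpa only [Real.norm_of_nonneg (h0 _)] using hi
  refine ⟨hI, ?_⟩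
  rw [integral_prod _ hI]
  calc ∫ y, ∫ u, F (y, u) ∂ν ∂μ ≤ ∫ _, C ∂μ := integral_mono hi (integrable_const C) hb
    _ = C := by simp

variable {P : Measure ℝ} [IsProbabilityMeasure P] {n : ℕ}

lemma Centered.integrable_entry {ι : Type*} [Fintype ι] (h : Centered P) (i : ι) :
    Integrable (fun x : ι → ℝ => x i) (Measure.pi fun _ : ι => P) :=
  (h.memLp_eval i).integrable (by norm_num)

lemma minEig_zero : minEig n 0 = 0 := by
  obtain ⟨s, hs⟩ := exists_isMinimizer (0 : UpperIndex n → ℝ)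
  rw [← IsMinimizer.quadForm_eq hs]
  simp [quadForm, symmMatrix]

lemma Centered.integrable_minEig (h : Centered P) (n : ℕ) :
    Integrable (minEig n) (entryLaw P n) := by
  have h1 : Integrable (fun x : UpperIndex n → ℝ => ((n : ℝ) + 1) ^ 2 * ∑ p, |x p|)
      (entryLaw P n) :=
    (integrable_finsetSum _ fun p _ => (h.integrable_entry p).abs).const_mul _
  refine h1.mono' (continuous_minEig n).aestronglyMeasurable (ae_of_all _ fun x => ?_)
  have h2 := (minEig_lipschitz n).dist_le_mul x 0
  rw [dist_eq_norm, dist_eq_norm, minEig_zero, sub_zero, sub_zero] at h2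
  refine h2.trans ?_
  push_cast
  gcongr
  refine (pi_norm_le_iff_of_nonneg (Finset.sum_nonneg fun _ _ => abs_nonneg _)).2 fun p => ?_
  exact Finset.single_le_sum (f := fun p => |x p|) (fun _ _ => abs_nonneg _) (Finset.mem_univ p)

/-- The error term in the bound for the level. -/
noncomputable def levelError (c : ℝ) (i : Fin (n + 2))
    (p : (UpperIndex n → ℝ) × (Fin (n + 2) → ℝ)) : ℝ :=
  (i.removeNth p.2 ⬝ᵥ levelRes (symmMatrix n p.1) *ᵥ i.removeNth p.2
      - c * (levelRes (symmMatrix n p.1)).trace) ^ 2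
    + p.2 i ^ 2
    + ((levelRes (symmMatrix n p.1) *ᵥ i.removeNth p.2) ⬝ᵥ
        (levelRes (symmMatrix n p.1) *ᵥ i.removeNth p.2)) ^ 2

lemma measurable_levelError (c : ℝ) (i : Fin (n + 2)) : Measurable (levelError (n := n) c i) := by
  have h1 : ∀ a b, Measurable fun p : (UpperIndex n → ℝ) × (Fin (n + 2) → ℝ) =>
      levelRes (symmMatrix n p.1) a b := fun a b => (measurable_levelRes a b).comp measurable_fst
  have h2 : ∀ a, Measurable fun p : (UpperIndex n → ℝ) × (Fin (n + 2) → ℝ) =>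
      i.removeNth p.2 a := fun a => by
    unfold Fin.removeNth; fun_prop
  unfold levelError
  simp only [dotProduct, Matrix.mulVec, Matrix.trace, Matrix.diag]
  fun_prop

lemma levelRes_frobSq (y : UpperIndex n → ℝ) : frobSq (levelRes (symmMatrix n y)) = 1 :=
  (level_spec (level_exists (symmMatrix_isHermitian y))).2

/-- The constant in the bound for the level. -/
noncomputable def levelConst (P : Measure ℝ) : ℝ :=
  formConst P + secondMoment P + (2 * formConst P + 2 * secondMoment P ^ 2)

/-- For a fixed minor the forms have as matrix a resolvent of Frobenius norm one, so `form_sq` and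
`normSq_moments` give bounds free of `n`. -/
lemma Centered.integrable_levelError (h : Centered P) (i : Fin (n + 2)) :
    Integrable (levelError (secondMoment P) i)
      ((entryLaw P n).prod (Measure.pi fun _ : Fin (n + 2) => P)) ∧
    ∫ p, levelError (secondMoment P) i p
      ∂((entryLaw P n).prod (Measure.pi fun _ : Fin (n + 2) => P)) ≤ levelConst P := by
  have hmp := measurePreserving_removeNth P i
  have hslice : ∀ y : UpperIndex n → ℝ,
      Integrable (fun u => levelError (secondMoment P) i (y, u))
        (Measure.pi fun _ : Fin (n + 2) => P) ∧
      ∫ u, levelError (secondMoment P) i (y, u) ∂(Measure.pi fun _ : Fin (n + 2) => P)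
        ≤ levelConst P := by
    intro y
    obtain ⟨a1, a2⟩ := h.form_sq (n + 1) (levelRes (symmMatrix n y))
    obtain ⟨-, -, b1, b2⟩ := h.normSq_moments (levelRes (symmMatrix n y))
    have hfr := levelRes_frobSq y
    have hfr' : ∑ a, ∑ j, levelRes (symmMatrix n y) a j ^ 2 = 1 := hfr
    rw [hfr, mul_one] at a2
    rw [hfr', one_pow, mul_one] at b2
    rw [← MeasurePreserving.integral_comp_of_integrable hmp a1.integrable_sq] at a2
    rw [← MeasurePreserving.integral_comp_of_integrable hmp b1] at b2
    have c1 := hmp.integrable_comp_of_integrable a1.integrable_sq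
    have c2 := (h.memLp_eval i).integrable_sq
    have c3 := hmp.integrable_comp_of_integrable b1
    have c12 := c1.add c2
    refine ⟨c12.add c3, ?_⟩
    have e1 := integral_add c12 c3
    have e2 := integral_add c1 c2
    rw [integral_eval_sq] at e2
    simp only [Function.comp_def, Pi.add_apply] at e1 e2
    unfold levelError levelConst
    rw [e1, e2]
    linarith
  refine integrable_prod_of_bound (measurable_levelError _ i) (fun p => ?_)
    (fun y => (hslice y).1) (fun y => (hslice y).2)
  unfold levelError
  positivity

lemma neg_minEig_le (P : Measure ℝ) (x : UpperIndex (n + 1) → ℝ) :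
    -minEig (n + 1) x ≤ (secondMoment P + 3) * √(n + 2 : ℝ) +
      (∑ i, levelError (secondMoment P) i (minorOf i x, rowOf i x)) / (2 * √(n + 2 : ℝ)) := by
  refine (neg_minEig_le_level x).trans ?_
  have := level_le (symmMatrix_isHermitian x) (secondMoment_nonneg P)
  simpa only [levelError, symmMatrix_minorOf, offRow_symmMatrix, rowOf_self] using this

/-- The negative part of the smallest eigenvalue has mean of order `√n`. -/
theorem Centered.exists_minEig_bound (h : Centered P) :
    ∃ C : ℝ, 0 < C ∧ ∀ n : ℕ,
      ∫ x, max (-minEig n x) 0 ∂(entryLaw P n) ≤ C * √(n + 1 : ℝ) := by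
  set c := secondMoment P with hc
  have hc0 : 0 ≤ c := secondMoment_nonneg P
  have hK0 : 0 ≤ levelConst P := by
    have := formConst_nonneg P
    unfold levelConst; positivity
  refine ⟨c + 4 + levelConst P, by positivity, fun n => ?_⟩
  have hint : Integrable (fun x => max (-minEig n x) 0) (entryLaw P n) :=
    (h.integrable_minEig n).neg.pos_part
  cases n with
  -- A matrix of size one has no minor of positive size; its smallest eigenvalue is its only entry.
  | zero =>
    have h1 : ∀ x : UpperIndex 0 → ℝ, max (-minEig 0 x) 0 ≤ 1 + x ⟨(0, 0), le_rfl⟩ ^ 2 := by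
      intro x
      obtain ⟨s, hs⟩ := exists_isMinimizer x
      have h2 := s.sum_sq
      have h3 : minEig 0 x = x ⟨(0, 0), le_rfl⟩ := by
        rw [← IsMinimizer.quadForm_eq hs]
        simp at h2
        have : s.1 0 * s.1 0 = 1 := by rcases h2 with h2 | h2 <;> rw [h2] <;> norm_num
        simp [quadForm, symmMatrix_diag, mul_assoc, this]
      rw [h3]
      refine max_le ?_ (by positivity)
      nlinarith [sq_nonneg (x ⟨(0, 0), le_rfl⟩ + 1)]
    have i2 := (h.memLp_eval (ι := UpperIndex 0) ⟨(0, 0), le_rfl⟩).integrable_sq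
    have h4 := integral_mono hint ((integrable_const 1).add i2) h1
    have h5 := integral_add (integrable_const (1 : ℝ)) i2
    rw [integral_eval_sq] at h5
    simp only [Pi.add_apply] at h4
    rw [h5] at h4
    simp at h4 ⊢
    linarith
  | succ n =>
    set s := √(n + 2 : ℝ) with hs
    have hs0 : 0 < s := Real.sqrt_pos.2 (by positivity)
    have hss : s ^ 2 = n + 2 := Real.sq_sqrt (by positivity)
    have hcast : √(((n + 1 : ℕ) : ℝ) + 1) = s := by rw [hs]; push_cast; ring_nf
    rw [hcast]
    have hE : ∀ i : Fin (n + 2), Integrable (fun x => levelError c i (minorOf i x, rowOf i x))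
        (entryLaw P (n + 1)) := fun i =>
      (measurePreserving_border P i).integrable_comp_of_integrable (h.integrable_levelError i).1
    have hE2 : ∀ i : Fin (n + 2), ∫ x, levelError c i (minorOf i x, rowOf i x)
        ∂(entryLaw P (n + 1)) ≤ levelConst P := fun i => by
      have := MeasurePreserving.integral_comp_of_integrable (measurePreserving_border P i)
        (h.integrable_levelError i).1
      rw [this]
      exact (h.integrable_levelError i).2
    have hEs : Integrable (fun x => (∑ i, levelError c i (minorOf i x, rowOf i x)) / (2 * s))
        (entryLaw P (n + 1)) := (integrable_finsetSum _ fun i _ => hE i).div_const _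
    have hle : ∀ x, max (-minEig (n + 1) x) 0 ≤ (c + 3) * s +
        (∑ i, levelError c i (minorOf i x, rowOf i x)) / (2 * s) := fun x => by
      refine max_le (neg_minEig_le P x) ?_
      have : 0 ≤ ∑ i, levelError c i (minorOf i x, rowOf i x) :=
        Finset.sum_nonneg fun i _ => by unfold levelError; positivity
      positivity
    have h1 := integral_mono hint ((integrable_const ((c + 3) * s)).add hEs) hle
    have h2 := integral_add (integrable_const ((c + 3) * s)) hEs
    simp only [Pi.add_apply] at h1
    rw [h2, integral_div, integral_finsetSum _ fun i _ => hE i] at h1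
    have h3 := Finset.sum_le_sum fun i (_ : i ∈ Finset.univ) => hE2 i
    simp only [Finset.sum_const, Finset.card_univ, Fintype.card_fin, nsmul_eq_mul] at h3
    push_cast at h3
    rw [← hss] at h3
    simp only [integral_const, probReal_univ, smul_eq_mul, one_mul] at h1
    have h4 : (∑ i : Fin (n + 2), ∫ x, levelError c i (minorOf i x, rowOf i x)
        ∂(entryLaw P (n + 1))) / (2 * s) ≤ levelConst P * s := by
      rw [div_le_iff₀ (by positivity)]
      nlinarith [mul_nonneg hK0 (sq_nonneg s)]
    nlinarith [mul_nonneg hK0 hs0.le]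

/-- A bound for the absolute values of all the diagonal entries. -/
noncomputable def diagBound (n : ℕ) (x : UpperIndex n → ℝ) : ℝ :=
  √(n + 1 : ℝ) / 2 + (∑ j : Fin (n + 1), x ⟨(j, j), le_rfl⟩ ^ 2) / (2 * √(n + 1 : ℝ))

lemma abs_diag_le_diagBound (x : UpperIndex n → ℝ) (j : Fin (n + 1)) :
    |x ⟨(j, j), le_rfl⟩| ≤ diagBound n x := by
  have hs0 : 0 < √(n + 1 : ℝ) := Real.sqrt_pos.2 (by positivity)
  set s := √(n + 1 : ℝ) with hs
  -- The arithmetic–geometric mean inequality with weight `s` gives a bound for all diagonal entries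
  -- at once that still has mean of order `√n`.
  have h1 : |x ⟨(j, j), le_rfl⟩| ≤ s / 2 + x ⟨(j, j), le_rfl⟩ ^ 2 / (2 * s) := by
    have : s / 2 + x ⟨(j, j), le_rfl⟩ ^ 2 / (2 * s) - |x ⟨(j, j), le_rfl⟩| =
        (s - |x ⟨(j, j), le_rfl⟩|) ^ 2 / (2 * s) := by
      rw [sub_sq, sq_abs]; field_simp; ring
    have : 0 ≤ (s - |x ⟨(j, j), le_rfl⟩|) ^ 2 / (2 * s) := by positivity
    linarith
  refine h1.trans ?_
  unfold diagBound
  rw [← hs]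
  gcongr
  exact Finset.single_le_sum (f := fun j : Fin (n + 1) => x ⟨(j, j), le_rfl⟩ ^ 2)
    (fun _ _ => sq_nonneg _) (Finset.mem_univ j)

lemma Centered.diagBound_integral (h : Centered P) (n : ℕ) :
    Integrable (diagBound n) (entryLaw P n) ∧
      ∫ x, diagBound n x ∂(entryLaw P n) = (1 + secondMoment P) / 2 * √(n + 1 : ℝ) := by
  have hs0 : 0 < √(n + 1 : ℝ) := Real.sqrt_pos.2 (by positivity)
  have hss : √(n + 1 : ℝ) ^ 2 = n + 1 := Real.sq_sqrt (by positivity)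
  set s := √(n + 1 : ℝ) with hs
  have hsqi : ∀ j : Fin (n + 1), Integrable
      (fun x : UpperIndex n → ℝ => x ⟨(j, j), le_rfl⟩ ^ 2) (entryLaw P n) := fun j =>
    (h.memLp_eval _).integrable_sq
  have hi : Integrable (fun x : UpperIndex n → ℝ =>
      (∑ j : Fin (n + 1), x ⟨(j, j), le_rfl⟩ ^ 2) / (2 * s)) (entryLaw P n) :=
    (integrable_finsetSum _ fun j _ => hsqi j).div_const _
  refine ⟨(integrable_const (s / 2)).add hi, ?_⟩
  unfold diagBound
  rw [← hs, integral_add (integrable_const _) hi, integral_div (2 * s),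
    integral_finsetSum _ fun j _ => hsqi j]
  simp only [integral_eval_sq, integral_const, probReal_univ, smul_eq_mul, one_mul,
    Finset.sum_const, Finset.card_univ, Fintype.card_fin, nsmul_eq_mul]
  push_cast
  rw [← hss]
  field_simp

end Integrals
end Wigner

namespace Wigner
open Matrix RandomOpt

/-! ### Deleting a row: upper bound for the mean change. -/

section Deletion
variable {n : ℕ}

lemma removeNth_insertNth' {m : ℕ} (i : Fin (m + 1)) (a : ℝ) (w : Fin m → ℝ) :
    i.removeNth (i.insertNth a w : Fin (m + 1) → ℝ) = w := by
  ext j; simp [Fin.removeNth]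

/-- The quadratic form of a bordered matrix. -/
lemma form_insertNth {m : ℕ} {M : Matrix (Fin (m + 1)) (Fin (m + 1)) ℝ} (h : M.IsHermitian)
    (i : Fin (m + 1)) (a : ℝ) (w : Fin m → ℝ) :
    (i.insertNth a w : Fin (m + 1) → ℝ) ⬝ᵥ M *ᵥ (i.insertNth a w : Fin (m + 1) → ℝ) =
      M i i * a ^ 2 + 2 * a * (offRow M i ⬝ᵥ w) + w ⬝ᵥ minor M i *ᵥ w := by
  rw [dotProduct_succAbove i, mulVec_self i, removeNth_mulVec h, removeNth_insertNth']
  simp only [Fin.insertNth_apply_same, dotProduct_add, dotProduct_smul, smul_eq_mul]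
  rw [dotProduct_comm w (offRow M i)]
  ring

lemma insertNth_dotProduct {m : ℕ} (i : Fin (m + 1)) (a : ℝ) (w : Fin m → ℝ) :
    (i.insertNth a w : Fin (m + 1) → ℝ) ⬝ᵥ (i.insertNth a w : Fin (m + 1) → ℝ) =
      a ^ 2 + w ⬝ᵥ w := by
  rw [dotProduct_succAbove i, removeNth_insertNth']
  simp [sq]

lemma minEig_le_minorOf (i : Fin (n + 2)) (x : UpperIndex (n + 1) → ℝ) :
    minEig (n + 1) x ≤ minEig n (minorOf i x) := by
  obtain ⟨s, hs⟩ := exists_isMinimizer (minorOf i x)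
  have h1 := minEig_le_form (x := x) (v := i.insertNth 0 s.1.ofLp) (by
    rw [insertNth_dotProduct, s.dotProduct_self]; norm_num)
  rw [form_insertNth (symmMatrix_isHermitian x), ← symmMatrix_minorOf, ← Wigner.quadForm_eq,
    IsMinimizer.quadForm_eq hs] at h1
  linarith

/-- The truncated minimizer `w` is the trial vector for the minor. The eigenvector equation gives
its form exactly, so the loss is of order `s.1 i ^ 2`, and these squares sum to one over `i`. -/
lemma minorOf_gap_le (i : Fin (n + 2)) (x : UpperIndex (n + 1) → ℝ) {s : HalfSphere (n + 1)}
    (hs : IsMinimizer (quadForm (n + 1)) x s) {D : ℝ}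
    (hD : ∀ j : Fin (n + 2), |x ⟨(j, j), le_rfl⟩| ≤ D) :
    minEig n (minorOf i x) - minEig (n + 1) x ≤ 2 * s.1 i ^ 2 * (-minEig (n + 1) x + D) := by
  set M := symmMatrix (n + 1) x with hM
  set lam := minEig (n + 1) x with hlam
  set w := i.removeNth s.1.ofLp with hw
  have hE : M *ᵥ s.1.ofLp = lam • s.1.ofLp := IsMinimizer.mulVec_eq hs
  have h1 : M i i * s.1 i + offRow M i ⬝ᵥ w = lam * s.1 i := by
    have := congrFun hE i
    rwa [mulVec_self i] at this
  have h2 : s.1 i • offRow M i + minor M i *ᵥ w = lam • w := by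
    have := congrArg i.removeNth hE
    rwa [removeNth_mulVec (symmMatrix_isHermitian x)] at this
  have h3 : w ⬝ᵥ w = 1 - s.1 i ^ 2 := by
    have := s.dotProduct_self
    rw [dotProduct_succAbove i] at this
    linarith
  have h4 : w ⬝ᵥ minor M i *ᵥ w = lam * (1 - s.1 i ^ 2) - s.1 i * (lam * s.1 i - M i i * s.1 i) := by
    have := congrArg (fun v => w ⬝ᵥ v) h2
    simp only [dotProduct_add, dotProduct_smul, smul_eq_mul, h3] at this
    rw [dotProduct_comm w (offRow M i)] at this
    linear_combination this - s.1 i * h1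
  have h5 := minEig_mul_le (minorOf i x) w
  rw [symmMatrix_minorOf, h3, h4] at h5
  have h6 : M i i ≤ D := by
    rw [hM, symmMatrix_diag]; exact (le_abs_self _).trans (hD i)
  have h7 : 0 ≤ -lam + D := by
    have := minEig_le_diag x i
    rw [hM, symmMatrix_diag] at h6
    linarith
  have hsq := sq_nonneg (s.1 i)
  -- If most of the mass sits at `i`, the truncated vector may be too short to be useful; a diagonal
  -- entry of the minor then suffices, since `2 * s.1 i ^ 2 > 1`.
  rcases le_or_gt (s.1 i ^ 2) (1 / 2) with hle | hgt
  · have h8 : (minEig n (minorOf i x) - lam) * (1 - s.1 i ^ 2) ≤ s.1 i ^ 2 * (-lam + D) := by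
      nlinarith
    rcases le_or_gt (minEig n (minorOf i x) - lam) 0 with hneg | hpos
    · have : 0 ≤ 2 * s.1 i ^ 2 * (-lam + D) := by positivity
      linarith
    · nlinarith
  · have h8 := minEig_le_diag (minorOf i x) 0
    have h9 : minorOf i x ⟨(0, 0), le_rfl⟩ ≤ D := (le_abs_self _).trans (hD (i.succAbove 0))
    nlinarith

variable {P : Measure ℝ} [IsProbabilityMeasure P]

/-- Deleting one row raises the mean of the smallest eigenvalue by at most order `1 / √n`. -/
theorem Centered.exists_gap_bound (h : Centered P) :
    ∃ C : ℝ, 0 < C ∧ ∀ n : ℕ,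
      ∫ x, (minEig n (minorOf 0 x) - minEig (n + 1) x) ∂(entryLaw P (n + 1)) ≤
        C / √(n + 1 : ℝ) := by
  obtain ⟨C, hC, hbound⟩ := h.exists_minEig_bound
  set τ := secondMoment P with hτ
  have hτ0 : 0 ≤ τ := secondMoment_nonneg P
  refine ⟨2 * C + 1 + τ, by positivity, fun n => ?_⟩
  have hb := hbound (n + 1)
  set s := √(n + 2 : ℝ) with hs
  have hs0 : 0 < s := Real.sqrt_pos.2 (by positivity)
  have hss : s ^ 2 = n + 2 := Real.sq_sqrt (by positivity)
  have hcast : √(((n + 1 : ℕ) : ℝ) + 1) = s := by rw [hs]; push_cast; ring_nf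
  rw [hcast] at hb
  set μ := entryLaw P (n + 1) with hμ
  set D : (UpperIndex (n + 1) → ℝ) → ℝ := diagBound (n + 1) with hDdef
  have hD : ∀ x, ∀ j : Fin (n + 2), |x ⟨(j, j), le_rfl⟩| ≤ D x := abs_diag_le_diagBound
  obtain ⟨hDi, hDint⟩ := h.diagBound_integral (n + 1)
  rw [hcast] at hDint
  have hmin : ∀ i : Fin (n + 2), Integrable (fun x => minEig n (minorOf i x)) μ := fun i =>
    (measurePreserving_minorOf P i).integrable_comp_of_integrable (h.integrable_minEig n)
  have hmin1 := h.integrable_minEig (n + 1)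
  -- All minors have the same law, so the mean change for row `0` is the average over all rows.
  have heq : ∀ i : Fin (n + 2), ∫ x, (minEig n (minorOf i x) - minEig (n + 1) x) ∂μ =
      ∫ x, (minEig n (minorOf 0 x) - minEig (n + 1) x) ∂μ := fun i => by
    rw [integral_sub (hmin i) hmin1, integral_sub (hmin 0) hmin1,
      MeasurePreserving.integral_comp_of_integrable (measurePreserving_minorOf P i)
        (h.integrable_minEig n),
      MeasurePreserving.integral_comp_of_integrable (measurePreserving_minorOf P 0)
        (h.integrable_minEig n)]
  have hpt : ∀ x, ∑ i : Fin (n + 2), (minEig n (minorOf i x) - minEig (n + 1) x) ≤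
      2 * (max (-minEig (n + 1) x) 0 + D x) := fun x => by
    obtain ⟨v, hv⟩ := exists_isMinimizer x
    have h1 := Finset.sum_le_sum fun i (_ : i ∈ Finset.univ) => minorOf_gap_le i x hv (hD x)
    rw [← Finset.sum_mul, ← Finset.mul_sum, v.sum_sq] at h1
    have := le_max_left (-minEig (n + 1) x) 0
    linarith
  have hmaxi : Integrable (fun x => max (-minEig (n + 1) x) 0) μ := hmin1.neg.pos_part
  have h1 := integral_mono (integrable_finsetSum Finset.univ fun i _ => (hmin i).sub hmin1)
    ((hmaxi.add hDi).const_mul 2) hpt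
  rw [integral_finsetSum Finset.univ fun i _ => (hmin i).sub hmin1, integral_const_mul] at h1
  have h2 := integral_add hmaxi hDi
  simp only [Pi.sub_apply, Pi.add_apply] at h1
  rw [h2, hDint] at h1
  simp only [heq, Finset.sum_const, Finset.card_univ, Fintype.card_fin, nsmul_eq_mul] at h1
  push_cast at h1
  rw [← hss] at h1
  have h3 : ∫ x, (minEig n (minorOf 0 x) - minEig (n + 1) x) ∂μ ≤ (2 * C + 1 + τ) / s := by
    rw [le_div_iff₀ hs0]
    have : s * (s * ∫ x, (minEig n (minorOf 0 x) - minEig (n + 1) x) ∂μ) ≤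
      s * (2 * C + 1 + τ) := by nlinarith
    have := le_of_mul_le_mul_left this hs0
    linarith
  refine h3.trans ?_
  gcongr
  rw [hs]
  exact Real.sqrt_le_sqrt (by linarith)

end Deletion

/-! ### Adding a row: lower bound for the gain, and tightness of the near degeneracy. -/

section Gain
variable {n : ℕ}

lemma upperIndex_snd_ne_zero {p : UpperIndex (n + 1)} (h : p.1.1 ≠ 0) : p.1.2 ≠ 0 :=
  fun h2 => h (Fin.le_zero_iff.1 (h2 ▸ p.2))

/-- The entries of the matrix with first row `u` and remaining entries `y`. -/
def bordered (y : UpperIndex n → ℝ) (u : Fin (n + 2) → ℝ) : UpperIndex (n + 1) → ℝ := fun p =>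
  if h : p.1.1 = 0 then u p.1.2 else
    y ⟨(p.1.1.pred h, p.1.2.pred (upperIndex_snd_ne_zero h)),
      (Fin.pred_le_pred_iff (ha := h) (hb := upperIndex_snd_ne_zero h)).2 p.2⟩

lemma minorOf_bordered (y : UpperIndex n → ℝ) (u : Fin (n + 2) → ℝ) :
    minorOf 0 (bordered y u) = y := by
  ext p
  simp [minorOf, bordered, borderIndex]

lemma rowOf_bordered (y : UpperIndex n → ℝ) (u : Fin (n + 2) → ℝ) :
    rowOf 0 (bordered y u) = u := by
  ext j
  simp [rowOf, bordered, borderIndex]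

lemma bordered_split (x : UpperIndex (n + 1) → ℝ) : bordered (minorOf 0 x) (rowOf 0 x) = x := by
  ext ⟨⟨a, b⟩, hab⟩
  simp only [bordered, minorOf, rowOf, borderIndex]
  split_ifs with h
  · subst h; simp
  · simp

lemma measurable_bordered : Measurable fun p : (UpperIndex n → ℝ) × (Fin (n + 2) → ℝ) =>
    bordered p.1 p.2 := by
  refine measurable_pi_lambda _ fun q => ?_
  unfold bordered
  split_ifs <;> fun_prop

/-- There is a `k`-dimensional space of vectors on which the quadratic form exceeds the smallest
eigenvalue by at most `η`. -/
def NearDegenerate (k : ℕ) (η : ℝ) (y : UpperIndex n → ℝ) : Prop :=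
  ∃ W : Matrix (Fin k) (Fin (n + 1)) ℝ, W * Wᵀ = 1 ∧
    ∀ c : Fin k → ℝ, (Wᵀ *ᵥ c) ⬝ᵥ symmMatrix n y *ᵥ (Wᵀ *ᵥ c) ≤ (minEig n y + η) * (c ⬝ᵥ c)

/-- The gain in the smallest eigenvalue when a row is added. -/
noncomputable def gain (p : (UpperIndex n → ℝ) × (Fin (n + 2) → ℝ)) : ℝ :=
  minEig n p.1 - minEig (n + 1) (bordered p.1 p.2)

lemma gain_nonneg (p : (UpperIndex n → ℝ) × (Fin (n + 2) → ℝ)) : 0 ≤ gain p := by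
  have := minEig_le_minorOf 0 (bordered p.1 p.2)
  rw [minorOf_bordered] at this
  unfold gain; linarith

/-- The trial vector puts `-s` on the new coordinate and the remaining mass on the unit vector of
the nearly degenerate space aligned with the projected row. Its cross term is linear in `s`, its
cost quadratic. -/
lemma le_gain {k : ℕ} {η : ℝ} (hη : 0 ≤ η) {y : UpperIndex n → ℝ}
    {W : Matrix (Fin (k + 1)) (Fin (n + 1)) ℝ} (hW : W * Wᵀ = 1)
    (hform : ∀ c : Fin (k + 1) → ℝ, (Wᵀ *ᵥ c) ⬝ᵥ symmMatrix n y *ᵥ (Wᵀ *ᵥ c) ≤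
      (minEig n y + η) * (c ⬝ᵥ c)) (u : Fin (n + 2) → ℝ) {s b : ℝ} (hs0 : 0 ≤ s)
    (hs1 : s ^ 2 ≤ 3 / 4) (hb : 0 < b) :
    s * ((W *ᵥ (0 : Fin (n + 2)).removeNth u) ⬝ᵥ (W *ᵥ (0 : Fin (n + 2)).removeNth u) / b -
        ((W *ᵥ (0 : Fin (n + 2)).removeNth u) ⬝ᵥ (W *ᵥ (0 : Fin (n + 2)).removeNth u)) ^ 2 / b ^ 3)
      - s ^ 2 * (-minEig n y + u 0) - η ≤ gain (y, u) := by
  set v := (0 : Fin (n + 2)).removeNth u with hv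
  set R := (W *ᵥ v) ⬝ᵥ (W *ᵥ v) with hR
  have hR0 : 0 ≤ R := Wigner.dotProduct_self_nonneg _
  set r := √R with hr
  have hr0 : 0 ≤ r := Real.sqrt_nonneg _
  have hrr : r ^ 2 = R := Real.sq_sqrt hR0
  obtain ⟨c₀, hc1, hc2⟩ : ∃ c₀ : Fin (k + 1) → ℝ, c₀ ⬝ᵥ c₀ = 1 ∧ c₀ ⬝ᵥ (W *ᵥ v) = r := by
    rcases hr0.eq_or_lt with h0 | hpos
    · refine ⟨Pi.single 0 1, by simp, ?_⟩
      have : W *ᵥ v = 0 := dotProduct_self_eq_zero.1 (by rw [← hR, ← hrr, ← h0]; norm_num)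
      rw [this, ← h0, dotProduct_zero]
    · refine ⟨r⁻¹ • (W *ᵥ v), ?_, ?_⟩
      · simp only [smul_dotProduct, dotProduct_smul, smul_eq_mul, ← hR, ← hrr]; field_simp
      · simp only [smul_dotProduct, smul_eq_mul, ← hR, ← hrr]; field_simp
  set w := Wᵀ *ᵥ c₀ with hw
  have hww : w ⬝ᵥ w = 1 := by
    rw [hw, Matrix.dotProduct_mulVec, Matrix.vecMul_transpose, Matrix.mulVec_mulVec, hW,
      Matrix.one_mulVec, hc1]
  have hwv : v ⬝ᵥ w = r := by
    rw [← hc2, hw, Matrix.dotProduct_mulVec, Matrix.vecMul_transpose, dotProduct_comm]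
  have hwf := hform c₀
  rw [hc1, mul_one, ← hw] at hwf
  set q := √(1 - s ^ 2) with hq
  have hqq : q ^ 2 = 1 - s ^ 2 := Real.sq_sqrt (by linarith)
  have hq0 : 0 ≤ q := Real.sqrt_nonneg _
  have hq1 : 1 / 2 ≤ q := by nlinarith
  have h1 := minEig_le_form (x := bordered y u) (v := (0 : Fin (n + 2)).insertNth (-s) (q • w)) (by
    rw [insertNth_dotProduct, smul_dotProduct, dotProduct_smul, hww]
    simp only [smul_eq_mul, mul_one]
    nlinarith)
  rw [form_insertNth (symmMatrix_isHermitian _), ← symmMatrix_minorOf, minorOf_bordered,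
    rowOf_self, rowOf_bordered, offRow_symmMatrix, rowOf_bordered, ← hv, dotProduct_smul, hwv,
    Matrix.mulVec_smul, dotProduct_smul, smul_dotProduct] at h1
  simp only [smul_eq_mul] at h1
  have h2 : q * (q * (w ⬝ᵥ symmMatrix n y *ᵥ w)) ≤ q ^ 2 * (minEig n y + η) := by
    nlinarith [mul_le_mul_of_nonneg_left hwf (sq_nonneg q)]
  -- This is where `s ^ 2 ≤ 3 / 4` enters, through `q ≥ 1 / 2`.
  have h3 : s * r ≤ 2 * s * (q * r) := by nlinarith [mul_nonneg hs0 hr0]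
  -- A polynomial minorant of `r = √R`, equivalent to `1 - z + z ^ 3 ≥ 0` for `z = r / b`. It bounds
  -- the mean of `r` from below using only the first two moments of `R`.
  have h4 : R / b - R ^ 2 / b ^ 3 ≤ r := by
    rw [← hrr]
    have e : r - (r ^ 2 / b - (r ^ 2) ^ 2 / b ^ 3) = r * (1 - r / b + (r / b) ^ 3) := by
      field_simp
      ring
    have hz : 0 ≤ r / b := by positivity
    have : 0 ≤ 1 - r / b + (r / b) ^ 3 := by
      rcases le_total (r / b) 1 with hz1 | hz1
      · have : 0 ≤ (r / b) ^ 3 := by positivity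
        linarith
      · nlinarith [mul_nonneg hz (by nlinarith : 0 ≤ (r / b) ^ 2 - 1)]
    have := mul_nonneg hr0 this
    linarith
  have h5 := mul_le_mul_of_nonneg_left h4 hs0
  unfold gain
  simp only
  rw [hqq] at h2
  nlinarith [mul_nonneg (sq_nonneg s) hη]

variable {P : Measure ℝ} [IsProbabilityMeasure P]

lemma measurable_gain : Measurable (gain (n := n)) :=
  ((continuous_minEig n).measurable.comp measurable_fst).sub
    ((continuous_minEig (n + 1)).measurable.comp measurable_bordered)

lemma gain_split (x : UpperIndex (n + 1) → ℝ) :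
    gain (minorOf 0 x, rowOf 0 x) = minEig n (minorOf 0 x) - minEig (n + 1) x := by
  unfold gain; rw [bordered_split]

lemma Centered.integrable_gain (h : Centered P) :
    Integrable (gain (n := n)) ((entryLaw P n).prod (Measure.pi fun _ : Fin (n + 2) => P)) := by
  rw [← (measurePreserving_border P (0 : Fin (n + 2))).integrable_comp
    measurable_gain.aestronglyMeasurable]
  have h1 : Integrable (fun x => minEig n (minorOf 0 x) - minEig (n + 1) x) (entryLaw P (n + 1)) :=
    ((measurePreserving_minorOf P 0).integrable_comp_of_integrable (h.integrable_minEig n)).sub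
      (h.integrable_minEig (n + 1))
  refine h1.congr (ae_of_all _ fun x => ?_)
  exact (gain_split x).symm

/-- Integrability is needed for every `y`, not just almost every one, because the lower bound for
the mean gain is asserted at each nearly degenerate `y`. -/
lemma Centered.integrable_gain_slice (h : Centered P) (y : UpperIndex n → ℝ) :
    Integrable (fun u => gain (y, u)) (Measure.pi fun _ : Fin (n + 2) => P) := by
  have hm : Measurable fun u : Fin (n + 2) → ℝ => gain (y, u) :=
    measurable_gain.comp (measurable_const.prodMk measurable_id)
  set K : ℝ := (n + 2) ^ 2 with hK
  have h1 : Integrable (fun u : Fin (n + 2) → ℝ =>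
      |minEig n y| + K * ((∑ p, |y p|) + ∑ j, |u j|)) (Measure.pi fun _ : Fin (n + 2) => P) :=
    (integrable_const _).add (((integrable_const _).add
      (integrable_finsetSum _ fun j _ => (h.integrable_entry j).abs)).const_mul _)
  refine h1.mono' hm.aestronglyMeasurable (ae_of_all _ fun u => ?_)
  have h2 := (minEig_lipschitz (n + 1)).dist_le_mul (bordered y u) 0
  rw [dist_eq_norm, dist_eq_norm, minEig_zero, sub_zero, sub_zero] at h2
  have h3 : ‖bordered y u‖ ≤ (∑ p, |y p|) + ∑ j, |u j| := by
    refine (pi_norm_le_iff_of_nonneg (by positivity)).2 fun p => ?_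
    unfold bordered
    split_ifs with hp
    · have := Finset.single_le_sum (f := fun j => |u j|) (fun _ _ => abs_nonneg _)
        (Finset.mem_univ p.1.2)
      have h4 : 0 ≤ ∑ p, |y p| := by positivity
      simp only [Real.norm_eq_abs]
      linarith
    · have h4 : 0 ≤ ∑ j, |u j| := by positivity
      refine le_trans ?_ (le_add_of_nonneg_right h4)
      exact Finset.single_le_sum (f := fun p => |y p|) (fun _ _ => abs_nonneg _)
        (Finset.mem_univ _)
  have h5 : ‖minEig (n + 1) (bordered y u)‖ ≤ K * ((∑ p, |y p|) + ∑ j, |u j|) := by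
    refine h2.trans ?_
    push_cast
    have : ((n : ℝ) + 1 + 1) ^ 2 = K := by rw [hK]; ring
    rw [this]
    gcongr
  unfold gain
  exact (norm_sub_le _ _).trans (add_le_add (by rfl) h5)

lemma sum_sq_eq_card {k : ℕ} {W : Matrix (Fin k) (Fin (n + 1)) ℝ} (hW : W * Wᵀ = 1) :
    ∑ a, ∑ i, W a i ^ 2 = k := by
  have : (W * Wᵀ).trace = k := by rw [hW]; simp
  rw [← this]
  simp [Matrix.trace, Matrix.mul_apply, sq]

/-- Bordering a nearly degenerate matrix by an independent row lowers the smallest eigenvalue. -/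
lemma Centered.le_integral_gain (h : Centered P) (hτ : 0 < secondMoment P) :
    ∃ g : ℝ, 0 < g ∧ ∀ (n k : ℕ) (y : UpperIndex n → ℝ) (η s : ℝ), 0 ≤ η → 0 ≤ s →
      s ^ 2 ≤ 3 / 4 → NearDegenerate (k + 1) η y →
      s * g * √(k + 1 : ℝ) - s ^ 2 * (-minEig n y) - η ≤
        ∫ u, gain (y, u) ∂(Measure.pi fun _ : Fin (n + 2) => P) := by
  set τ := secondMoment P with hτd
  set K := 2 * formConst P + 2 * secondMoment P ^ 2 with hK
  have hK0 : 0 < K := by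
    have := formConst_nonneg P
    rw [hK]; positivity
  -- Chosen so that the subtracted second-moment term is at most half of the main term.
  set b0 := √(2 * K / τ) with hb0
  have hb0p : 0 < b0 := Real.sqrt_pos.2 (by positivity)
  have hb0s : b0 ^ 2 = 2 * K / τ := Real.sq_sqrt (by positivity)
  refine ⟨τ / (2 * b0), by positivity, fun n k y η s hη hs0 hs1 hbad => ?_⟩
  obtain ⟨W, hW, hform⟩ := hbad
  set ρ := √(k + 1 : ℝ) with hρ
  have hρ0 : 0 < ρ := Real.sqrt_pos.2 (by positivity)
  have hρs : ρ ^ 2 = k + 1 := Real.sq_sqrt (by positivity)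
  set b := b0 * ρ with hb
  have hbp : 0 < b := by positivity
  obtain ⟨i1, m1, i2, m2⟩ := h.normSq_moments W
  have hcard := sum_sq_eq_card hW
  push_cast at hcard
  rw [hcard, ← hρs] at m1 m2
  have hmp := measurePreserving_removeNth P (0 : Fin (n + 2))
  rw [← MeasurePreserving.integral_comp_of_integrable hmp i1] at m1
  rw [← MeasurePreserving.integral_comp_of_integrable hmp i2] at m2
  have j1 := hmp.integrable_comp_of_integrable i1
  have j2 := hmp.integrable_comp_of_integrable i2
  simp only [Function.comp_def] at j1 j2
  set R : (Fin (n + 2) → ℝ) → ℝ := fun u =>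
    (W *ᵥ (0 : Fin (n + 2)).removeNth u) ⬝ᵥ (W *ᵥ (0 : Fin (n + 2)).removeNth u) with hR
  set ν := Measure.pi fun _ : Fin (n + 2) => P with hν
  have l1 : Integrable (fun u => R u / b) ν := j1.div_const b
  have l2 : Integrable (fun u => R u ^ 2 / b ^ 3) ν := j2.div_const _
  have l12 : Integrable (fun u => s * (R u / b - R u ^ 2 / b ^ 3)) ν := (l1.sub l2).const_mul s
  have l3 : Integrable (fun u : Fin (n + 2) → ℝ => s ^ 2 * (-minEig n y + u 0)) ν :=
    ((integrable_const _).add (h.integrable_entry 0)).const_mul _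
  have l123 : Integrable (fun u => s * (R u / b - R u ^ 2 / b ^ 3) -
    s ^ 2 * (-minEig n y + u 0)) ν := l12.sub l3
  have hle := integral_mono (l123.sub (integrable_const η)) (h.integrable_gain_slice y)
    fun u => le_gain hη hW hform u hs0 hs1 hbp
  simp only [Pi.sub_apply] at hle
  rw [integral_sub l123 (integrable_const η), integral_sub l12 l3, integral_const_mul,
    integral_const_mul, integral_sub l1 l2, integral_div, integral_div,
    integral_add (integrable_const _) (h.integrable_entry 0), h.integral_eval, m1] at hle
  simp only [integral_const, probReal_univ, smul_eq_mul, one_mul, add_zero] at hle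
  refine le_trans ?_ hle
  have e1 : (∫ u, R u ^ 2 ∂ν) / b ^ 3 ≤ K * (ρ ^ 2) ^ 2 / b ^ 3 := by gcongr
  have e2 : K * (ρ ^ 2) ^ 2 / b ^ 3 = τ / (2 * b0) * ρ := by
    have : K = b0 ^ 2 * τ / 2 := by rw [hb0s]; field_simp
    rw [hb, this]; field_simp
  have e3 : τ * ρ ^ 2 / b = 2 * (τ / (2 * b0) * ρ) := by rw [hb]; field_simp
  rw [← hτd, e3]
  rw [e2] at e1
  nlinarith

/-- The number of eigenvalues within order `1 / √n` of the smallest one is tight. -/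
theorem Centered.nearDegenerate_tight (h : Centered P) (hτ : 0 < secondMoment P) {H δ : ℝ}
    (hH : 0 ≤ H) (hδ : 0 < δ) : ∃ k n₀ : ℕ, ∀ n ≥ n₀,
      (entryLaw P n) {y | NearDegenerate k (H / √(n + 1 : ℝ)) y} ≤ ENNReal.ofReal δ := by
  obtain ⟨C1, hC1, hb1⟩ := h.exists_minEig_bound
  obtain ⟨C2, hC2, hb2⟩ := h.exists_gap_bound
  obtain ⟨g, hg, hgain⟩ := h.le_integral_gain hτ
  -- `B` is the Markov threshold for `-λ / √n`. With this bound the tilt `s` below maximizes `s g ρ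
  -- - s² B N`, with value `G (k + 1) / N`. Then `k` is taken large enough to beat the mean gain,
  -- and `n₀` large enough that `s ^ 2 ≤ 3 / 4`.
  set B := 2 * C1 / δ with hB
  have hB0 : 0 < B := by positivity
  set G := g ^ 2 / (4 * B) with hG
  have hG0 : 0 < G := by positivity
  obtain ⟨k, hk⟩ := exists_nat_ge ((H + 2 * C2 / δ) / G)
  obtain ⟨n₀, hn₀⟩ := exists_nat_ge (g ^ 2 * (k + 1) / (3 * B ^ 2))
  refine ⟨k + 1, n₀, fun n hn => ?_⟩
  set N := √(n + 1 : ℝ) with hN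
  have hN0 : 0 < N := Real.sqrt_pos.2 (by positivity)
  have hNN : N ^ 2 = n + 1 := Real.sq_sqrt (by positivity)
  set μ := entryLaw P n with hμ
  set ν := Measure.pi fun _ : Fin (n + 2) => P with hν
  set Γ : (UpperIndex n → ℝ) → ℝ := fun y => ∫ u, gain (y, u) ∂ν with hΓ
  have hΓ0 : ∀ y, 0 ≤ Γ y := fun y => integral_nonneg fun u => gain_nonneg _
  have hΓi : Integrable Γ μ := (h.integrable_gain (n := n)).integral_prod_left
  have hΓle : ∫ y, Γ y ∂μ ≤ C2 / N := by
    have h1 := hb2 n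
    simp only [← gain_split] at h1
    rw [MeasurePreserving.integral_comp_of_integrable (measurePreserving_border P 0)
      h.integrable_gain, integral_prod _ h.integrable_gain] at h1
    exact h1
  -- Near degeneracy forces a large conditional mean gain or a very negative eigenvalue. Covering by
  -- these two events avoids any question of measurability of the event itself.
  have hsub : {y : UpperIndex n → ℝ | NearDegenerate (k + 1) (H / N) y} ⊆
      {y | 2 * C2 / δ / N ≤ Γ y} ∪ {y | B * N ≤ max (-minEig n y) 0} := by
    intro y hy
    by_contra hcon
    simp only [Set.mem_union, Set.mem_ofPred_eq, not_or, not_le] at hcon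
    obtain ⟨hc1, hc2⟩ := hcon
    have hL : -minEig n y < B * N := (le_max_left _ _).trans_lt hc2
    set ρ := √(k + 1 : ℝ) with hρ
    have hρ0 : 0 < ρ := Real.sqrt_pos.2 (by positivity)
    have hρs : ρ ^ 2 = k + 1 := Real.sq_sqrt (by positivity)
    set s := g * ρ / (2 * B * N) with hs
    have hs0 : 0 < s := by positivity
    have hs1 : s ^ 2 ≤ 3 / 4 := by
      have h1 : g ^ 2 * (k + 1) / (3 * B ^ 2) ≤ N ^ 2 := by
        rw [hNN]
        have : (n₀ : ℝ) ≤ n := by exact_mod_cast hn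
        linarith
      rw [div_le_iff₀ (by positivity), ← hρs] at h1
      rw [hs, div_pow, div_le_iff₀ (by positivity)]
      nlinarith
    have h1 := hgain n k y (H / N) s (by positivity) hs0.le hs1 hy
    have h2 : s ^ 2 * (-minEig n y) ≤ s ^ 2 * (B * N) :=
      mul_le_mul_of_nonneg_left hL.le (sq_nonneg s)
    have h3 : s * g * ρ - s ^ 2 * (B * N) = G * (k + 1) / N := by
      rw [← hρs, hs, hG]; field_simp; ring
    rw [div_le_iff₀ hG0] at hk
    have h4 : (H + 2 * C2 / δ) / N ≤ G * (k + 1) / N := by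
      gcongr
      nlinarith
    rw [add_div] at h4
    have h5 : Γ y = ∫ u, gain (y, u) ∂ν := rfl
    rw [h5] at hc1
    linarith
  have mk1 : μ {y | 2 * C2 / δ / N ≤ Γ y} ≤ ENNReal.ofReal (δ / 2) := by
    have h1 := mul_meas_ge_le_integral_of_nonneg (ae_of_all _ hΓ0) hΓi (2 * C2 / δ / N)
    rw [← ENNReal.ofReal_toReal (measure_ne_top μ _)]
    refine ENNReal.ofReal_le_ofReal ?_
    change _ * (μ {y | 2 * C2 / δ / N ≤ Γ y}).toReal ≤ _ at h1
    set q := (μ {y | 2 * C2 / δ / N ≤ Γ y}).toReal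
    have h2 : 2 * C2 / δ / N * q ≤ C2 / N := h1.trans hΓle
    have h3 : C2 / N = 2 * C2 / δ / N * (δ / 2) := by field_simp
    rw [h3] at h2
    exact le_of_mul_le_mul_left h2 (by positivity)
  have mk2 : μ {y | B * N ≤ max (-minEig n y) 0} ≤ ENNReal.ofReal (δ / 2) := by
    have hint : Integrable (fun x => max (-minEig n x) 0) μ := (h.integrable_minEig n).neg.pos_part
    have h1 := mul_meas_ge_le_integral_of_nonneg (ae_of_all _ fun y => le_max_right _ _) hint (B * N)
    rw [← ENNReal.ofReal_toReal (measure_ne_top μ _)]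
    refine ENNReal.ofReal_le_ofReal ?_
    change _ * (μ {y | B * N ≤ max (-minEig n y) 0}).toReal ≤ _ at h1
    set q := (μ {y | B * N ≤ max (-minEig n y) 0}).toReal
    have h2 : B * N * q ≤ C1 * N := h1.trans (hb1 n)
    have h3 : C1 * N = B * N * (δ / 2) := by rw [hB]; field_simp
    rw [h3] at h2
    exact le_of_mul_le_mul_left h2 (by positivity)
  calc μ {y | NearDegenerate (k + 1) (H / N) y} ≤ _ := measure_mono hsub
    _ ≤ _ := measure_union_le _ _
    _ ≤ ENNReal.ofReal (δ / 2) + ENNReal.ofReal (δ / 2) := add_le_add mk1 mk2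
    _ = ENNReal.ofReal δ := by
      rw [← ENNReal.ofReal_add (by positivity) (by positivity), add_halves]

end Gain
end Wigner

namespace Wigner
open Matrix RandomOpt

/-! ### Null hyperplanes for product laws with a density. -/

section AbsolutelyContinuous
variable {P : Measure ℝ} [IsProbabilityMeasure P]

lemma pi_fin_absolutelyContinuous (hP : P ≪ volume) :
    ∀ n : ℕ, (Measure.pi fun _ : Fin n => P) ≪ Measure.pi fun _ : Fin n => (volume : Measure ℝ)
  | 0 => by
    rw [Measure.pi_of_empty, Measure.pi_of_empty]
  | n + 1 => by
    rw [← ((measurePreserving_piFinSuccAbove (fun _ : Fin (n + 1) => P) 0).symm).map_eq,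
      ← ((measurePreserving_piFinSuccAbove
        (fun _ : Fin (n + 1) => (volume : Measure ℝ)) 0).symm).map_eq]
    exact (hP.prod (pi_fin_absolutelyContinuous hP n)).map (MeasurableEquiv.measurable _)

lemma pi_absolutelyContinuous {ι : Type*} [Fintype ι] (hP : P ≪ volume) :
    (Measure.pi fun _ : ι => P) ≪ Measure.pi fun _ : ι => (volume : Measure ℝ) := by
  have e := (Fintype.equivFin ι).symm
  rw [← (measurePreserving_piCongrLeft (fun _ : ι => P) e).map_eq,
    ← (measurePreserving_piCongrLeft (fun _ : ι => (volume : Measure ℝ)) e).map_eq]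
  exact (pi_fin_absolutelyContinuous hP _).map (MeasurableEquiv.measurable _)

lemma hyperplane_null (hP : P ≪ volume) {m : ℕ} {w : Fin m → ℝ} (hw : w ≠ 0)
    (i : Fin (m + 1)) :
    (Measure.pi fun _ : Fin (m + 1) => P) {u | i.removeNth u ⬝ᵥ w = 0} = 0 := by
  refine pi_absolutelyContinuous hP ?_
  let φ : (Fin (m + 1) → ℝ) →ₗ[ℝ] ℝ :=
    { toFun := fun u => i.removeNth u ⬝ᵥ w
      map_add' := fun u v => add_dotProduct (i.removeNth u) (i.removeNth v) w
      map_smul' := fun c u => smul_dotProduct c (i.removeNth u) w }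
  have hne : LinearMap.ker φ ≠ ⊤ := by
    intro h
    have h1 : i.insertNth 0 w ∈ LinearMap.ker φ := by rw [h]; trivial
    have h2 : i.removeNth (i.insertNth 0 w : Fin (m + 1) → ℝ) ⬝ᵥ w = 0 := h1
    rw [removeNth_insertNth'] at h2
    exact hw (dotProduct_self_eq_zero.1 h2)
  exact Measure.addHaar_submodule volume (LinearMap.ker φ) hne

end AbsolutelyContinuous

/-! ### Almost sure uniqueness and measurability of the minimizer. -/

section Uniqueness
variable {n : ℕ}

lemma quadForm_add_smul (x h : UpperIndex n → ℝ) (t : ℝ) (s : HalfSphere n) :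
    quadForm n (x + t • h) s = quadForm n x s + t * quadForm n h s := by
  simp only [quadForm, Finset.mul_sum, ← Finset.sum_add_distrib]
  refine Finset.sum_congr rfl fun i _ => Finset.sum_congr rfl fun j _ => ?_
  simp [symmMatrix]; ring

/-- The derivative of the smallest eigenvalue is given by any minimizer. -/
lemma fderiv_minEig {x : UpperIndex n → ℝ} (hd : DifferentiableAt ℝ (minEig n) x)
    {s : HalfSphere n} (hs : IsMinimizer (quadForm n) x s) (h : UpperIndex n → ℝ) :
    fderiv ℝ (minEig n) x h = quadForm n h s := by
  have hline : HasDerivAt (fun t : ℝ => x + t • h) h 0 := by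
    simpa using ((hasDerivAt_id (0 : ℝ)).smul_const h).const_add x
  have h1 : HasDerivAt (fun t : ℝ => minEig n (x + t • h)) (fderiv ℝ (minEig n) x h) 0 := by
    have hx : HasFDerivAt (minEig n) (fderiv ℝ (minEig n) x) (x + (0 : ℝ) • h) := by
      rw [zero_smul, add_zero]; exact hd.hasFDerivAt
    exact hx.comp_hasDerivAt 0 hline
  have h2 : HasDerivAt (fun t : ℝ => quadForm n x s + t * quadForm n h s -
      minEig n (x + t • h)) (quadForm n h s - fderiv ℝ (minEig n) x h) 0 := by
    have h3 : HasDerivAt (fun t : ℝ => quadForm n x s + t * quadForm n h s)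
        (quadForm n h s) 0 := by
      simpa using ((hasDerivAt_id (0 : ℝ)).mul_const (quadForm n h s)).const_add (quadForm n x s)
    exact h3.sub h1
  -- Along the line the fixed trial vector `s` gives an affine function lying above the smallest
  -- eigenvalue and touching it at `0`, so the derivatives agree there.
  have h3 : IsLocalMin (fun t : ℝ => quadForm n x s + t * quadForm n h s -
      minEig n (x + t • h)) 0 := by
    refine Filter.Eventually.of_forall fun t => ?_
    have h4 := minEig_le (x + t • h) s
    rw [quadForm_add_smul] at h4
    have h5 := IsMinimizer.quadForm_eq hs
    simp only [zero_smul, add_zero, zero_mul]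
    linarith
  have := h3.hasDerivAt_eq_zero h2
  linarith

lemma quadForm_single (s : HalfSphere n) (j : Fin (n + 1)) :
    quadForm n (Pi.single ⟨(0, j), Fin.zero_le j⟩ 1) s =
      (if j = 0 then 1 else 2) * (s.1 0 * s.1 j) := by
  have h1 : ∀ a b : Fin (n + 1), symmMatrix n (Pi.single ⟨(0, j), Fin.zero_le j⟩ 1) a b =
      (if a = 0 ∧ b = j then 1 else 0) + (if a = j ∧ b = 0 then 1 else 0) -
        (if a = 0 ∧ b = 0 ∧ j = 0 then 1 else 0) := by
    intro a b
    simp only [symmMatrix, Matrix.of_apply, Pi.single_apply, Subtype.mk.injEq, Prod.mk.injEq]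
    rcases le_total a b with hab | hab
    · rw [min_eq_left hab, max_eq_right hab]
      by_cases ha : a = 0
      · subst ha
        by_cases hb : b = 0 <;> by_cases hj : j = 0 <;> by_cases hbj : b = j <;> simp_all
      · have hb : b ≠ 0 := fun hb => ha (Fin.le_zero_iff.1 (hb ▸ hab))
        simp [ha, hb]
    · rw [min_eq_right hab, max_eq_left hab]
      by_cases hb : b = 0
      · subst hb
        by_cases ha : a = 0 <;> by_cases hj : j = 0 <;> by_cases haj : a = j <;> simp_all
      · have ha : a ≠ 0 := fun ha => hb (Fin.le_zero_iff.1 (ha ▸ hab))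
        simp [ha, hb]
  simp only [quadForm, h1]
  have h2 : ∀ a b : Fin (n + 1), ((if a = 0 ∧ b = j then (1 : ℝ) else 0) +
      (if a = j ∧ b = 0 then 1 else 0) - (if a = 0 ∧ b = 0 ∧ j = 0 then 1 else 0)) *
        s.1 a * s.1 b =
      (if a = 0 then (if b = j then s.1 a * s.1 b else 0) else 0) +
      (if a = j then (if b = 0 then s.1 a * s.1 b else 0) else 0) -
      (if a = 0 then (if b = 0 then (if j = 0 then s.1 a * s.1 b else 0) else 0) else 0) := by
    intro a b
    by_cases ha : a = 0 <;> by_cases hb : b = 0 <;> by_cases hj : j = 0 <;>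
      by_cases hbj : b = j <;> by_cases haj : a = j <;> simp_all
  simp only [h2, Finset.sum_add_distrib, Finset.sum_sub_distrib]
  by_cases hj : j = 0
  · simp [hj]
  · simp [hj]; ring

/-- The candidate minimizer, read off the derivative of the smallest eigenvalue. -/
noncomputable def gradVector (x : UpperIndex n → ℝ) : EuclideanSpace ℝ (Fin (n + 1)) :=
  WithLp.toLp 2 fun j =>
    if j = 0 then √(fderiv ℝ (minEig n) x (Pi.single ⟨(0, 0), le_rfl⟩ 1)) else
      fderiv ℝ (minEig n) x (Pi.single ⟨(0, j), Fin.zero_le j⟩ 1) /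
        (2 * √(fderiv ℝ (minEig n) x (Pi.single ⟨(0, 0), le_rfl⟩ 1)))

lemma measurable_gradVector : Measurable (gradVector (n := n)) := by
  refine (WithLp.measurable_toLp 2 _).comp (measurable_pi_lambda _ fun j => ?_)
  split_ifs
  · exact (measurable_fderiv_apply_const ℝ _ _).sqrt
  · exact (measurable_fderiv_apply_const ℝ _ _).div
      ((measurable_fderiv_apply_const ℝ _ _).sqrt.const_mul 2)

/-- The sign convention makes `s.1 0` the nonnegative root of its square, and dividing by it
recovers the other coordinates from the products `s.1 0 * s.1 j`. -/
lemma eq_gradVector {x : UpperIndex n → ℝ} (hd : DifferentiableAt ℝ (minEig n) x)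
    {s : HalfSphere n} (hs : IsMinimizer (quadForm n) x s) (h0 : s.1 0 ≠ 0) :
    s.1 = gradVector x := by
  have h1 : √(fderiv ℝ (minEig n) x (Pi.single ⟨(0, 0), le_rfl⟩ 1)) = s.1 0 := by
    rw [fderiv_minEig hd hs, quadForm_single]
    simp only [if_true, one_mul]
    exact Real.sqrt_mul_self s.2.2
  ext j
  simp only [gradVector, h1]
  split_ifs with hj
  · rw [hj]
  · rw [fderiv_minEig hd hs, quadForm_single, if_neg hj]
    field_simp

lemma removeNth_form_of_zero {x : UpperIndex (n + 1) → ℝ} {s : HalfSphere (n + 1)}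
    (hs : IsMinimizer (quadForm (n + 1)) x s) (h0 : s.1 0 = 0) :
    minEig (n + 1) x = minEig n (minorOf 0 x) := by
  refine le_antisymm (minEig_le_minorOf 0 x) ?_
  set w := (0 : Fin (n + 2)).removeNth s.1.ofLp with hw
  have hins : s.1.ofLp = (0 : Fin (n + 2)).insertNth 0 w := by
    have := (Fin.insertNth_self_removeNth (0 : Fin (n + 2)) s.1.ofLp).symm
    rwa [h0] at this
  have h1 : w ⬝ᵥ w = 1 := by
    have := s.dotProduct_self
    rw [hins, insertNth_dotProduct] at this
    linarith
  have h2 := IsMinimizer.quadForm_eq hs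
  rw [Wigner.quadForm_eq, hins, form_insertNth (symmMatrix_isHermitian x),
    ← symmMatrix_minorOf] at h2
  have h3 := minEig_le_form (x := minorOf 0 x) h1
  linarith

/-- Padding a minimizer of the minor with a zero then minimizes the large form, hence gives an
eigenvector; coordinate `0` of the eigenvector equation is the orthogonality. -/
lemma offRow_dotProduct_of_gap_eq {x : UpperIndex (n + 1) → ℝ}
    (h : minEig (n + 1) x = minEig n (minorOf 0 x)) {w : HalfSphere n}
    (hw : IsMinimizer (quadForm n) (minorOf 0 x) w) :
    (0 : Fin (n + 2)).removeNth (rowOf 0 x) ⬝ᵥ w.1.ofLp = 0 := by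
  have h1 : symmMatrix (n + 1) x *ᵥ ((0 : Fin (n + 2)).insertNth 0 w.1.ofLp : Fin (n + 2) → ℝ) =
      minEig (n + 1) x • ((0 : Fin (n + 2)).insertNth 0 w.1.ofLp : Fin (n + 2) → ℝ) := by
    refine mulVec_eq_of_form_eq (symmMatrix_isHermitian x) (minEig_mul_le x) ?_
    rw [form_insertNth (symmMatrix_isHermitian x), insertNth_dotProduct, w.dotProduct_self,
      ← symmMatrix_minorOf, ← Wigner.quadForm_eq, IsMinimizer.quadForm_eq hw, h]
    ring
  have h2 := congrFun h1 0
  rw [mulVec_self 0, removeNth_insertNth', offRow_symmMatrix] at h2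
  simpa using h2

variable {P : Measure ℝ} [IsProbabilityMeasure P]

lemma gain_ne_zero_ae (hP : P ≪ volume) (n : ℕ) :
    ∀ᵐ x ∂(entryLaw P (n + 1)), minEig (n + 1) x ≠ minEig n (minorOf 0 x) := by
  have hms : MeasurableSet {p : (UpperIndex n → ℝ) × (Fin (n + 2) → ℝ) | gain p = 0} :=
    measurable_gain (measurableSet_singleton 0)
  have h0 : ((entryLaw P n).prod (Measure.pi fun _ : Fin (n + 2) => P))
      {p | gain p = 0} = 0 := by
    rw [Measure.measure_prod_null hms]
    refine Filter.Eventually.of_forall fun y => ?_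
    obtain ⟨w, hw⟩ := exists_isMinimizer y
    have hne : w.1.ofLp ≠ 0 := fun h => by
      have := w.dotProduct_self
      simp [h] at this
    -- With the minor fixed, a zero gain confines the independent new row to a fixed hyperplane.
    refine measure_mono_null ?_ (hyperplane_null hP hne 0)
    intro u hu
    have hu' : gain (y, u) = 0 := hu
    unfold gain at hu'
    have h1 := offRow_dotProduct_of_gap_eq (x := bordered y u) (w := w)
      (by rw [minorOf_bordered]; simp only at hu'; linarith) (by rwa [minorOf_bordered])
    rwa [rowOf_bordered] at h1
  have h1 := (measurePreserving_border P (0 : Fin (n + 2))).measure_preimage hms.nullMeasurableSet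
  rw [h0] at h1
  rw [ae_iff]
  refine measure_mono_null (fun x hx => ?_) h1
  simp only [ne_eq, not_not, Set.mem_ofPred_eq] at hx
  change gain (minorOf 0 x, rowOf 0 x) = 0
  rw [gain_split, hx, sub_self]

lemma minimizer_ne_zero_ae (hP : P ≪ volume) (n : ℕ) :
    ∀ᵐ x ∂(entryLaw P n), ∀ s, IsMinimizer (quadForm n) x s → s.1 0 ≠ 0 := by
  cases n with
  | zero =>
    refine Filter.Eventually.of_forall fun x s _ h0 => ?_
    have := s.sum_sq
    simp [h0] at this
  | succ n =>
    filter_upwards [gain_ne_zero_ae hP n] with x hx s hs h0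
    exact hx (removeNth_form_of_zero hs h0)

lemma minimizer_eq_gradVector_ae (hP : P ≪ volume) (n : ℕ) :
    ∀ᵐ x ∂(entryLaw P n), ∀ s, IsMinimizer (quadForm n) x s → s.1 = gradVector x := by
  have h1 : ∀ᵐ x ∂(entryLaw P n), DifferentiableAt ℝ (minEig n) x :=
    (pi_absolutelyContinuous hP).ae_le (minEig_lipschitz n).ae_differentiableAt
  filter_upwards [h1, minimizer_ne_zero_ae hP n] with x hd hx s hs
  exact eq_gradVector hd hs (hx s hs)

lemma measurableSet_halfSphere (n : ℕ) :
    MeasurableSet {v : EuclideanSpace ℝ (Fin (n + 1)) | ‖v‖ = 1 ∧ 0 ≤ v 0} := by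
  refine MeasurableSet.inter ?_ ?_
  · exact (isClosed_eq continuous_norm continuous_const).measurableSet
  · exact (isClosed_le (f := fun _ => (0 : ℝ)) (g := fun v : EuclideanSpace ℝ (Fin (n + 1)) => v 0)
      continuous_const (by fun_prop)).measurableSet

theorem Centered.wellPosed (h : Centered P) (hP : P ≪ volume) (n : ℕ) :
    WellPosed P (quadForm n) where
  existsUnique_minimizer := by
    filter_upwards [minimizer_eq_gradVector_ae hP n] with x hx
    obtain ⟨s, hs⟩ := exists_isMinimizer x
    exact ⟨s, hs, fun t ht => Subtype.ext ((hx t ht).trans (hx s hs).symm)⟩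
  aemeasurable_optimizer := by
    refine (MeasurableEmbedding.subtype_coe (measurableSet_halfSphere n)).aemeasurable_comp_iff.1 ?_
    refine ⟨gradVector, measurable_gradVector, ?_⟩
    filter_upwards [minimizer_eq_gradVector_ae hP n] with x hx
    exact hx _ (optimizer_isMinimizer x)
  integrable_optValue := h.integrable_minEig n

end Uniqueness
end Wigner

namespace Wigner
open Matrix RandomOpt

/-! ### Exchanging blocks between two independent copies. -/

section Exchange
variable {ι α : Type*}

lemma perturb_perturb (J : Set ι) (x x' : ι → α) :
    perturb J (perturb J x x') (perturb J x' x) = x := by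
  funext i
  unfold perturb
  split_ifs <;> rfl

variable [Fintype ι] [MeasurableSpace α] (P : Measure α) [IsProbabilityMeasure P]

/-- Exchanging a block of coordinates of two independent copies preserves their joint law. -/
lemma measurePreserving_exchange (J : Set ι) :
    MeasurePreserving (fun p : (ι → α) × (ι → α) => (perturb J p.1 p.2, perturb J p.2 p.1))
      ((Measure.pi fun _ : ι => P).prod (Measure.pi fun _ : ι => P))
      ((Measure.pi fun _ : ι => P).prod (Measure.pi fun _ : ι => P)) := by
  classical
  let e : ι ⊕ ι → ι ⊕ ι := Sum.elim
    (fun i => if i ∈ J then Sum.inr i else Sum.inl i) fun i => if i ∈ J then Sum.inl i else Sum.inr i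
  have he : Function.Injective e := by
    rintro (i | i) (j | j) h <;> simp only [e, Sum.elim_inl, Sum.elim_inr] at h <;>
      split_ifs at h <;> simp_all
  have h1 := (measurePreserving_sumPiEquivProdPi_symm (fun _ : ι ⊕ ι => P))
  have h2 := (measurePreserving_precomp_prod P he).comp h1
  convert h2 using 1
  funext p
  refine Prod.ext (funext fun i => ?_) (funext fun i => ?_) <;>
  · simp only [Function.comp, e, Sum.elim_inl, Sum.elim_inr, perturb]
    split_ifs <;> rfl

lemma indicator_add_perturb (J : Set ι) (x x' : ι → ℝ) :
    perturb J x x' = x + (J.indicator x' - J.indicator x) := by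
  funext i
  simp only [perturb, Pi.add_apply, Pi.sub_apply]
  by_cases h : i ∈ J <;> simp [h]

end Exchange

/-! ### Mean excess of a perturbed minimizer. -/

section Gap
variable {n : ℕ}

lemma quadForm_add (x h : UpperIndex n → ℝ) (s : HalfSphere n) :
    quadForm n (x + h) s = quadForm n x s + quadForm n h s := by
  simpa using quadForm_add_smul x h 1 s

lemma quadForm_sub (x h : UpperIndex n → ℝ) (s : HalfSphere n) :
    quadForm n (x - h) s = quadForm n x s - quadForm n h s := by
  have := quadForm_add (x - h) h s
  rw [sub_add_cancel] at this
  linarith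

lemma quadForm_sum {κ : Type*} (t : Finset κ) (h : κ → UpperIndex n → ℝ) (s : HalfSphere n) :
    quadForm n (∑ l ∈ t, h l) s = ∑ l ∈ t, quadForm n (h l) s := by
  classical
  induction t using Finset.induction_on with
  | empty => simp [quadForm, symmMatrix]
  | insert a t ha ih => rw [Finset.sum_insert ha, Finset.sum_insert ha, quadForm_add, ih]

lemma abs_quadForm_le (x : UpperIndex n → ℝ) (s : HalfSphere n) :
    |quadForm n x s| ≤ (n + 1) ^ 2 * ∑ p, |x p| := by
  have h1 := abs_quadForm_sub_le x 0 s
  have h2 : quadForm n 0 s = 0 := by simp [quadForm, symmMatrix]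
  rw [h2, sub_zero, sub_zero] at h1
  refine h1.trans ?_
  gcongr
  refine (pi_norm_le_iff_of_nonneg (by positivity)).2 fun p => ?_
  exact Finset.single_le_sum (f := fun p => |x p|) (fun _ _ => abs_nonneg _) (Finset.mem_univ p)

lemma continuous_quadForm : Continuous fun p : (UpperIndex n → ℝ) × HalfSphere n =>
    quadForm n p.1 p.2 := by
  unfold quadForm
  simp only [symmMatrix, Matrix.of_apply]
  fun_prop

/-- The excess of the value at `x` of the optimal solution for the perturbed input. -/
noncomputable def excess (J : Set (UpperIndex n)) (x x' : UpperIndex n → ℝ) : ℝ :=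
  quadForm n x (optimizer (quadForm n) (perturb J x x')) - minEig n x

lemma excess_nonneg (J : Set (UpperIndex n)) (x x' : UpperIndex n → ℝ) : 0 ≤ excess J x x' :=
  sub_nonneg.2 (minEig_le _ _)

/-- The change of the value of the optimal solution under a perturbation of the input. -/
noncomputable def valueChange (J : Set (UpperIndex n)) (x x' : UpperIndex n → ℝ) : ℝ :=
  quadForm n (J.indicator x') (optimizer (quadForm n) x) -
    quadForm n (J.indicator x) (optimizer (quadForm n) x)

lemma valueChange_eq (J : Set (UpperIndex n)) (x x' : UpperIndex n → ℝ) :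
    valueChange J x x' = quadForm n (perturb J x x') (optimizer (quadForm n) x) -
      quadForm n x (optimizer (quadForm n) x) := by
  rw [indicator_add_perturb, quadForm_add, quadForm_sub, valueChange]; ring

/-- Go from `x` to the perturbed input and back. The second change is taken at the perturbed
minimizer, and it is again a `valueChange`, for the exchanged pair; optimality at the perturbed
input has the favourable sign. -/
lemma excess_le (J : Set (UpperIndex n)) (x x' : UpperIndex n → ℝ) :
    excess J x x' ≤ valueChange J x x' + valueChange J (perturb J x x') (perturb J x' x) := by
  rw [valueChange_eq, valueChange_eq, perturb_perturb, excess]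
  have h1 := optimizer_isMinimizer (perturb J x x') (optimizer (quadForm n) x)
  have h2 := IsMinimizer.quadForm_eq (optimizer_isMinimizer x)
  linarith

variable {P : Measure ℝ} [IsProbabilityMeasure P]

lemma Centered.integrable_sum_abs {ι : Type*} [Fintype ι] (h : Centered P) :
    Integrable (fun x : ι → ℝ => ∑ p, |x p|) (Measure.pi fun _ : ι => P) :=
  integrable_finsetSum _ fun p _ => (h.integrable_entry p).abs

lemma aestronglyMeasurable_quadForm {Ω : Type*} [MeasurableSpace Ω] {μ : Measure Ω}
    {f : Ω → UpperIndex n → ℝ} {g : Ω → HalfSphere n} (hf : AEMeasurable f μ)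
    (hg : AEMeasurable g μ) : AEStronglyMeasurable (fun ω => quadForm n (f ω) (g ω)) μ :=
  (continuous_quadForm.measurable.comp_aemeasurable (hf.prodMk hg)).aestronglyMeasurable

lemma sum_abs_indicator_le {ι : Type*} [Fintype ι] (J : Set ι) (x : ι → ℝ) :
    ∑ p, |J.indicator x p| ≤ ∑ p, |x p| := by
  refine Finset.sum_le_sum fun p _ => ?_
  by_cases hp : p ∈ J <;> simp [hp]

lemma measurable_indicator_apply {ι : Type*} (J : Set ι) :
    Measurable fun x : ι → ℝ => J.indicator x := by
  classical
  refine measurable_pi_lambda _ fun i => ?_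
  simp only [Set.indicator_apply]
  split_ifs <;> fun_prop

lemma Centered.integrable_blockValue (h : Centered P) (hw : WellPosed P (quadForm n))
    (J : Set (UpperIndex n)) :
    Integrable (fun x => quadForm n (J.indicator x) (optimizer (quadForm n) x))
      (entryLaw P n) := by
  refine (h.integrable_sum_abs.const_mul (((n : ℝ) + 1) ^ 2)).mono'
    (aestronglyMeasurable_quadForm (measurable_indicator_apply J).aemeasurable
      hw.aemeasurable_optimizer) (ae_of_all _ fun x => ?_)
  refine (abs_quadForm_le _ _).trans ?_
  exact mul_le_mul_of_nonneg_left (sum_abs_indicator_le J x) (by positivity)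

lemma Centered.integrable_freshValue (h : Centered P) (hw : WellPosed P (quadForm n))
    (J : Set (UpperIndex n)) :
    Integrable (fun p : (UpperIndex n → ℝ) × (UpperIndex n → ℝ) =>
      quadForm n (J.indicator p.2) (optimizer (quadForm n) p.1))
      ((entryLaw P n).prod (entryLaw P n)) := by
  have h1 : Integrable (fun p : (UpperIndex n → ℝ) × (UpperIndex n → ℝ) => ∑ q, |p.2 q|)
      ((entryLaw P n).prod (entryLaw P n)) :=
    (h.integrable_sum_abs (ι := UpperIndex n)).comp_snd (entryLaw P n)
  refine (h1.const_mul (((n : ℝ) + 1) ^ 2)).mono'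
    (aestronglyMeasurable_quadForm
      ((measurable_indicator_apply J).comp measurable_snd).aemeasurable
      (hw.aemeasurable_optimizer.comp_fst)) (ae_of_all _ fun p => ?_)
  refine (abs_quadForm_le _ _).trans ?_
  exact mul_le_mul_of_nonneg_left (sum_abs_indicator_le J p.2) (by positivity)

/-- The fresh block is centred and independent of the minimizer for the original input, so only the
contribution of the old block survives. -/
lemma Centered.integral_valueChange (h : Centered P) (hw : WellPosed P (quadForm n))
    (J : Set (UpperIndex n)) :
    Integrable (fun p => valueChange J p.1 p.2) ((entryLaw P n).prod (entryLaw P n)) ∧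
    ∫ p, valueChange J p.1 p.2 ∂((entryLaw P n).prod (entryLaw P n)) =
      -∫ x, quadForm n (J.indicator x) (optimizer (quadForm n) x) ∂(entryLaw P n) := by
  have h1 := h.integrable_freshValue hw J
  have h2 : Integrable (fun p : (UpperIndex n → ℝ) × (UpperIndex n → ℝ) =>
      quadForm n (J.indicator p.1) (optimizer (quadForm n) p.1))
      ((entryLaw P n).prod (entryLaw P n)) :=
    (h.integrable_blockValue hw J).comp_fst (entryLaw P n)
  refine ⟨h1.sub h2, ?_⟩
  unfold valueChange
  rw [integral_sub h1 h2, integral_prod _ h1, integral_prod _ h2]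
  have h3 : ∀ s : HalfSphere n, ∫ x', quadForm n (J.indicator x') s ∂(entryLaw P n) = 0 := by
    classical
    intro s
    have h4 : ∀ i j : Fin (n + 1), Integrable (fun x' : UpperIndex n → ℝ =>
        symmMatrix n (J.indicator x') i j) (entryLaw P n) ∧
        ∫ x', symmMatrix n (J.indicator x') i j ∂(entryLaw P n) = 0 := by
      intro i j
      simp only [symmMatrix, Matrix.of_apply, Set.indicator_apply]
      split_ifs
      · exact ⟨h.integrable_entry _, h.integral_eval _⟩
      · simp
    have h5 : ∀ i j : Fin (n + 1), Integrable (fun x' : UpperIndex n → ℝ =>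
        symmMatrix n (J.indicator x') i j * s.1 i * s.1 j) (entryLaw P n) := fun i j =>
      ((h4 i j).1.mul_const _).mul_const _
    unfold quadForm
    rw [integral_finsetSum _ fun i _ => integrable_finsetSum _ fun j _ => h5 i j]
    refine Finset.sum_eq_zero fun i _ => ?_
    rw [integral_finsetSum _ fun j _ => h5 i j]
    refine Finset.sum_eq_zero fun j _ => ?_
    rw [integral_mul_const, integral_mul_const, (h4 i j).2]
    simp
  simp only [h3, integral_zero, zero_sub, integral_const, probReal_univ, smul_eq_mul, one_mul]

/-- The mean excess is at most twice the mean contribution of the block to minus the optimal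
value. -/
lemma Centered.integral_excess_le (h : Centered P) (hw : WellPosed P (quadForm n))
    (J : Set (UpperIndex n)) :
    Integrable (fun p => excess J p.1 p.2) ((entryLaw P n).prod (entryLaw P n)) ∧
    ∫ p, excess J p.1 p.2 ∂((entryLaw P n).prod (entryLaw P n)) ≤
      -2 * ∫ x, quadForm n (J.indicator x) (optimizer (quadForm n) x) ∂(entryLaw P n) := by
  obtain ⟨h1, h2⟩ := h.integral_valueChange hw J
  have hex := measurePreserving_exchange P J
  have h3 : Integrable (fun p : (UpperIndex n → ℝ) × (UpperIndex n → ℝ) =>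
      valueChange J (perturb J p.1 p.2) (perturb J p.2 p.1))
      ((entryLaw P n).prod (entryLaw P n)) := hex.integrable_comp_of_integrable h1
  have h4 : ∫ p : (UpperIndex n → ℝ) × (UpperIndex n → ℝ),
      valueChange J (perturb J p.1 p.2) (perturb J p.2 p.1)
      ∂((entryLaw P n).prod (entryLaw P n)) = ∫ p, valueChange J p.1 p.2
      ∂((entryLaw P n).prod (entryLaw P n)) :=
    MeasurePreserving.integral_comp_of_integrable hex h1
  have hqm : Measure.QuasiMeasurePreserving
      (fun p : (UpperIndex n → ℝ) × (UpperIndex n → ℝ) => perturb J p.1 p.2)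
      ((entryLaw P n).prod (entryLaw P n)) (entryLaw P n) :=
    Measure.quasiMeasurePreserving_fst.comp hex.quasiMeasurePreserving
  have hm : AEStronglyMeasurable (fun p => excess J p.1 p.2)
      ((entryLaw P n).prod (entryLaw P n)) :=
    (aestronglyMeasurable_quadForm measurable_fst.aemeasurable
      (hw.aemeasurable_optimizer.comp_quasiMeasurePreserving hqm)).sub
      ((continuous_minEig n).comp continuous_fst).aestronglyMeasurable
  have hi : Integrable (fun p => excess J p.1 p.2) ((entryLaw P n).prod (entryLaw P n)) := by
    refine (h1.add h3).mono' hm (ae_of_all _ fun p => ?_)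
    rw [Real.norm_of_nonneg (excess_nonneg _ _ _)]
    exact excess_le J p.1 p.2
  refine ⟨hi, ?_⟩
  have h5 := integral_mono hi (h1.add h3) fun p => excess_le J p.1 p.2
  have h6 := integral_add h1 h3
  simp only [Pi.add_apply] at h5
  rw [h6, h4, h2] at h5
  linarith

end Gap
end Wigner

namespace Wigner
open Matrix RandomOpt

/-! ### Packing numbers of sets of near minimizers. -/

section Packing
variable {n : ℕ}

lemma exists_diagonalization {m : ℕ} {A : Matrix (Fin m) (Fin m) ℝ} (hA : A.IsHermitian) :
    ∃ (e : Fin m → ℝ) (U : Matrix (Fin m) (Fin m) ℝ), U * Uᵀ = 1 ∧ Uᵀ * U = 1 ∧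
      A * Uᵀ = Uᵀ * Matrix.diagonal e := by
  set b := hA.eigenvectorBasis with hb
  set U : Matrix (Fin m) (Fin m) ℝ := Matrix.of fun j i => b j i with hU
  have h1 : U * Uᵀ = 1 := by
    ext i j
    have := orthonormal_iff_ite.1 b.orthonormal i j
    rw [PiLp.inner_apply] at this
    simp only [RCLike.inner_apply, conj_trivial] at this
    rw [Matrix.mul_apply, Matrix.one_apply, ← this]
    exact Finset.sum_congr rfl fun x _ => by simp [hU, mul_comm]
  refine ⟨hA.eigenvalues, U, h1, mul_eq_one_comm.1 h1, ?_⟩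
  ext i j
  have := congrFun (hA.mulVec_eigenvectorBasis j) i
  simp only [Matrix.mulVec, dotProduct, Pi.smul_apply, smul_eq_mul] at this
  rw [Matrix.mul_apply, Matrix.mul_diagonal]
  simp only [hU, Matrix.transpose_apply, Matrix.of_apply, hb]
  rw [this, mul_comm]

lemma form_of_intertwine {m k : ℕ} {A : Matrix (Fin m) (Fin m) ℝ} {W : Matrix (Fin k) (Fin m) ℝ}
    {e : Fin k → ℝ} (h1 : W * Wᵀ = 1) (h2 : A * Wᵀ = Wᵀ * Matrix.diagonal e) (c : Fin k → ℝ) :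
    (Wᵀ *ᵥ c) ⬝ᵥ A *ᵥ (Wᵀ *ᵥ c) = ∑ a, e a * c a ^ 2 := by
  rw [Matrix.mulVec_mulVec, h2, ← Matrix.mulVec_mulVec, Matrix.dotProduct_mulVec,
    Matrix.vecMul_transpose, Matrix.mulVec_mulVec, h1, Matrix.one_mulVec]
  simp only [dotProduct, Matrix.mulVec_diagonal]
  exact Finset.sum_congr rfl fun a _ => by ring

/-- An `r`-packing is no larger than a cover at radius `r / 2`, and compactness provides a finite
one. -/
lemma packingNumber_closedBall_ne_top (m : ℕ) {r : ℝ} (hr : 0 < r) :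
    Metric.packingNumber r.toNNReal (Metric.closedBall (0 : EuclideanSpace ℝ (Fin m)) 1) ≠ ⊤ := by
  have hr2 : (r / 2).toNNReal ≠ 0 := by
    rw [ne_eq, Real.toNNReal_eq_zero, not_le]; positivity
  obtain ⟨C, hCs, hCf, hC⟩ := Metric.exists_finite_isCover_of_isCompact hr2
    (isCompact_closedBall (0 : EuclideanSpace ℝ (Fin m)) 1)
  have h1 := Metric.packingNumber_two_mul_le_externalCoveringNumber (r / 2).toNNReal
    (Metric.closedBall (0 : EuclideanSpace ℝ (Fin m)) 1)
  have h2 : 2 * (r / 2).toNNReal = r.toNNReal := by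
    rw [← Real.toNNReal_ofNat, ← Real.toNNReal_mul (by norm_num)]
    congr 1
    ring
  rw [h2] at h1
  have h3 := h1.trans hC.externalCoveringNumber_le_encard
  exact (h3.trans_lt hCf.encard_lt_top).ne

/-- If few eigenvalues are close to the smallest one then sets of near minimizers have small
packing numbers. -/
lemma exists_packing_bound {ε : ℝ} (hε : 0 < ε) (k : ℕ) : ∃ N : ℕ, ∀ (n : ℕ)
    (y : UpperIndex n → ℝ) (η' : ℝ), 0 < η' → ¬ NearDegenerate k η' y →
      ∀ T : Set (HalfSphere n), (∀ s ∈ T, quadForm n y s ≤ minEig n y + η' * (ε ^ 2 / 64)) →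
        Metric.packingNumber ε.toNNReal T ≤ N := by
  set Np : ℕ → ℕ∞ := fun m => Metric.packingNumber (ε / 2).toNNReal
    (Metric.closedBall (0 : EuclideanSpace ℝ (Fin m)) 1) with hNp
  have hfin : ∀ m, Np m ≠ ⊤ := fun m => packingNumber_closedBall_ne_top m (by positivity)
  refine ⟨∑ m ∈ Finset.range k, (Np m).toNat, fun n y η' hη' hnd T hT => ?_⟩
  obtain ⟨e, U, hU1, hU2, hAU⟩ := exists_diagonalization (symmMatrix_isHermitian y)
  set lam := minEig n y with hlam
  set low := Finset.univ.filter fun j => e j ≤ lam + η' with hlow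
  set m := low.card with hm
  have hmk : m < k := by
    by_contra hcon
    rw [not_lt] at hcon
    refine hnd ?_
    set f : Fin k → Fin (n + 1) := fun a => (low.equivFin.symm (Fin.castLE hcon a)).1 with hf
    have hfinj : Function.Injective f := fun a b hab => by
      have := low.equivFin.symm.injective (Subtype.ext hab)
      exact Fin.castLE_injective hcon this
    have hflow : ∀ a, e (f a) ≤ lam + η' := fun a => by
      have := (low.equivFin.symm (Fin.castLE hcon a)).2
      exact (Finset.mem_filter.1 this).2
    have hW1 : U.submatrix f id * (U.submatrix f id)ᵀ = 1 := by
      ext a b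
      have := congrFun (congrFun hU1 (f a)) (f b)
      simp only [Matrix.mul_apply, Matrix.transpose_apply, Matrix.submatrix_apply, id,
        Matrix.one_apply, hfinj.eq_iff] at this ⊢
      exact this
    have hW2 : symmMatrix n y * (U.submatrix f id)ᵀ =
        (U.submatrix f id)ᵀ * Matrix.diagonal fun a => e (f a) := by
      ext i a
      have := congrFun (congrFun hAU i) (f a)
      rw [Matrix.mul_diagonal] at this ⊢
      exact this
    refine ⟨U.submatrix f id, hW1, fun c => ?_⟩
    rw [form_of_intertwine hW1 hW2, dotProduct, Finset.mul_sum]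
    refine Finset.sum_le_sum fun a _ => ?_
    rw [← sq]
    exact mul_le_mul_of_nonneg_right (hflow a) (sq_nonneg _)
  have hUU : ∀ v : Fin (n + 1) → ℝ, Uᵀ *ᵥ (U *ᵥ v) = v := fun v => by
    rw [Matrix.mulVec_mulVec, hU2, Matrix.one_mulVec]
  have hnorm : ∀ v : Fin (n + 1) → ℝ, v ⬝ᵥ v = ∑ j, (U *ᵥ v) j ^ 2 := fun v => by
    conv_lhs => rw [← hUU v, Matrix.dotProduct_mulVec, Matrix.vecMul_transpose, hUU]
    simp [dotProduct, sq]
  have hform : ∀ v : Fin (n + 1) → ℝ, v ⬝ᵥ symmMatrix n y *ᵥ v = ∑ j, e j * (U *ᵥ v) j ^ 2 :=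
    fun v => by
      have := form_of_intertwine hU1 hAU (U *ᵥ v)
      rwa [hUU] at this
  have helam : ∀ j, lam ≤ e j := fun j => by
    have h1 := minEig_mul_le y (Uᵀ *ᵥ Pi.single j 1)
    have h2 : U *ᵥ (Uᵀ *ᵥ Pi.single j 1) = Pi.single j 1 := by
      rw [Matrix.mulVec_mulVec, hU1, Matrix.one_mulVec]
    rw [hform, hnorm, h2] at h1
    simpa [Pi.single_apply] using h1
  -- Each unit of mass on eigenvalues beyond `lam + η'` costs at least `η'`, so a near minimizer
  -- carries at most `ε ^ 2 / 64` there.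
  have hhigh : ∀ s ∈ T, ∑ j ∈ lowᶜ, (U *ᵥ s.1.ofLp) j ^ 2 ≤ ε ^ 2 / 64 := fun s hs => by
    have h1 := hT s hs
    rw [Wigner.quadForm_eq, hform] at h1
    have h2 : lam = ∑ j, lam * (U *ᵥ s.1.ofLp) j ^ 2 := by
      rw [← Finset.mul_sum, ← hnorm, s.dotProduct_self, mul_one]
    have h3 : ∑ j, (e j - lam) * (U *ᵥ s.1.ofLp) j ^ 2 ≤ η' * (ε ^ 2 / 64) := by
      simp only [sub_mul, Finset.sum_sub_distrib]
      linarith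
    have h4 : ∑ j ∈ lowᶜ, η' * (U *ᵥ s.1.ofLp) j ^ 2 ≤
        ∑ j, (e j - lam) * (U *ᵥ s.1.ofLp) j ^ 2 := by
      calc _ ≤ ∑ j ∈ lowᶜ, (e j - lam) * (U *ᵥ s.1.ofLp) j ^ 2 := by
            refine Finset.sum_le_sum fun j hj => ?_
            rw [hlow, Finset.mem_compl, Finset.mem_filter, not_and, not_le] at hj
            have := hj (Finset.mem_univ j)
            exact mul_le_mul_of_nonneg_right (by linarith) (sq_nonneg _)
        _ ≤ _ := Finset.sum_le_sum_of_subset_of_nonneg (Finset.subset_univ _) fun j _ _ =>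
            mul_nonneg (sub_nonneg.2 (helam j)) (sq_nonneg _)
    rw [← Finset.mul_sum] at h4
    exact le_of_mul_le_mul_left (h4.trans h3) hη'
  set p : HalfSphere n → EuclideanSpace ℝ (Fin m) := fun s =>
    WithLp.toLp 2 fun i => (U *ᵥ s.1.ofLp) (low.equivFin.symm i).1 with hp
  have hsumlow : ∀ g : Fin (n + 1) → ℝ, ∑ i : Fin m, g (low.equivFin.symm i).1 =
      ∑ j ∈ low, g j := fun g => by
    rw [low.equivFin.symm.sum_comp fun j => g j.1, Finset.sum_coe_sort low g]
  have hpball : ∀ s, p s ∈ Metric.closedBall (0 : EuclideanSpace ℝ (Fin m)) 1 := fun s => by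
    rw [mem_closedBall_zero_iff]
    have h1 : ‖p s‖ ^ 2 ≤ 1 := by
      rw [EuclideanSpace.real_norm_sq_eq]
      simp only [hp]
      rw [hsumlow fun j => (U *ᵥ s.1.ofLp) j ^ 2]
      refine le_of_le_of_eq ?_ ((hnorm s.1.ofLp).symm.trans s.dotProduct_self)
      exact Finset.sum_le_sum_of_subset_of_nonneg (Finset.subset_univ _) fun _ _ _ => sq_nonneg _
    nlinarith [norm_nonneg (p s)]
  have hsep : ∀ s ∈ T, ∀ t ∈ T, ε < dist s t → ε / 2 < dist (p s) (p t) := by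
    intro s hs t ht hst
    have h1 : dist s t ^ 2 = ∑ j, (U *ᵥ s.1.ofLp - U *ᵥ t.1.ofLp) j ^ 2 := by
      rw [Subtype.dist_eq, dist_eq_norm, ← ofLp_dotProduct_self, WithLp.ofLp_sub, hnorm,
        Matrix.mulVec_sub]
    have h2 : dist (p s) (p t) ^ 2 = ∑ j ∈ low, (U *ᵥ s.1.ofLp - U *ᵥ t.1.ofLp) j ^ 2 := by
      rw [dist_eq_norm, EuclideanSpace.real_norm_sq_eq]
      simp only [hp, PiLp.sub_apply]
      exact hsumlow fun j => ((U *ᵥ s.1.ofLp) j - (U *ᵥ t.1.ofLp) j) ^ 2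
    -- The high coordinates contribute at most `ε ^ 2 / 16` to the squared distance, so
    -- `ε`-separated points remain `ε / 2`-separated after projection to the low coordinates.
    have h3 : ∑ j ∈ lowᶜ, (U *ᵥ s.1.ofLp - U *ᵥ t.1.ofLp) j ^ 2 ≤
        2 * ∑ j ∈ lowᶜ, (U *ᵥ s.1.ofLp) j ^ 2 + 2 * ∑ j ∈ lowᶜ, (U *ᵥ t.1.ofLp) j ^ 2 := by
      rw [Finset.mul_sum, Finset.mul_sum, ← Finset.sum_add_distrib]
      refine Finset.sum_le_sum fun j _ => ?_
      rw [Pi.sub_apply]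
      nlinarith [sq_nonneg ((U *ᵥ s.1.ofLp) j + (U *ᵥ t.1.ofLp) j)]
    have h4 := hhigh s hs
    have h5 := hhigh t ht
    rw [← Finset.sum_add_sum_compl low] at h1
    have h6 : ε ^ 2 < dist s t ^ 2 := by gcongr
    have h7 : (ε / 2) ^ 2 < dist (p s) (p t) ^ 2 := by
      rw [h2]; nlinarith
    exact lt_of_pow_lt_pow_left₀ 2 dist_nonneg h7
  have hle : Metric.packingNumber ε.toNNReal T ≤ Np m := by
    unfold Metric.packingNumber
    refine iSup₂_le fun C hC => iSup_le fun hCs => ?_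
    have hdist : ∀ s ∈ C, ∀ t ∈ C, s ≠ t → ε / 2 < dist (p s) (p t) := fun s hs t ht hst => by
      refine hsep s (hC hs) t (hC ht) ?_
      have : (ε.toNNReal : ENNReal) < edist s t := hCs hs ht hst
      rw [edist_nndist, ENNReal.coe_lt_coe, ← NNReal.coe_lt_coe, coe_nndist,
        Real.coe_toNNReal _ hε.le] at this
      exact this
    have hinj : Set.InjOn p C := fun s hs t ht hst => by
      by_contra hne
      have := hdist s hs t ht hne
      rw [hst, dist_self] at this
      linarith
    rw [← hinj.encard_image]
    refine Metric.IsSeparated.encard_le_packingNumber ?_ ?_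
    · rintro _ ⟨s, -, rfl⟩; exact hpball s
    · rintro _ ⟨s, hs, rfl⟩ _ ⟨t, ht, rfl⟩ hne
      have := hdist s hs t ht fun h => hne (by rw [h])
      change ((ε / 2).toNNReal : ENNReal) < edist (p s) (p t)
      rw [edist_nndist, ENNReal.coe_lt_coe, ← NNReal.coe_lt_coe, coe_nndist,
        Real.coe_toNNReal _ (by positivity)]
      exact this
  refine hle.trans ?_
  rw [← ENat.natCast_toNat (hfin m)]
  exact_mod_cast Finset.single_le_sum (f := fun m => (Np m).toNat) (fun _ _ => Nat.zero_le _)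
    (Finset.mem_range.2 hmk)

end Packing
end Wigner

namespace Wigner
open Matrix RandomOpt

/-! ### Stability under small perturbations. -/

section Stability
variable {n : ℕ} {P : Measure ℝ} [IsProbabilityMeasure P]

/-- If the excesses are small on average then most perturbed optimal solutions are near
minimizers. -/
lemma minPacking_le {L : Type*} [Fintype L] (J : L → Set (UpperIndex n)) {ε η : ℝ} (hη : 0 < η)
    {x : UpperIndex n → ℝ} {x' : L → UpperIndex n → ℝ}
    (hsum : ∑ l, excess (J l) x (x' l) < η * (ε * Fintype.card L)) {N : ℕ}
    (hN : ∀ T : Set (HalfSphere n), (∀ s ∈ T, quadForm n x s ≤ minEig n x + η) →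
      Metric.packingNumber ε.toNNReal T ≤ N) :
    minPacking (quadForm n) J ε x x' ≤ N := by
  classical
  set A := Finset.univ.filter fun l => excess (J l) x (x' l) < η with hA
  have h1 : (Aᶜ.card : ℝ) * η ≤ ∑ l, excess (J l) x (x' l) := by
    calc (Aᶜ.card : ℝ) * η = ∑ l ∈ Aᶜ, η := by rw [Finset.sum_const, nsmul_eq_mul]
      _ ≤ ∑ l ∈ Aᶜ, excess (J l) x (x' l) := Finset.sum_le_sum fun l hl => by
          rw [hA, Finset.mem_compl, Finset.mem_filter, not_and, not_lt] at hl
          exact hl (Finset.mem_univ l)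
      _ ≤ _ := Finset.sum_le_sum_of_subset_of_nonneg (Finset.subset_univ _)
          fun l _ _ => excess_nonneg _ _ _
  have h2 : (Aᶜ.card : ℝ) < ε * Fintype.card L := by
    by_contra hcon
    nlinarith [mul_le_mul_of_nonneg_left (not_lt.1 hcon) hη.le]
  have h3 : (A.card : ℝ) + Aᶜ.card = Fintype.card L := by
    exact_mod_cast Finset.card_add_card_compl A
  refine (iInf₂_le A (by linarith)).trans (hN _ ?_)
  rintro _ ⟨l, hl, rfl⟩
  have := (Finset.mem_filter.1 hl).2
  unfold excess at this
  linarith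

lemma integral_excess_scheme (h : Centered P) (hw : WellPosed P (quadForm n)) {L Ω : Type*}
    [MeasurableSpace Ω] {μ : Measure Ω} [IsProbabilityMeasure μ] {X : Ω → UpperIndex n → ℝ}
    {X' : L → Ω → UpperIndex n → ℝ} (hX : IsPerturbationScheme P μ X X') (l : L)
    (J : Set (UpperIndex n)) :
    Integrable (fun ω => excess J (X ω) (X' l ω)) μ ∧
    ∫ ω, excess J (X ω) (X' l ω) ∂μ ≤
      -2 * ∫ x, quadForm n (J.indicator x) (optimizer (quadForm n) x) ∂(entryLaw P n) := by
  obtain ⟨h1, h2⟩ := h.integral_excess_le hw J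
  have hX1 := hX.hasLaw
  have hX2 := hX.hasLaw_copy l
  have hm : AEMeasurable (fun ω => (X ω, X' l ω)) μ := hX1.aemeasurable.prodMk hX2.aemeasurable
  have hmap : μ.map (fun ω => (X ω, X' l ω)) = (entryLaw P n).prod (entryLaw P n) := by
    rw [(indepFun_iff_map_prod_eq_prod_map_map hX1.aemeasurable hX2.aemeasurable).1
      (hX.indep_copy l), hX1.map_eq, hX2.map_eq]
  rw [← hmap] at h1 h2
  exact ⟨h1.comp_aemeasurable hm, by rwa [integral_map hm h1.aestronglyMeasurable] at h2⟩

/-- A sufficient condition for stability under small perturbations: on average over the blocks,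
the contribution of a block to the smallest eigenvalue is at most of order `n ^ (-1/2)`. -/
theorem stable_of_blockValue (h : Centered P) (hw : ∀ n, WellPosed P (quadForm n))
    (hτ : 0 < secondMoment P) {L : ℕ → Type} [∀ n, Fintype (L n)] [∀ n, Nonempty (L n)]
    (J : ∀ n, L n → Set (UpperIndex n)) {C : ℝ} (hC : 0 < C)
    (hJ : ∀ n, -∑ l, ∫ x, quadForm n ((J n l).indicator x) (optimizer (quadForm n) x)
      ∂(entryLaw P n) ≤ C * (Fintype.card (L n) / √((n : ℝ) + 1))) :
    StableUnderSmallPerturbations.{u} P quadForm J := by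
  intro ε hε δ hδ
  -- Markov's inequality at level `4C/δ` makes the excess of most perturbed minimizers smaller than
  -- `η = 4C/(δ ε √(n+1))`; the packing bound needs `η = η' ε²/64`, whence `η' = 256C/(δ ε³
  -- √(n+1))`.
  obtain ⟨k, n₀, hk⟩ := h.nearDegenerate_tight hτ (H := 256 * C / (δ * ε ^ 3)) (by positivity)
    (half_pos hδ)
  obtain ⟨N, hN⟩ := exists_packing_bound hε k
  refine ⟨N + 1, fun Ω _ μ X X' hμ hX => ?_⟩
  refine limsup_le_of_le (by isBoundedDefault) (eventually_atTop.2 ⟨n₀, fun n hn => ?_⟩)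
  have := hμ n
  have hs : 0 < √((n : ℝ) + 1) := by positivity
  set r : ℝ := Fintype.card (L n) / √((n : ℝ) + 1) with hr
  have hr0 : 0 < r := by
    have : (0 : ℝ) < Fintype.card (L n) := by exact_mod_cast Fintype.card_pos
    positivity
  set F : Ω n → ℝ := fun ω => ∑ l, excess (J n l) (X n ω) (X' n l ω) with hF
  have hex := fun l => integral_excess_scheme h (hw n) (hX n) l (J n l)
  have hFi : Integrable F (μ n) := integrable_finsetSum _ fun l _ => (hex l).1
  have hFE : ∫ ω, F ω ∂(μ n) ≤ 2 * C * r := by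
    rw [hF, integral_finsetSum _ fun l _ => (hex l).1]
    refine (Finset.sum_le_sum fun l _ => (hex l).2).trans ?_
    rw [← Finset.mul_sum]
    linarith [hJ n]
  have hmarkov : μ n {ω | 4 * C / δ * r ≤ F ω} ≤ ENNReal.ofReal (δ / 2) := by
    have h1 := mul_meas_ge_le_integral_of_nonneg (ae_of_all (μ n) fun ω =>
      Finset.sum_nonneg fun l _ => excess_nonneg (J n l) (X n ω) (X' n l ω)) hFi (4 * C / δ * r)
    have h2 : (μ n).real {ω | 4 * C / δ * r ≤ F ω} ≤ δ / 2 := by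
      refine le_of_mul_le_mul_left (h1.trans (hFE.trans (le_of_eq ?_)))
        (by positivity : 0 < 4 * C / δ * r)
      field_simp
      norm_num
    rw [← ofReal_measureReal]
    exact ENNReal.ofReal_le_ofReal h2
  have hdeg : μ n (X n ⁻¹' {y | NearDegenerate k (256 * C / (δ * ε ^ 3) / √((n : ℝ) + 1)) y}) ≤
      ENNReal.ofReal (δ / 2) := by
    -- The near-degeneracy event is not known to be measurable, so only an inequality with the
    -- push-forward is used.
    refine (Measure.le_map_apply (hX n).hasLaw.aemeasurable _).trans ?_
    rw [(hX n).hasLaw.map_eq]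
    exact hk n hn
  have hsub : {ω | ((N + 1 : ℕ) : ℕ∞) ≤ minPacking (quadForm n) (J n) ε (X n ω)
        fun l => X' n l ω} ⊆ {ω | 4 * C / δ * r ≤ F ω} ∪
      X n ⁻¹' {y | NearDegenerate k (256 * C / (δ * ε ^ 3) / √((n : ℝ) + 1)) y} := by
    intro ω hω
    by_contra hcon
    simp only [Set.mem_union, Set.mem_ofPred_eq, Set.mem_preimage, not_or, not_le] at hcon hω
    obtain ⟨h1, h2⟩ := hcon
    have h3 : minPacking (quadForm n) (J n) ε (X n ω) (fun l => X' n l ω) ≤ N := by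
      refine minPacking_le (J n) (η := 4 * C / (δ * ε * √((n : ℝ) + 1))) (by positivity)
        (h1.trans_eq ?_) fun T hT => hN n (X n ω) _ (by positivity) h2 T fun s hs => ?_
      · rw [hr]; field_simp
      · refine (hT s hs).trans_eq ?_
        congr 1
        field_simp
        norm_num
    have h4 := hω.trans h3
    rw [Nat.cast_le] at h4
    omega
  refine (measure_mono hsub).trans ((measure_union_le _ _).trans ((add_le_add hmarkov hdeg).trans ?_))
  rw [← ENNReal.ofReal_add (by positivity) (by positivity), add_halves]

lemma sum_indicator_entryBlock (x : UpperIndex n → ℝ) :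
    ∑ p, (entryBlock n p).indicator x = x := by
  classical
  funext q
  rw [Finset.sum_apply]
  simp [entryBlock, Set.indicator_apply]

/-- Each off-diagonal entry belongs to two row blocks and each diagonal entry to one. -/
lemma sum_indicator_rowBlock (x : UpperIndex n → ℝ) :
    ∑ i, (rowBlock n i).indicator x = x + (x - {p : UpperIndex n | p.1.1 = p.1.2}.indicator x) := by
  classical
  funext q
  rw [Finset.sum_apply]
  simp only [rowBlock, Set.indicator_apply, Set.mem_ofPred_eq, Pi.add_apply, Pi.sub_apply]
  by_cases hq : q.1.1 = q.1.2
  · simp [hq]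
  · rw [if_neg hq, sub_zero]
    have : ∀ i, (if q.1.1 = i ∨ q.1.2 = i then x q else 0) =
        (if q.1.1 = i then x q else 0) + if q.1.2 = i then x q else 0 := by
      intro i
      by_cases h1 : q.1.1 = i <;> by_cases h2 : q.1.2 = i
      · exact absurd (h1.trans h2.symm) hq
      all_goals simp [h1, h2]
    simp [this, Finset.sum_add_distrib]

lemma quadForm_diagonal_le (x : UpperIndex n → ℝ) (s : HalfSphere n) :
    quadForm n ({p : UpperIndex n | p.1.1 = p.1.2}.indicator x) s ≤ diagBound n x := by
  classical
  have h1 : ∀ i, ∑ j, symmMatrix n ({p : UpperIndex n | p.1.1 = p.1.2}.indicator x) i j *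
      s.1 i * s.1 j = symmMatrix n x i i * (s.1 i * s.1 i) := fun i => by
    rw [Finset.sum_eq_single i]
    · simp [symmMatrix, mul_assoc]
    · intro j _ hj
      have : min i j ≠ max i j := by
        rcases lt_or_gt_of_ne hj with hc | hc
        · rw [min_eq_right hc.le, max_eq_left hc.le]; exact hc.ne
        · rw [min_eq_left hc.le, max_eq_right hc.le]; exact hc.ne
      simp [symmMatrix, this]
    · simp
  unfold quadForm
  simp only [h1]
  have h2 : ∑ i, s.1 i * s.1 i = 1 := s.dotProduct_self
  calc _ ≤ ∑ i, diagBound n x * (s.1 i * s.1 i) := Finset.sum_le_sum fun i _ =>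
        mul_le_mul_of_nonneg_right
        (by rw [symmMatrix_diag]; exact (le_abs_self _).trans (abs_diag_le_diagBound x i))
        (mul_self_nonneg _)
    _ = diagBound n x := by rw [← Finset.mul_sum, h2, mul_one]

lemma sum_blockValue (h : Centered P) (hw : WellPosed P (quadForm n)) {L : Type*} [Fintype L]
    (J : L → Set (UpperIndex n)) :
    ∑ l, ∫ x, quadForm n ((J l).indicator x) (optimizer (quadForm n) x) ∂(entryLaw P n) =
      ∫ x, quadForm n (∑ l, (J l).indicator x) (optimizer (quadForm n) x) ∂(entryLaw P n) := by
  simp only [quadForm_sum]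
  exact (integral_finsetSum _ fun l _ => h.integrable_blockValue hw (J l)).symm

lemma quadForm_optimizer (x : UpperIndex n → ℝ) :
    quadForm n x (optimizer (quadForm n) x) = minEig n x :=
  IsMinimizer.quadForm_eq (optimizer_isMinimizer x)

lemma neg_integral_minEig_le (h : Centered P) {B : ℝ}
    (hB : ∫ x, max (-minEig n x) 0 ∂(entryLaw P n) ≤ B) :
    -∫ x, minEig n x ∂(entryLaw P n) ≤ B := by
  have hi := (h.integrable_minEig n).neg
  rw [← integral_neg]
  exact (integral_mono hi (hi.sup (integrable_zero _ _ _)) fun x => le_max_left _ _).trans hB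

lemma le_card_upperIndex (n : ℕ) : n + 1 ≤ Fintype.card (UpperIndex n) := by
  have := Fintype.card_le_of_injective
    (fun i : Fin (n + 1) => (⟨(i, i), le_rfl⟩ : UpperIndex n)) fun i j hij =>
      congrArg (fun p : UpperIndex n => p.1.1) hij
  rwa [Fintype.card_fin] at this

instance (n : ℕ) : Nonempty (UpperIndex n) := ⟨⟨(0, 0), le_rfl⟩⟩

/-- The smallest eigenvalue problem is stable when single entries are replaced. -/
theorem stable_entryBlock (h : Centered P) (hw : ∀ n, WellPosed P (quadForm n))
    (hτ : 0 < secondMoment P) :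
    StableUnderSmallPerturbations.{u} P quadForm entryBlock := by
  obtain ⟨C, hC, hCn⟩ := h.exists_minEig_bound
  refine stable_of_blockValue h hw hτ entryBlock hC fun n => ?_
  rw [sum_blockValue h (hw n)]
  simp only [sum_indicator_entryBlock, quadForm_optimizer]
  -- Only the crude count of at least `n + 1` entries is used: it already gives `√(n+1) ≤ card /
  -- √(n+1)`.
  refine (neg_integral_minEig_le h (hCn n)).trans (mul_le_mul_of_nonneg_left ?_ hC.le)
  refine (Real.div_sqrt (x := (n : ℝ) + 1)).symm.trans_le ?_
  refine div_le_div_of_nonneg_right ?_ (Real.sqrt_nonneg _)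
  exact_mod_cast le_card_upperIndex n

/-- The smallest eigenvalue problem is stable when rows and columns are replaced. -/
theorem stable_rowBlock (h : Centered P) (hw : ∀ n, WellPosed P (quadForm n))
    (hτ : 0 < secondMoment P) :
    StableUnderSmallPerturbations.{u} P quadForm rowBlock := by
  obtain ⟨C, hC, hCn⟩ := h.exists_minEig_bound
  refine stable_of_blockValue h hw hτ rowBlock (C := 2 * C + (1 + secondMoment P) / 2)
    (by positivity) fun n => ?_
  rw [sum_blockValue h (hw n), Fintype.card_fin]
  obtain ⟨hd, hdi⟩ := h.diagBound_integral n
  have hm := h.integrable_minEig n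
  have hdiag := h.integrable_blockValue (hw n) {p | p.1.1 = p.1.2}
  simp only [sum_indicator_rowBlock, quadForm_add, quadForm_sub, quadForm_optimizer]
  have h3 := integral_add hm (hm.sub hdiag)
  simp only [Pi.sub_apply] at h3
  rw [h3, integral_sub hm hdiag]
  have h1 := neg_integral_minEig_le h (hCn n)
  have h2 := integral_mono hdiag hd fun x => quadForm_diagonal_le x _
  rw [hdi] at h2
  push_cast
  rw [Real.div_sqrt]
  linarith

end Stability

/-- A vanishing second moment would concentrate the law at zero, which a density forbids. Positivity
drives the gain from a fresh row. -/
lemma secondMoment_pos {P : Measure ℝ} [IsProbabilityMeasure P] (h : Centered P)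
    (hP : P ≪ volume) : 0 < secondMoment P := by
  refine (integral_nonneg fun t => sq_nonneg t).lt_of_ne fun h0 => ?_
  have h1 := (integral_eq_zero_iff_of_nonneg (fun t => sq_nonneg t) (h.integrable_pow 2)).1 h0.symm
  have h2 : ∀ᵐ t ∂P, t ≠ 0 := hP.ae_le (Measure.ae_ne volume 0)
  obtain ⟨t, ht1, ht2⟩ := (h1.and h2).exists
  exact ht2 (by simpa using ht1)

lemma centered_of_abs_moments {P : Measure ℝ} [IsProbabilityMeasure P]
    (hmean : ∫ t, t ∂P = 0) (hmom : ∀ k : ℕ, 1 ≤ k → Integrable (fun t => |t| ^ k) P) :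
    Centered P where
  integrable_pow k := by
    rcases Nat.eq_zero_or_pos k with rfl | hk
    · simp
    · refine (hmom k hk).mono' (by fun_prop) (ae_of_all _ fun t => ?_)
      rw [Real.norm_eq_abs, abs_pow]
  mean := hmean

end Wigner

theorem mainTheorem12
    (P : Measure ℝ) [IsProbabilityMeasure P]
    (f : ℝ → ENNReal) (hf : Measurable f) (hP : P = volume.withDensity f)
    (hmean : ∫ t, t ∂P = 0)
    (σ β : ℝ) (hσ : 0 < σ) (hβ : 0 < β)
    (hmom : ∀ k : ℕ, 1 ≤ k →
      Integrable (fun t => |t| ^ k) P ∧ ∫ t, |t| ^ k ∂P ≤ σ ^ k * (k : ℝ) ^ (β * (k : ℝ))) :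
    (∀ n : ℕ, RandomOpt.WellPosed P (Wigner.quadForm n)) ∧
    RandomOpt.StableUnderSmallPerturbations.{u} P Wigner.quadForm Wigner.entryBlock ∧
    RandomOpt.StableUnderSmallPerturbations.{u} P Wigner.quadForm Wigner.rowBlock := by
  have h := Wigner.centered_of_abs_moments hmean fun k hk => (hmom k hk).1
  have hac : P ≪ volume := hP ▸ withDensity_absolutelyContinuous volume f
  have hτ := Wigner.secondMoment_pos h hac
  have hw := fun n => h.wellPosed hac n
  exact ⟨hw, Wigner.stable_entryBlock h hw hτ, Wigner.stable_rowBlock h hw hτ⟩
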